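/- Let $d\ge 2$ be an integer and $\beta\ge\frac{2-d}{4}$ a real number with $(d,\beta)\ne(2,0)$. For $s>0$ write $\phi_s(r)=\sqrt{s^2+r^2}$ and $D=\sqrt{-\Delta}$ on $\mathbb R^d$, and let $e^{it\phi_s(D)}$ and $\phi_s(D)^\alpha$ be the Fourier multiplier operators on $\mathbb R^d$ with symbols $e^{it\phi_s(|\xi|)}$ and $\phi_s(|\xi|)^\alpha$. Let $|\square-(2s)^2|^\beta$ be the space-time Fourier multiplier operator with symbol $\left|\tau^2-|\xi|^2-(2s)^2\right|^\beta$, $(\tau,\xi)\in\mathbb R\times\mathbb R^d$. Data are functions $f\in L^2(\mathbb R^d)$ with $\|\phi_s(D)^{\frac{d-1}{4}+\beta}f\|_{L^2(\mathbb R^d)}<\infty$. Then: (i) There is a constant $C>0$, depending only on $d$ and $\beta$, such that for every $s>0$ $$\big\||\square-(2s)^2|^{\beta}\big(e^{it\phi_s(D)}f\; e^{it\phi_s(D)}g\big)\big\|_{L^2(\mathbb R^{d+1})}\le C\,\|\phi_s(D)^{\frac{d-1}{4}+\beta}f\|_{L^2(\mathbb R^d)}\,\|\phi_s(D)^{\frac{d-1}{4}+\beta}g\|_{L^2(\mathbb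 R^d)}\qquad(*)$$ for all radially symmetric data $f,g$. (ii) If moreover $\beta\in[\frac{2-d}{4},\frac{3-d}{4}]\cup[\frac{5-d}{4},\infty)$, then for every $s>0$ the optimal (smallest) constant $C$ in $(*)$ for radially symmetric $f,g$ is $\mathbf F_{(++)}(\beta,d)^{1/2}$, where $$\mathbf F_{(++)}(\beta,d)=2^{-1+4\beta}\,\pi^{\frac{-d+1}{2}}\,\frac{\Gamma(d-2+2\beta)}{\Gamma(\frac{3d-5}{2}+2\beta)},$$ and there are no radially symmetric data $f\neq 0$, $g\ne0$ for which equality holds in $(*)$ with $C=\mathbf F_{(++)}(\beta,d)^{1/2}$. -/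

import Mathlib

open MeasureTheory FourierTransform
open scoped ENNReal

noncomputable section

namespace KleinGordon

/-- Euclidean space `ℝᵈ`. -/
abbrev E (d : ℕ) : Type := EuclideanSpace ℝ (Fin d)

/-- Complex-valued `L²(ℝᵈ)` for Lebesgue measure. -/
abbrev L2 (d : ℕ) : Type := Lp ℂ 2 (volume : Measure (E d))

/-- `φ_s(r) = √(s² + r²)`. -/
def phi (s r : ℝ) : ℝ := Real.sqrt (s ^ 2 + r ^ 2)

/-- Mathlib's Fourier transform `𝓕` on `L²` has the kernel `exp (-2πi x·ξ)`, so that `D = √(-Δ)` is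
the multiplier `2π‖ξ‖` and `exp (i t φ_s(D))` is the multiplier `exp (i t φ_s(2π‖ξ‖))`. -/
def propagatorSymbol {d : ℕ} (s t : ℝ) (ξ : E d) : ℂ :=
  Complex.exp (Complex.I * ((t * phi s (2 * Real.pi * ‖ξ‖) : ℝ) : ℂ))

theorem memLp_propagatorSymbol_mul {d : ℕ} (s t : ℝ) (h : L2 d) :
    MemLp (fun ξ => propagatorSymbol s t ξ * h ξ) 2 (volume : Measure (E d)) := by
  have hc : Continuous (propagatorSymbol s t : E d → ℂ) := by
    unfold propagatorSymbol phi
    fun_prop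
  refine (Lp.memLp h).of_le (hc.aestronglyMeasurable.mul (Lp.aestronglyMeasurable h)) ?_
  refine Filter.Eventually.of_forall fun ξ => ?_
  have h1 : ‖propagatorSymbol s t ξ‖ = 1 := by
    unfold propagatorSymbol
    rw [mul_comm]
    exact Complex.norm_exp_ofReal_mul_I _
  rw [norm_mul, h1, one_mul]

/-- The Klein--Gordon propagator `exp (i t φ_s(D)) f`, for `f ∈ L²(ℝᵈ)`. -/
def propagator {d : ℕ} (s t : ℝ) (f : L2 d) : L2 d :=
  𝓕⁻ ((memLp_propagatorSymbol_mul s t (𝓕 f)).toLp _ : L2 d)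

/-- `‖φ_s(D)^α f‖_{L²(ℝᵈ)}`, with value `∞` when `φ_s(D)^α f` is not in `L²`. -/
def sobolevNorm {d : ℕ} (s α : ℝ) (f : L2 d) : ℝ≥0∞ :=
  eLpNorm (fun ξ : E d => ((phi s (2 * Real.pi * ‖ξ‖) ^ α : ℝ) : ℂ) * (𝓕 f : L2 d) ξ) 2 volume

/-- `f` is radially symmetric: it is invariant under every orthogonal transformation of `ℝᵈ`. -/
def IsRadial {d : ℕ} (f : L2 d) : Prop :=
  ∀ A : E d ≃ₗᵢ[ℝ] E d, (fun x => f (A x)) =ᵐ[volume] f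

/-- The space-time Fourier transform `∫∫ exp (-i (tτ + x·ξ)) ψ(τ, ξ) dξ dτ`, at the point `(t, x)`,
of a test function `ψ` of the frequency variables `(τ, ξ)`. -/
def testFourier {d : ℕ} (ψ : ℝ × E d → ℂ) (t : ℝ) (x : E d) : ℂ :=
  ∫ p : ℝ × E d, Complex.exp (-Complex.I * ((t * p.1 + inner ℝ x p.2 : ℝ) : ℂ)) * ψ p

/-- The locally integrable function `W(τ, ξ)` is the space-time Fourier transform, in the sense of
distributions, of the function `U(t, x)` on `ℝ × ℝᵈ`: `∫ W ψ = ∫ U ψ̃` for every test function. -/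
def IsSpaceTimeFourier {d : ℕ} (U : ℝ → E d → ℂ) (W : ℝ × E d → ℂ) : Prop :=
  LocallyIntegrable W volume ∧
    ∀ ψ : ℝ × E d → ℂ, ContDiff ℝ (⊤ : ℕ∞) ψ → HasCompactSupport ψ →
      ∫ p, W p * ψ p = ∫ t : ℝ, ∫ x : E d, U t x * testFourier ψ t x

/-- A space-time Fourier transform is unique up to null sets. -/
theorem IsSpaceTimeFourier.ae_eq {d : ℕ} {U : ℝ → E d → ℂ} {W W' : ℝ × E d → ℂ}
    (h : IsSpaceTimeFourier U W) (h' : IsSpaceTimeFourier U W') : W =ᵐ[volume] W' := by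
  refine ae_eq_of_integral_contDiff_smul_eq h.1 h'.1 fun g hg hgc => ?_
  have hg1 : ContDiff ℝ (⊤ : ℕ∞) fun p => ((g p : ℝ) : ℂ) := Complex.ofRealCLM.contDiff.comp hg
  have hg2 : HasCompactSupport fun p => ((g p : ℝ) : ℂ) :=
    hgc.comp_left (g := fun r : ℝ => (r : ℂ)) Complex.ofReal_zero
  have e := (h.2 _ hg1 hg2).trans (h'.2 _ hg1 hg2).symm
  simpa only [Complex.real_smul, mul_comm] using e

/-- The `L²(ℝᵈ⁺¹)` norm of `|□ - (2s)²|^β (exp (i t φ_s(D)) f · exp (i t φ_s(D)) g)`, where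
`|□ - (2s)²|^β` is the space-time Fourier multiplier `|τ² - |ξ|² - (2s)²|^β`. By Plancherel's theorem
it is `(2π)^(-(d+1)/2)` times the `L²` norm of `|τ² - |ξ|² - (2s)²|^β W`, where `W` is the
space-time Fourier transform of the product. As `W` is unique up to null sets, the infimum runs over
at most one value; it is `∞` if the space-time Fourier transform is not a function. -/
def nullFormNorm {d : ℕ} (s β : ℝ) (f g : L2 d) : ℝ≥0∞ :=
  ⨅ (W : ℝ × E d → ℂ)
    (_ : IsSpaceTimeFourier (fun t x => propagator s t f x * propagator s t g x) W),
    ENNReal.ofReal ((2 * Real.pi) ^ (-((d : ℝ) + 1) / 2)) *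
      eLpNorm (fun p : ℝ × E d =>
        ((|p.1 ^ 2 - ‖p.2‖ ^ 2 - (2 * s) ^ 2| ^ β : ℝ) : ℂ) * W p) 2 volume

/-- The data: radially symmetric `f` with `‖φ_s(D)^((d-1)/4+β) f‖_{L²} < ∞`. -/
def IsRadialDatum {d : ℕ} (s β : ℝ) (f : L2 d) : Prop :=
  IsRadial f ∧ sobolevNorm s (((d : ℝ) - 1) / 4 + β) f < ⊤

/-- The `(++)` null-form estimate with constant `C` for all radially symmetric data. -/
def RadialEstimate (d : ℕ) (s β C : ℝ) : Prop :=
  ∀ f g : L2 d, IsRadialDatum s β f → IsRadialDatum s β g →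
    nullFormNorm s β f g ≤ ENNReal.ofReal C *
      sobolevNorm s (((d : ℝ) - 1) / 4 + β) f * sobolevNorm s (((d : ℝ) - 1) / 4 + β) g

/-- The constant `F₍₊₊₎(β, d)`. -/
def Fpp (β : ℝ) (d : ℕ) : ℝ :=
  2 ^ (-1 + 4 * β) * Real.pi ^ ((-(d : ℝ) + 1) / 2) *
    (Real.Gamma ((d : ℝ) - 2 + 2 * β) / Real.Gamma ((3 * (d : ℝ) - 5) / 2 + 2 * β))

end KleinGordon

end

noncomputable section

namespace KleinGordon

/-! Write d = n + 1 and p = 2β + n/2 − 1; the exponent p governs everything. On the Fourier side the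
product of two solutions lives on sums of two points of the hyperboloid. The product of the
invariant measures is pushed forward by the sum map to an explicit density (`lintegral_phi_add_phi`,
`measurePreserving_sumMap`): along lines parallel to ξ the sum of the two weights is a sum of
distances to two foci, and an elliptic substitution evaluates the integral. Hence the space-time
transform of the product is this density times the fibre average of f̂ ĝ φ_s φ_s
(`isSpaceTimeFourier_of`), and Cauchy–Schwarz on the fibres (`exists_condExp`) bounds the null-form
norm by an integral of |f̂|²|ĝ|² against a kernel (`nullFormNorm_sq_le`).

With A = τ² − |ξ|² − 4s², the kernel is a constant times A^(p+1/2) (A + 4s²)^(−1/2) φ_s φ_s, which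
is strictly less than the same constant times (A + 2s²)^p φ_s φ_s (`bilinKernel_lt`). Since A + 2s²
= 2 φ_s φ_s (1 − r), where r is the inner product of the frequencies divided by the weights, the
powers of the weights separate and only (1 − r)^p couples the two frequencies. For radial data η₂
may be replaced by −η₂. The symmetrized function (1 − r)^p + (1 + r)^p increases with |r| when p ≤ 0
or p ≥ 1, by convexity, and |r| is at most the absolute value of the cosine of the angle
(`lintegral_ratio_le`). Rotation invariance turns the cosine integral into a spherical average,
which is a quotient of Gamma functions (`sphereAverage_spec`, `const_eq`). When 0 < p < 1 the crude
bound 1 − r ≤ 2 still gives a constant independent of s. The strict kernel bound excludes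
extremizers.

For optimality, data with f̂ = e^(−aφ_s)/φ_s make f̂ ĝ φ_s φ_s constant on the fibres, so that
Cauchy–Schwarz is an equality (`nullFormNorm_testData`). After rescaling frequencies only e = 2as
remains, so a → 0 is the massless limit: A + 2s² and A + 4s² both become A, and r becomes the
cosine. Dominated convergence for the norms and Fatou's lemma for the bilinear integral give the
lower bound (`Fpp_le_of_radialEstimate`). -/

/-! ### Convolution of two hyperboloid measures in elliptic coordinates. -/

theorem lintegral_eq_two_mul_Ioi_of_even {f : ℝ → ℝ≥0∞} (hf : ∀ x, f (-x) = f x) :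
    ∫⁻ x, f x = 2 * ∫⁻ x in Set.Ioi 0, f x := by
  have h1 : ∫⁻ x, f x = (∫⁻ x in Set.Ioi 0, f x) + ∫⁻ x in Set.Iic 0, f x := by
    rw [← lintegral_add_compl f (measurableSet_Ioi (a := (0 : ℝ))), Set.compl_Ioi]
  have h2 : ∫⁻ x in Set.Iic 0, f x = ∫⁻ x in Set.Ioi 0, f x := by
    rw [setLIntegral_congr Iio_ae_eq_Iic.symm]
    have h := (Measure.measurePreserving_neg (volume : Measure ℝ)).setLIntegral_comp_emb
      (Homeomorph.neg ℝ).measurableEmbedding f (Set.Ioi 0)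
    rw [Set.image_neg_eq_neg, Set.neg_Ioi, neg_zero] at h
    simpa [hf] using h.symm
  rw [h1, h2, two_mul]

/-- The sum of the distances from `(x, a)` to the two foci `(±k, 0)`. -/
def focalSum (a k x : ℝ) : ℝ := √(a ^ 2 + (x + k) ^ 2) + √(a ^ 2 + (x - k) ^ 2)

theorem focalSum_neg (a k x : ℝ) : focalSum a k (-x) = focalSum a k x := by
  unfold focalSum
  rw [add_comm]
  congr 3 <;> ring

theorem focalSum_pos {a : ℝ} (ha : 0 < a) (k x : ℝ) : 0 < focalSum a k x := by
  unfold focalSum; positivity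

theorem continuous_focalSum (a k : ℝ) : Continuous (focalSum a k) := by
  unfold focalSum; fun_prop

/-- The foci are 2|k| apart and a > 0 keeps the point off their axis, so the triangle inequality is
strict. This is the sign of the derivative below. -/
theorem focalSum_sq_sub_pos {a : ℝ} (ha : 0 < a) (k x : ℝ) :
    0 < focalSum a k x ^ 2 - 4 * k ^ 2 := by
  unfold focalSum
  have hP : √(a ^ 2 + (x + k) ^ 2) ^ 2 = a ^ 2 + (x + k) ^ 2 := Real.sq_sqrt (by positivity)
  have hM : √(a ^ 2 + (x - k) ^ 2) ^ 2 = a ^ 2 + (x - k) ^ 2 := Real.sq_sqrt (by positivity)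
  have h1 : |x + k| ≤ √(a ^ 2 + (x + k) ^ 2) := Real.abs_le_sqrt (by nlinarith)
  have h2 : |x - k| ≤ √(a ^ 2 + (x - k) ^ 2) := Real.abs_le_sqrt (by nlinarith)
  have h3 := mul_le_mul h1 h2 (abs_nonneg _) (Real.sqrt_nonneg _)
  rw [← abs_mul] at h3
  have h4 := neg_abs_le ((x + k) * (x - k))
  nlinarith [pow_pos ha 2]

/-- With P and M the two distances, the derivative is (x(P + M) + k(M − P))/(PM), and P² − M² = 4kx
removes the difference M − P. The factored form makes the sign visible and cancels the weight 1/(PM)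
in the substitution. -/
theorem hasDerivAt_focalSum {a : ℝ} (ha : 0 < a) (k x : ℝ) :
    HasDerivAt (focalSum a k) (x * (focalSum a k x ^ 2 - 4 * k ^ 2) /
      (focalSum a k x * (√(a ^ 2 + (x + k) ^ 2) * √(a ^ 2 + (x - k) ^ 2)))) x := by
  have h1 : HasDerivAt (fun x => √(a ^ 2 + (x + k) ^ 2))
      ((2 * (x + k)) / (2 * √(a ^ 2 + (x + k) ^ 2))) x := by
    refine HasDerivAt.sqrt ?_ (by positivity)
    simpa using ((hasDerivAt_id x).add_const k).pow 2 |>.const_add (a ^ 2)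
  have h2 : HasDerivAt (fun x => √(a ^ 2 + (x - k) ^ 2))
      ((2 * (x - k)) / (2 * √(a ^ 2 + (x - k) ^ 2))) x := by
    refine HasDerivAt.sqrt ?_ (by positivity)
    simpa using ((hasDerivAt_id x).sub_const k).pow 2 |>.const_add (a ^ 2)
  refine (h1.add h2).congr_deriv ?_
  have hP0 : 0 < √(a ^ 2 + (x + k) ^ 2) := by positivity
  have hM0 : 0 < √(a ^ 2 + (x - k) ^ 2) := by positivity
  have hP : √(a ^ 2 + (x + k) ^ 2) ^ 2 = a ^ 2 + (x + k) ^ 2 := Real.sq_sqrt (by positivity)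
  have hM : √(a ^ 2 + (x - k) ^ 2) ^ 2 = a ^ 2 + (x - k) ^ 2 := Real.sq_sqrt (by positivity)
  unfold focalSum
  set P := √(a ^ 2 + (x + k) ^ 2)
  set M := √(a ^ 2 + (x - k) ^ 2)
  have : P + M ≠ 0 := by positivity
  field_simp
  linear_combination (k) * hM - (k) * hP

theorem image_focalSum {a : ℝ} (ha : 0 < a) (k : ℝ) :
    focalSum a k '' Set.Ioi 0 = Set.Ioi (2 * √(a ^ 2 + k ^ 2)) ∧
      Set.InjOn (focalSum a k) (Set.Ioi 0) := by
  have hmono : StrictMonoOn (focalSum a k) (Set.Ici 0) := by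
    refine strictMonoOn_of_deriv_pos (convex_Ici 0) (continuous_focalSum a k).continuousOn ?_
    intro x hx
    rw [interior_Ici, Set.mem_Ioi] at hx
    rw [(hasDerivAt_focalSum ha k x).deriv]
    have := focalSum_sq_sub_pos ha k x
    have := focalSum_pos ha k x
    positivity
  have h0 : focalSum a k 0 = 2 * √(a ^ 2 + k ^ 2) := by
    simp only [focalSum, zero_add, zero_sub, even_two, Even.neg_pow]
    ring
  refine ⟨?_, (hmono.mono Set.Ioi_subset_Ici_self).injOn⟩
  ext τ
  constructor
  · rintro ⟨x, hx, rfl⟩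
    rw [← h0]
    exact hmono (Set.mem_Ici.2 le_rfl) (Set.mem_Ici.2 (le_of_lt hx)) hx
  · intro hτ
    rw [Set.mem_Ioi, ← h0] at hτ
    have hτ0 : 0 ≤ |τ| := abs_nonneg τ
    have hb : τ ≤ focalSum a k |τ| := by
      unfold focalSum
      have h1 : |τ| + k ≤ √(a ^ 2 + (|τ| + k) ^ 2) := Real.le_sqrt_of_sq_le (by nlinarith)
      have h2 : |τ| - k ≤ √(a ^ 2 + (|τ| - k) ^ 2) := Real.le_sqrt_of_sq_le (by nlinarith)
      linarith [le_abs_self τ]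
    obtain ⟨x, hx, hxe⟩ := intermediate_value_Icc hτ0 (continuous_focalSum a k).continuousOn
      ⟨hτ.le, hb⟩
    refine ⟨x, lt_of_le_of_ne hx.1 ?_, hxe⟩
    rintro rfl
    exact hτ.ne hxe

/-- The substitution τ = P + M on x > 0. Evenness of the integrand accounts for one factor 2 of the
4, and the ellipse identity for the other. -/
theorem lintegral_focalSum {a : ℝ} (ha : 0 < a) (k : ℝ) (G : ℝ → ℝ≥0∞) :
    ∫⁻ x, G (focalSum a k x) *
        ENNReal.ofReal (1 / (√(a ^ 2 + (x + k) ^ 2) * √(a ^ 2 + (x - k) ^ 2))) =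
      ∫⁻ τ in Set.Ioi 0, G τ *
        ENNReal.ofReal (4 / (√(τ ^ 2 - 4 * k ^ 2) * √(τ ^ 2 - 4 * k ^ 2 - 4 * a ^ 2))) := by
  have hR : ∫⁻ τ in Set.Ioi 0, G τ *
        ENNReal.ofReal (4 / (√(τ ^ 2 - 4 * k ^ 2) * √(τ ^ 2 - 4 * k ^ 2 - 4 * a ^ 2))) =
      ∫⁻ τ in Set.Ioi (2 * √(a ^ 2 + k ^ 2)), G τ *
        ENNReal.ofReal (4 / (√(τ ^ 2 - 4 * k ^ 2) * √(τ ^ 2 - 4 * k ^ 2 - 4 * a ^ 2))) := by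
    rw [← lintegral_indicator measurableSet_Ioi, ← lintegral_indicator measurableSet_Ioi]
    refine lintegral_congr fun τ => ?_
    have hs : √(a ^ 2 + k ^ 2) ^ 2 = a ^ 2 + k ^ 2 := Real.sq_sqrt (by positivity)
    have hs0 : 0 < √(a ^ 2 + k ^ 2) := by positivity
    by_cases h1 : τ ∈ Set.Ioi (2 * √(a ^ 2 + k ^ 2))
    · rw [Set.indicator_of_mem h1, Set.indicator_of_mem]
      exact lt_trans (by positivity) (Set.mem_Ioi.1 h1)
    · rw [Set.indicator_of_notMem h1]
      by_cases h2 : τ ∈ Set.Ioi (0 : ℝ)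
      · rw [Set.indicator_of_mem h2]
        rw [Set.mem_Ioi] at h1 h2
        -- Below the minimal focal sum the real square root is 0 and division by it gives 0, so the
        -- right side may be written over all τ > 0.
        have : τ ^ 2 - 4 * k ^ 2 - 4 * a ^ 2 ≤ 0 := by nlinarith
        rw [Real.sqrt_eq_zero'.2 this]
        simp
      · rw [Set.indicator_of_notMem h2]
  obtain ⟨him, hinj⟩ := image_focalSum ha k
  rw [hR, ← him, lintegral_image_eq_lintegral_abs_deriv_mul measurableSet_Ioi
    (fun x _ => (hasDerivAt_focalSum ha k x).hasDerivWithinAt) hinj,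
    lintegral_eq_two_mul_Ioi_of_even, ← lintegral_const_mul' _ _ (by simp)]
  · refine setLIntegral_congr_fun measurableSet_Ioi fun x hx => ?_
    rw [Set.mem_Ioi] at hx
    have hm := focalSum_sq_sub_pos ha k x
    have ht := focalSum_pos ha k x
    have hP0 : 0 < √(a ^ 2 + (x + k) ^ 2) := by positivity
    have hM0 : 0 < √(a ^ 2 + (x - k) ^ 2) := by positivity
    have hP : √(a ^ 2 + (x + k) ^ 2) ^ 2 = a ^ 2 + (x + k) ^ 2 := Real.sq_sqrt (by positivity)
    have hM : √(a ^ 2 + (x - k) ^ 2) ^ 2 = a ^ 2 + (x - k) ^ 2 := Real.sq_sqrt (by positivity)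
    have hfs : focalSum a k x = √(a ^ 2 + (x + k) ^ 2) + √(a ^ 2 + (x - k) ^ 2) := rfl
    set P := √(a ^ 2 + (x + k) ^ 2)
    set M := √(a ^ 2 + (x - k) ^ 2)
    set t := focalSum a k x
    -- The equation of the ellipse with foci ±k, solved for x in terms of the sum of distances t.
    have key : t ^ 2 - 4 * k ^ 2 - 4 * a ^ 2 = (2 * x * √(t ^ 2 - 4 * k ^ 2) / t) ^ 2 := by
      rw [div_pow, mul_pow, Real.sq_sqrt hm.le, eq_div_iff (by positivity), hfs]
      have h4 : P ^ 2 * M ^ 2 = (a ^ 2 + (x + k) ^ 2) * (a ^ 2 + (x - k) ^ 2) := by rw [hP, hM]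
      have h5 : (P + M) ^ 2 = 2 * a ^ 2 + 2 * x ^ 2 + 2 * k ^ 2 + 2 * (P * M) := by
        linear_combination hP + hM
      rw [h5]
      linear_combination 4 * h4
    have hr : √(t ^ 2 - 4 * k ^ 2 - 4 * a ^ 2) = 2 * x * √(t ^ 2 - 4 * k ^ 2) / t := by
      rw [key, Real.sqrt_sq (by positivity)]
    have hq : 0 < √(t ^ 2 - 4 * k ^ 2) := Real.sqrt_pos.2 hm
    have hqq : √(t ^ 2 - 4 * k ^ 2) ^ 2 = t ^ 2 - 4 * k ^ 2 := Real.sq_sqrt hm.le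
    set q := √(t ^ 2 - 4 * k ^ 2)
    have e2 : (2 : ℝ≥0∞) = ENNReal.ofReal 2 := by simp
    have e3 : 2 * ENNReal.ofReal (1 / (P * M)) = ENNReal.ofReal (2 * (1 / (P * M))) := by
      rw [e2, ← ENNReal.ofReal_mul (by norm_num)]
    change 2 * (G t * ENNReal.ofReal (1 / (P * M))) = _
    rw [mul_left_comm, e3, hr, ← hqq, abs_of_pos (by positivity), mul_left_comm,
      ← ENNReal.ofReal_mul (by positivity)]
    congr 2
    field_simp
    ring
  · intro x
    rw [focalSum_neg]
    congr 3
    rw [mul_comm]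
    congr 3 <;> ring

/-- `∫_{|y| < 1} (1 - |y|²)^(-1/2) dy` over `ℝⁿ`; the square root is `0` for `|y| > 1`. -/
def ballConst (n : ℕ) : ℝ≥0∞ := ∫⁻ y : E n, ENNReal.ofReal (1 / √(1 - ‖y‖ ^ 2))

theorem lintegral_comp_smul_E {n : ℕ} (f : E n → ℝ≥0∞) {r : ℝ} (hr : 0 < r) :
    ∫⁻ y, f y = ENNReal.ofReal (r ^ n) * ∫⁻ y, f (r • y) := by
  have h := Measure.map_addHaar_smul (volume : Measure (E n)) hr.ne'
  have h2 : ∫⁻ y, f (r • y) = ∫⁻ y, f y ∂(Measure.map (r • ·) (volume : Measure (E n))) := by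
    have := (Homeomorph.smulOfNeZero r hr.ne' : E n ≃ₜ E n).measurableEmbedding.lintegral_map
      (μ := volume) f
    exact this.symm
  rw [h2, h, lintegral_smul_measure, finrank_euclideanSpace_fin, smul_eq_mul, ← mul_assoc,
    ← ENNReal.ofReal_mul (by positivity), abs_of_pos (by positivity),
    mul_inv_cancel₀ (by positivity), ENNReal.ofReal_one, one_mul]

theorem lintegral_inv_sqrt_sub (n : ℕ) {A : ℝ} (hA : 0 < A) :
    ∫⁻ y : E n, ENNReal.ofReal (1 / √(A - 4 * ‖y‖ ^ 2)) =
      ENNReal.ofReal ((√A / 2) ^ n / √A) * ballConst n := by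
  have hA' : 0 < √A := Real.sqrt_pos.2 hA
  rw [lintegral_comp_smul_E _ (half_pos hA'), ballConst, ← lintegral_const_mul' _ _ (by simp),
    ← lintegral_const_mul' _ _ (by simp)]
  refine lintegral_congr fun y => ?_
  rw [← ENNReal.ofReal_mul (by positivity), ← ENNReal.ofReal_mul (by positivity)]
  congr 1
  have : A - 4 * ‖(√A / 2) • y‖ ^ 2 = A * (1 - ‖y‖ ^ 2) := by
    rw [norm_smul, mul_pow, Real.norm_eq_abs, sq_abs, div_pow, Real.sq_sqrt hA.le]
    ring
  rw [this, Real.sqrt_mul hA.le]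
  simp only [div_eq_mul_inv, mul_inv]
  ring

/-- The point `(x, y)` of `ℝⁿ⁺¹ = ℝ × ℝⁿ`. -/
def consE {n : ℕ} (x : ℝ) (y : E n) : E (n + 1) := WithLp.toLp 2 (Fin.cons x y.ofLp)

theorem continuous_consE {n : ℕ} : Continuous fun q : ℝ × E n => consE q.1 q.2 := by
  refine (PiLp.continuous_toLp 2 _).comp (continuous_pi fun i => ?_)
  refine Fin.cases ?_ (fun j => ?_) i
  · exact continuous_fst
  · simp only [Fin.cons_succ]; fun_prop

theorem norm_consE_sq {n : ℕ} (x : ℝ) (y : E n) : ‖consE x y‖ ^ 2 = x ^ 2 + ‖y‖ ^ 2 := by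
  simp [consE, EuclideanSpace.norm_sq_eq, Fin.sum_univ_succ]

theorem lintegral_consE {n : ℕ} {H : E (n + 1) → ℝ≥0∞} (hH : Measurable H) :
    ∫⁻ η, H η = ∫⁻ y : E n, ∫⁻ x : ℝ, H (consE x y) := by
  rw [← (PiLp.volume_preserving_toLp (Fin (n + 1))).lintegral_comp hH,
    ← (volume_preserving_piFinSuccAbove (fun _ : Fin (n + 1) => ℝ) 0).symm.lintegral_comp_emb
      (MeasurableEquiv.measurableEmbedding _)]
  have hm : Measurable fun a : ℝ × (Fin n → ℝ) => H (WithLp.toLp 2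
      ((MeasurableEquiv.piFinSuccAbove (fun _ : Fin (n + 1) => ℝ) 0).symm a)) :=
    hH.comp ((PiLp.continuous_toLp 2 _).measurable.comp (MeasurableEquiv.measurable _))
  rw [Measure.volume_eq_prod, lintegral_prod_symm _ hm.aemeasurable]
  rw [← (PiLp.volume_preserving_toLp (Fin n)).lintegral_comp (f := fun y : E n =>
    ∫⁻ x : ℝ, H (consE x y))]
  · refine lintegral_congr fun y => lintegral_congr fun x => ?_
    congr 2
    ext i
    refine Fin.cases ?_ (fun j => ?_) i <;> simp [MeasurableEquiv.piFinSuccAbove,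
      Fin.insertNthEquiv]
  · exact Measurable.lintegral_prod_left' (f := fun q : ℝ × E n => H (consE q.1 q.2))
      (hH.comp continuous_consE.measurable)

/-- The first basis vector of `ℝⁿ⁺¹`. -/
def e0 {n : ℕ} : E (n + 1) := consE 1 0

theorem norm_e0 {n : ℕ} : ‖(e0 : E (n + 1))‖ = 1 := by
  have := norm_consE_sq (n := n) 1 0
  rw [norm_zero] at this
  have h0 := norm_nonneg (e0 : E (n + 1))
  change ‖(e0 : E (n + 1))‖ ^ 2 = _ at this
  nlinarith

/-- The reflection in the hyperplane orthogonal to v − w exchanges two vectors of equal length. -/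
theorem exists_isometry_map {d : ℕ} {v w : E d} (h : ‖v‖ = ‖w‖) :
    ∃ A : E d ≃ₗᵢ[ℝ] E d, A v = w := ⟨_, Submodule.reflection_sub h⟩

theorem consE_add_smul_e0 {n : ℕ} (k x : ℝ) (y : E n) :
    consE x y + k • e0 = consE (x + k) y := by
  ext i
  refine Fin.cases ?_ (fun j => ?_) i <;> simp [consE, e0]

theorem inner_consE_e0 {n : ℕ} (x : ℝ) (y : E n) : inner ℝ (consE x y) e0 = x := by
  simp [consE, e0, PiLp.inner_apply, Fin.sum_univ_succ]

/-- The density of the image of `dη₁ dη₂ / (φ_s(|η₁|) φ_s(|η₂|))` under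
`(η₁, η₂) ↦ (φ_s(|η₁|) + φ_s(|η₂|), η₁ + η₂)`, at `(τ, ξ)` with `τ > 0` and `|ξ| = r`. -/
def density (n : ℕ) (s τ r : ℝ) : ℝ≥0∞ :=
  ENNReal.ofReal (4 / √(τ ^ 2 - r ^ 2) *
    ((√(τ ^ 2 - r ^ 2 - 4 * s ^ 2) / 2) ^ n / √(τ ^ 2 - r ^ 2 - 4 * s ^ 2))) * ballConst n

/-- The variable y transverse to ξ enters the elliptic formula through a² = s² + |y|²; rescaling by
half the square root of τ² − r² − 4s² reduces its integral to `ballConst`. When that quantity is not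
positive, both sides vanish by the convention for the square root. -/
theorem lintegral_eq_density {n : ℕ} (s τ r : ℝ) :
    ∫⁻ y : E n, ENNReal.ofReal (4 / (√(τ ^ 2 - r ^ 2) *
      √(τ ^ 2 - r ^ 2 - 4 * (s ^ 2 + ‖y‖ ^ 2)))) = density n s τ r := by
  have h1 : ∀ y : E n, ENNReal.ofReal (4 / (√(τ ^ 2 - r ^ 2) *
      √(τ ^ 2 - r ^ 2 - 4 * (s ^ 2 + ‖y‖ ^ 2)))) = ENNReal.ofReal (4 / √(τ ^ 2 - r ^ 2)) *
        ENNReal.ofReal (1 / √(τ ^ 2 - r ^ 2 - 4 * s ^ 2 - 4 * ‖y‖ ^ 2)) := by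
    intro y
    rw [← ENNReal.ofReal_mul (by positivity)]
    congr 1
    rw [div_mul_div_comm, mul_one]
    congr 3
    ring
  rw [lintegral_congr h1, lintegral_const_mul' _ _ (by simp), density]
  rcases lt_or_ge 0 (τ ^ 2 - r ^ 2 - 4 * s ^ 2) with h | h
  · rw [lintegral_inv_sqrt_sub n h, ENNReal.ofReal_mul (by positivity), mul_assoc]
  · have h2 : ∀ y : E n, ENNReal.ofReal (1 / √(τ ^ 2 - r ^ 2 - 4 * s ^ 2 - 4 * ‖y‖ ^ 2)) = 0 := by
      intro y
      rw [Real.sqrt_eq_zero'.2 (by nlinarith [sq_nonneg ‖y‖])]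
      simp
    rw [lintegral_congr h2, Real.sqrt_eq_zero'.2 h]
    simp

theorem measurable_phi (s : ℝ) : Measurable (phi s) := by
  unfold phi; fun_prop

/-- The image of `dη / (φ_s(|η|) φ_s(|ξ - η|))` under `η ↦ φ_s(|η|) + φ_s(|ξ - η|)`. -/
theorem lintegral_phi_add_phi {n : ℕ} (hn : 1 ≤ n) (s : ℝ) (ξ : E (n + 1)) {G : ℝ → ℝ≥0∞}
    (hG : Measurable G) :
    ∫⁻ η, G (phi s ‖η‖ + phi s ‖ξ - η‖) *
        ENNReal.ofReal (1 / (phi s ‖η‖ * phi s ‖ξ - η‖)) =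
      ∫⁻ τ in Set.Ioi 0, G τ * density n s τ ‖ξ‖ := by
  have : NeZero n := ⟨by omega⟩
  set k : ℝ := ‖ξ‖ / 2 with hk
  -- Rotate ξ onto the first axis; shifting η by ξ/2 then puts the foci at ±k.
  obtain ⟨A, hA⟩ := exists_isometry_map (v := (2 * k) • (e0 : E (n + 1))) (w := ξ) (by
    rw [norm_smul, norm_e0, hk, Real.norm_eq_abs, abs_of_nonneg (by positivity)]; ring)
  set B : E (n + 1) → ℝ≥0∞ := fun η => G (phi s ‖η‖ + phi s ‖ξ - η‖) *
        ENNReal.ofReal (1 / (phi s ‖η‖ * phi s ‖ξ - η‖)) with hB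
  have hmphi := measurable_phi s
  have hBm : Measurable B := by
    refine Measurable.mul (hG.comp ?_) (Measurable.ennreal_ofReal ?_) <;> fun_prop
  have hAm : Measurable A := A.continuous.measurable
  have e1 : ∫⁻ η, B η = ∫⁻ ζ, B (A (ζ + k • e0)) := by
    rw [← A.measurePreserving.lintegral_comp hBm]
    exact (lintegral_add_right_eq_self (fun ζ => B (A ζ)) (k • e0)).symm
  have e2 : ∀ (y : E n) (x : ℝ), B (A (consE x y + k • e0)) =
      G (focalSum (√(s ^ 2 + ‖y‖ ^ 2)) k x) * ENNReal.ofReal (1 /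
        (√(√(s ^ 2 + ‖y‖ ^ 2) ^ 2 + (x + k) ^ 2) * √(√(s ^ 2 + ‖y‖ ^ 2) ^ 2 + (x - k) ^ 2))) := by
    intro y x
    have h1 : phi s ‖A (consE x y + k • e0)‖ = √(√(s ^ 2 + ‖y‖ ^ 2) ^ 2 + (x + k) ^ 2) := by
      rw [A.norm_map, consE_add_smul_e0, phi, norm_consE_sq, Real.sq_sqrt (by positivity)]
      congr 1; ring
    have h2 : phi s ‖ξ - A (consE x y + k • e0)‖ =
        √(√(s ^ 2 + ‖y‖ ^ 2) ^ 2 + (x - k) ^ 2) := by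
      rw [← hA, ← map_sub, A.norm_map, ← norm_neg]
      have : -((2 * k) • e0 - (consE x y + k • e0)) = consE x y + (-k) • e0 := by module
      rw [this, consE_add_smul_e0, phi, norm_consE_sq, Real.sq_sqrt (by positivity)]
      congr 1; ring
    simp only [hB, h1, h2, focalSum]
  have hmeas : Measurable fun ζ => B (A (ζ + k • e0)) := hBm.comp (hAm.comp (by fun_prop))
  rw [e1, lintegral_consE hmeas]
  have e3 : ∀ᵐ y : E n, ∫⁻ x : ℝ, B (A (consE x y + k • e0)) =
      ∫⁻ τ in Set.Ioi 0, G τ * ENNReal.ofReal (4 / (√(τ ^ 2 - ‖ξ‖ ^ 2) *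
        √(τ ^ 2 - ‖ξ‖ ^ 2 - 4 * (s ^ 2 + ‖y‖ ^ 2)))) := by
    -- For s = 0 the parameter a vanishes at y = 0. Discarding this null set keeps s = 0 admissible,
    -- the case from which polar coordinates are derived.
    have hae : ∀ᵐ y : E n, y ≠ 0 := by
      have : Nontrivial (E n) := inferInstance
      exact (measure_eq_zero_iff_ae_notMem.1 (measure_singleton (0 : E n)))
    filter_upwards [hae] with y hy
    have ha : 0 < √(s ^ 2 + ‖y‖ ^ 2) := Real.sqrt_pos.2 (by
      have := norm_pos_iff.2 hy; positivity)
    rw [lintegral_congr (e2 y), lintegral_focalSum ha]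
    refine lintegral_congr fun τ => ?_
    rw [Real.sq_sqrt (by positivity), hk]
    congr 5 <;> ring
  rw [lintegral_congr_ae e3, lintegral_lintegral_swap]
  · refine lintegral_congr fun τ => ?_
    rw [lintegral_const_mul, lintegral_eq_density]
    fun_prop
  · refine Measurable.aemeasurable (Measurable.mul (hG.comp measurable_snd) ?_)
    fun_prop

/-! ### Polar coordinates and the integrals behind the spherical average. -/

theorem lintegral_Ioi_comp_div_two (f : ℝ → ℝ≥0∞) :
    ∫⁻ τ in Set.Ioi 0, f (τ / 2) = 2 * ∫⁻ R in Set.Ioi 0, f R := by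
  have him : (fun R : ℝ => 2 * R) '' Set.Ioi 0 = Set.Ioi 0 := by
    ext x
    constructor
    · rintro ⟨y, hy, rfl⟩
      have : 0 < y := hy
      exact Set.mem_Ioi.2 (by simpa using this)
    · intro hx
      exact ⟨x / 2, half_pos (Set.mem_Ioi.1 hx), by ring⟩
  rw [← lintegral_const_mul' _ _ (by simp)]
  conv_lhs => rw [← him]
  rw [lintegral_image_eq_lintegral_abs_deriv_mul measurableSet_Ioi (f' := fun _ => 2)
    (fun x _ => (((hasDerivAt_id' x).const_mul 2).congr_deriv (by simp)).hasDerivWithinAt)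
    (fun x _ y _ h => by simpa using h)]
  simp

/-- Integration of a radial function. -/
theorem lintegral_norm_E {n : ℕ} (hn : 1 ≤ n) {F : ℝ → ℝ≥0∞} (hF : Measurable F) :
    ∫⁻ x : E (n + 1), F ‖x‖ =
      2 * ballConst n * ∫⁻ R in Set.Ioi 0, F R * ENNReal.ofReal (R ^ n) := by
  -- In the case s = 0, ξ = 0 the sum of the weights is 2‖x‖. The factor (τ/2)² compensates the
  -- weight 1/(‖x‖‖x‖).
  have h := lintegral_phi_add_phi hn 0 (0 : E (n + 1))
    (G := fun τ => F (τ / 2) * ENNReal.ofReal ((τ / 2) ^ 2)) (by fun_prop)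
  have hphi : ∀ r : ℝ, 0 ≤ r → phi 0 r = r := fun r hr => by simp [phi, Real.sqrt_sq hr]
  have e1 : ∀ᵐ x : E (n + 1), F ‖x‖ = F ((phi 0 ‖x‖ + phi 0 ‖0 - x‖) / 2) *
      ENNReal.ofReal (((phi 0 ‖x‖ + phi 0 ‖0 - x‖) / 2) ^ 2) *
      ENNReal.ofReal (1 / (phi 0 ‖x‖ * phi 0 ‖0 - x‖)) := by
    filter_upwards [measure_eq_zero_iff_ae_notMem.1 (measure_singleton (0 : E (n + 1)))]
      with x hx
    have hx0 : 0 < ‖x‖ := norm_pos_iff.2 hx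
    rw [zero_sub, norm_neg, hphi _ hx0.le, mul_assoc, ← ENNReal.ofReal_mul (by positivity)]
    have : ((‖x‖ + ‖x‖) / 2) ^ 2 * (1 / (‖x‖ * ‖x‖)) = 1 := by field_simp; ring
    rw [this, ENNReal.ofReal_one, mul_one]
    congr 1; ring
  rw [lintegral_congr_ae e1, h]
  have e2 : ∀ τ ∈ Set.Ioi (0 : ℝ), F (τ / 2) * ENNReal.ofReal ((τ / 2) ^ 2) *
      density n 0 τ ‖(0 : E (n + 1))‖ =
      ballConst n * (F (τ / 2) * ENNReal.ofReal ((τ / 2) ^ n)) := by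
    intro τ hτ
    rw [Set.mem_Ioi] at hτ
    have h1 : τ ^ 2 - ‖(0 : E (n + 1))‖ ^ 2 = τ ^ 2 := by simp
    have h2 : τ ^ 2 - 4 * (0 : ℝ) ^ 2 = τ ^ 2 := by simp
    have h3 : (τ / 2) ^ n = (τ / 2) ^ 2 * (4 / τ * ((τ / 2) ^ n / τ)) := by
      field_simp
      ring
    have h4 : ENNReal.ofReal ((τ / 2) ^ n) =
        ENNReal.ofReal ((τ / 2) ^ 2) * ENNReal.ofReal (4 / τ * ((τ / 2) ^ n / τ)) := by
      rw [← ENNReal.ofReal_mul (by positivity), ← h3]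
    rw [density, h1, h2, Real.sqrt_sq hτ.le, h4]
    ring
  rw [setLIntegral_congr_fun measurableSet_Ioi e2, lintegral_const_mul _ (by fun_prop),
    lintegral_Ioi_comp_div_two (fun R => F R * ENNReal.ofReal (R ^ n))]
  ring

theorem lintegral_rpow_mul_exp {a r : ℝ} (ha : 0 < a) (hr : 0 < r) :
    ∫⁻ t in Set.Ioi 0, ENNReal.ofReal (t ^ (a - 1) * Real.exp (-(r * t))) =
      ENNReal.ofReal ((1 / r) ^ a * Real.Gamma a) := by
  have h := Real.integral_rpow_mul_exp_neg_mul_Ioi ha hr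
  rw [← h, ofReal_integral_eq_lintegral_ofReal]
  · refine Integrable.of_integral_ne_zero ?_
    rw [h]
    have := Real.Gamma_pos_of_pos ha
    positivity
  · filter_upwards [ae_restrict_mem measurableSet_Ioi] with t ht
    have : 0 < t := ht
    exact (by positivity : (0 : ℝ) ≤ t ^ (a - 1) * Real.exp (-(r * t)))

theorem lintegral_norm_rpow_mul_exp {n : ℕ} (hn : 1 ≤ n) {p : ℝ} (hp : 0 < p + n) :
    ∫⁻ x : E (n + 1), ENNReal.ofReal (‖x‖ ^ (p - 1) * Real.exp (-‖x‖)) =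
      2 * ballConst n * ENNReal.ofReal (Real.Gamma (p + n)) := by
  rw [lintegral_norm_E hn (F := fun R => ENNReal.ofReal (R ^ (p - 1) * Real.exp (-R)))
    (by fun_prop)]
  congr 1
  have h := lintegral_rpow_mul_exp hp one_pos
  simp only [one_mul, div_one, Real.one_rpow] at h
  rw [← h]
  refine setLIntegral_congr_fun measurableSet_Ioi fun t ht => ?_
  have ht0 : 0 < t := ht
  change ENNReal.ofReal _ * ENNReal.ofReal _ = ENNReal.ofReal _
  rw [← ENNReal.ofReal_mul (by positivity)]
  congr 1
  have : p + n - 1 = p - 1 + n := by ring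
  rw [this, Real.rpow_add ht0, Real.rpow_natCast]
  ring

/-- Otherwise the polar formula would give the whole space measure zero. -/
theorem ballConst_pos {n : ℕ} (hn : 1 ≤ n) : ballConst n ≠ 0 := by
  intro h
  have h1 := lintegral_norm_E hn (F := fun _ => 1) measurable_const
  rw [h] at h1
  simp at h1

theorem lintegral_gaussian_E {n : ℕ} {b : ℝ} (hb : 0 < b) :
    ∫⁻ x : E n, ENNReal.ofReal (Real.exp (-b * ‖x‖ ^ 2)) =
      ENNReal.ofReal ((Real.pi / b) ^ ((n : ℝ) / 2)) := by
  have h := GaussianFourier.integral_rexp_neg_mul_sq_norm (V := E n) hb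
  rw [finrank_euclideanSpace_fin] at h
  rw [← h, ofReal_integral_eq_lintegral_ofReal]
  · refine Integrable.of_integral_ne_zero ?_
    rw [h]
    have := Real.pi_pos
    positivity
  · exact Filter.Eventually.of_forall fun x => (Real.exp_pos _).le

/-- The Gaussian has a finite integral and a positive radial part, so the factor in front of its
polar integral is finite. -/
theorem ballConst_ne_top {n : ℕ} (hn : 1 ≤ n) : ballConst n ≠ ⊤ := by
  have h1 := lintegral_gaussian_E (n := n + 1) one_pos
  rw [lintegral_norm_E hn (F := fun R => ENNReal.ofReal (Real.exp (-1 * R ^ 2)))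
    (by fun_prop)] at h1
  have hpos : 0 < (Real.pi / 1) ^ (((n + 1 : ℕ) : ℝ) / 2) := by
    have := Real.pi_pos
    positivity
  intro h
  rw [h, ENNReal.mul_top (by simp)] at h1
  by_cases h0 : ∫⁻ R in Set.Ioi 0, ENNReal.ofReal (Real.exp (-1 * R ^ 2)) *
    ENNReal.ofReal (R ^ n) = 0
  · rw [h0, mul_zero, eq_comm, ENNReal.ofReal_eq_zero] at h1
    exact absurd h1 (not_le.2 hpos)
  · rw [ENNReal.top_mul h0] at h1
    exact ENNReal.ofReal_ne_top h1.symm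

theorem hasDerivAt_sqrt_sub {R : ℝ} (hR : 0 < R) (x : ℝ) :
    HasDerivAt (fun x => √(R ^ 2 + x ^ 2) - x)
      (-(√(R ^ 2 + x ^ 2) - x) / √(R ^ 2 + x ^ 2)) x := by
  have h1 : HasDerivAt (fun x => √(R ^ 2 + x ^ 2)) ((2 * x) / (2 * √(R ^ 2 + x ^ 2))) x := by
    refine HasDerivAt.sqrt ?_ (by positivity)
    simpa using ((hasDerivAt_id x).pow 2).const_add (R ^ 2)
  refine (h1.sub (hasDerivAt_id' x)).congr_deriv ?_
  have : 0 < √(R ^ 2 + x ^ 2) := by positivity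
  field_simp
  ring

theorem sqrt_sub_pos {R : ℝ} (hR : 0 < R) (x : ℝ) : 0 < √(R ^ 2 + x ^ 2) - x := by
  have h : |x| < √(R ^ 2 + x ^ 2) := by
    rw [← Real.sqrt_sq_eq_abs]
    exact Real.sqrt_lt_sqrt (sq_nonneg x) (by nlinarith [pow_pos hR 2])
  linarith [le_abs_self x]

/-- The substitution `u = √(R² + x²) - x`. -/
theorem lintegral_sqrt_sub {R : ℝ} (hR : 0 < R) (p : ℝ) :
    ∫⁻ x : ℝ, ENNReal.ofReal (√(R ^ 2 + x ^ 2) - x) ^ p *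
        ENNReal.ofReal (Real.exp (-√(R ^ 2 + x ^ 2)) / √(R ^ 2 + x ^ 2)) =
      ∫⁻ u in Set.Ioi 0, ENNReal.ofReal (u ^ (p - 1) * Real.exp (-(1 / 2 * u))) *
        ENNReal.ofReal (Real.exp (-(1 / (2 * u)) * R ^ 2)) := by
  -- With u = √(R² + x²) − x, the conjugate √(R² + x²) + x equals R²/u. Hence u determines x, and
  -- √(R² + x²) = u/2 + R²/(2u), which splits the exponential into a function of u times a Gaussian
  -- in R.
  have hinv : ∀ x : ℝ, R ^ 2 = (√(R ^ 2 + x ^ 2) - x) * (√(R ^ 2 + x ^ 2) - x + 2 * x) := by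
    intro x
    have : √(R ^ 2 + x ^ 2) ^ 2 = R ^ 2 + x ^ 2 := Real.sq_sqrt (by positivity)
    linear_combination -this
  have hinj : Set.InjOn (fun x => √(R ^ 2 + x ^ 2) - x) Set.univ := by
    intro x _ y _ hxy
    have h1 := hinv x
    have h2 := hinv y
    have hp := sqrt_sub_pos hR y
    change √(R ^ 2 + x ^ 2) - x = √(R ^ 2 + y ^ 2) - y at hxy
    rw [hxy] at h1
    have h3 := mul_left_cancel₀ hp.ne' (h1.symm.trans h2)
    linarith
  have him : (fun x => √(R ^ 2 + x ^ 2) - x) '' Set.univ = Set.Ioi 0 := by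
    ext u
    constructor
    · rintro ⟨x, -, rfl⟩
      exact sqrt_sub_pos hR x
    · intro hu
      have hu : 0 < u := hu
      refine ⟨(R ^ 2 / u - u) / 2, trivial, ?_⟩
      have : R ^ 2 + ((R ^ 2 / u - u) / 2) ^ 2 = ((R ^ 2 / u + u) / 2) ^ 2 := by
        field_simp
        ring
      change √(R ^ 2 + ((R ^ 2 / u - u) / 2) ^ 2) - _ = u
      rw [this, Real.sqrt_sq (by positivity)]
      ring
  rw [← him, lintegral_image_eq_lintegral_abs_deriv_mul MeasurableSet.univ
    (fun x _ => (hasDerivAt_sqrt_sub hR x).hasDerivWithinAt) hinj, setLIntegral_univ]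
  refine lintegral_congr fun x => ?_
  have hu := sqrt_sub_pos hR x
  have hq : 0 < √(R ^ 2 + x ^ 2) := by positivity
  have h1 := hinv x
  have h3 : R ^ 2 / (√(R ^ 2 + x ^ 2) - x) = √(R ^ 2 + x ^ 2) + x := by
    rw [div_eq_iff hu.ne']
    linarith
  set q := √(R ^ 2 + x ^ 2)
  change _ = ENNReal.ofReal |-(q - x) / q| * (ENNReal.ofReal ((q - x) ^ (p - 1) *
    Real.exp (-(1 / 2 * (q - x)))) * ENNReal.ofReal (Real.exp (-(1 / (2 * (q - x))) * R ^ 2)))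
  rw [ENNReal.ofReal_rpow_of_pos hu, ← ENNReal.ofReal_mul (by positivity),
    ← ENNReal.ofReal_mul (by positivity), ← ENNReal.ofReal_mul (by positivity), abs_div, abs_neg,
    abs_of_pos hu, abs_of_pos hq, mul_assoc, ← Real.exp_add, Real.rpow_sub_one hu.ne']
  congr 1
  have h4 : -(1 / 2 * (q - x)) + -(1 / (2 * (q - x))) * R ^ 2 = -q := by
    have : -(1 / (2 * (q - x))) * R ^ 2 = -(R ^ 2 / (q - x)) / 2 := by field_simp
    rw [this, h3]
    ring
  rw [h4]
  field_simp

/-- The weight against which spherical averages of `(1 - cos)^p` are computed. -/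
theorem lintegral_parabolic {n : ℕ} (hn : 1 ≤ n) {p : ℝ} (hp : 0 < p + n / 2) {e : E (n + 1)}
    (he : ‖e‖ = 1) :
    ∫⁻ x : E (n + 1), ENNReal.ofReal (‖x‖ - inner ℝ x e) ^ p *
        ENNReal.ofReal (Real.exp (-‖x‖) / ‖x‖) =
      ENNReal.ofReal ((2 * Real.pi) ^ ((n : ℝ) / 2) * 2 ^ (p + n / 2) *
        Real.Gamma (p + n / 2)) := by
  have : NeZero n := ⟨by omega⟩
  obtain ⟨A, hA⟩ := exists_isometry_map (v := (e0 : E (n + 1))) (w := e) (by rw [norm_e0, he])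
  have hm : Measurable fun x : E (n + 1) => ENNReal.ofReal (‖x‖ - inner ℝ x e) ^ p *
      ENNReal.ofReal (Real.exp (-‖x‖) / ‖x‖) := by fun_prop
  rw [← A.measurePreserving.lintegral_comp hm, ← hA]
  simp only [A.norm_map, A.inner_map_map]
  rw [lintegral_consE (by fun_prop)]
  have e3 : ∀ᵐ y : E n, ∫⁻ x : ℝ, ENNReal.ofReal (‖consE x y‖ - inner ℝ (consE x y) e0) ^ p *
      ENNReal.ofReal (Real.exp (-‖consE x y‖) / ‖consE x y‖) =
      ∫⁻ u in Set.Ioi 0, ENNReal.ofReal (u ^ (p - 1) * Real.exp (-(1 / 2 * u))) *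
        ENNReal.ofReal (Real.exp (-(1 / (2 * u)) * ‖y‖ ^ 2)) := by
    filter_upwards [measure_eq_zero_iff_ae_notMem.1 (measure_singleton (0 : E n))] with y hy
    rw [← lintegral_sqrt_sub (norm_pos_iff.2 hy)]
    refine lintegral_congr fun x => ?_
    have : ‖consE x y‖ = √(‖y‖ ^ 2 + x ^ 2) := by
      rw [← Real.sqrt_sq (norm_nonneg (consE x y)), norm_consE_sq, add_comm]
    rw [this, inner_consE_e0]
  -- After the exchange the transverse integral is a Gaussian of variance u. It contributes
  -- (2πu)^(n/2) and leaves a Gamma integral in u.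
  rw [lintegral_congr_ae e3, lintegral_lintegral_swap (by fun_prop)]
  have e4 : ∀ u ∈ Set.Ioi (0 : ℝ), ∫⁻ y : E n, ENNReal.ofReal (u ^ (p - 1) *
      Real.exp (-(1 / 2 * u))) * ENNReal.ofReal (Real.exp (-(1 / (2 * u)) * ‖y‖ ^ 2)) =
      ENNReal.ofReal ((2 * Real.pi) ^ ((n : ℝ) / 2)) *
        ENNReal.ofReal (u ^ (p + n / 2 - 1) * Real.exp (-(1 / 2 * u))) := by
    intro u hu
    have hu : 0 < u := hu
    have hpi := Real.pi_pos
    rw [lintegral_const_mul' _ _ (by simp), lintegral_gaussian_E (by positivity),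
      ← ENNReal.ofReal_mul (by positivity), ← ENNReal.ofReal_mul (by positivity)]
    congr 1
    have h1 : Real.pi / (1 / (2 * u)) = (2 * Real.pi) * u := by field_simp
    have h2 : p + n / 2 - 1 = (p - 1) + n / 2 := by ring
    rw [h1, Real.mul_rpow (by positivity) hu.le, h2, Real.rpow_add hu]
    ring
  rw [setLIntegral_congr_fun measurableSet_Ioi e4, lintegral_const_mul _ (by fun_prop),
    lintegral_rpow_mul_exp hp (by norm_num), ← ENNReal.ofReal_mul (by positivity)]
  congr 1
  norm_num
  ring

/-! ### The sum map and the push-forward of the product measure. -/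

/-- The symbol of `φ_s(D)` in the frequency variable of Mathlib's Fourier transform. -/
def weight {d : ℕ} (s : ℝ) (ξ : E d) : ℝ := phi s (2 * Real.pi * ‖ξ‖)

theorem continuous_weight {d : ℕ} (s : ℝ) : Continuous (weight s : E d → ℝ) := by
  unfold weight phi; fun_prop

theorem weight_pos {d : ℕ} {s : ℝ} (hs : 0 < s) (ξ : E d) : 0 < weight s ξ := by
  unfold weight phi; positivity

theorem le_weight {d : ℕ} (s : ℝ) (ξ : E d) : s ≤ weight s ξ :=
  Real.le_sqrt_of_sq_le (by nlinarith [sq_nonneg (2 * Real.pi * ‖ξ‖)])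

theorem weight_neg {d : ℕ} (s : ℝ) (ξ : E d) : weight s (-ξ) = weight s ξ := by
  simp [weight]

theorem weight_sq {d : ℕ} (s : ℝ) (ξ : E d) :
    weight s ξ ^ 2 = s ^ 2 + (2 * Real.pi * ‖ξ‖) ^ 2 := Real.sq_sqrt (by positivity)

/-- The sum of two points of the hyperboloid. -/
def sumMap {d : ℕ} (s : ℝ) (q : E d × E d) : ℝ × E d :=
  (weight s q.1 + weight s q.2, (2 * Real.pi) • (q.1 + q.2))

theorem continuous_sumMap {d : ℕ} (s : ℝ) : Continuous (sumMap s : E d × E d → ℝ × E d) := by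
  have := continuous_weight (d := d) s
  unfold sumMap; fun_prop

/-- The product of the invariant measures of two copies of the hyperboloid. -/
def pairMeasure (d : ℕ) (s : ℝ) : Measure (E d × E d) :=
  volume.withDensity fun q => ENNReal.ofReal (1 / (weight s q.1 * weight s q.2))

/-- The density of the image of `pairMeasure` under `sumMap`. -/
def sumDensity (n : ℕ) (s : ℝ) (p : ℝ × E (n + 1)) : ℝ≥0∞ :=
  if 0 < p.1 then
    ENNReal.ofReal (((2 * Real.pi) ^ (n + 1) * (2 * Real.pi) ^ (n + 1))⁻¹) *
      density n s p.1 ‖p.2‖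
  else 0

theorem measurable_density {n : ℕ} (s : ℝ) :
    Measurable fun p : ℝ × E (n + 1) => density n s p.1 ‖p.2‖ := by
  unfold density; fun_prop

theorem measurable_sumDensity {n : ℕ} (s : ℝ) : Measurable (sumDensity n s) := by
  unfold sumDensity
  refine Measurable.ite (measurableSet_lt measurable_const measurable_fst) ?_ measurable_const
  exact (measurable_density s).const_mul _

theorem sumDensity_ne_top {n : ℕ} (hn : 1 ≤ n) (s : ℝ) (p : ℝ × E (n + 1)) :
    sumDensity n s p ≠ ⊤ := by
  unfold sumDensity density
  split_ifs
  · exact ENNReal.mul_ne_top (by simp) (ENNReal.mul_ne_top (by simp) (ballConst_ne_top hn))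
  · simp

theorem lintegral_lintegral_phi {n : ℕ} (hn : 1 ≤ n) (s : ℝ) {G : ℝ × E (n + 1) → ℝ≥0∞}
    (hG : Measurable G) :
    ∫⁻ η₁ : E (n + 1), ∫⁻ η₂ : E (n + 1), G (phi s ‖η₁‖ + phi s ‖η₂‖, η₁ + η₂) *
        ENNReal.ofReal (1 / (phi s ‖η₁‖ * phi s ‖η₂‖)) =
      ∫⁻ ξ : E (n + 1), ∫⁻ τ in Set.Ioi 0, G (τ, ξ) * density n s τ ‖ξ‖ := by
  have hmphi := measurable_phi s
  have e1 : ∀ η₁ : E (n + 1), ∫⁻ η₂ : E (n + 1), G (phi s ‖η₁‖ + phi s ‖η₂‖, η₁ + η₂) *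
        ENNReal.ofReal (1 / (phi s ‖η₁‖ * phi s ‖η₂‖)) =
      ∫⁻ ξ : E (n + 1), G (phi s ‖η₁‖ + phi s ‖ξ - η₁‖, ξ) *
        ENNReal.ofReal (1 / (phi s ‖η₁‖ * phi s ‖ξ - η₁‖)) := by
    intro η₁
    rw [← lintegral_sub_right_eq_self (fun η₂ => G (phi s ‖η₁‖ + phi s ‖η₂‖, η₁ + η₂) *
        ENNReal.ofReal (1 / (phi s ‖η₁‖ * phi s ‖η₂‖))) η₁]
    refine lintegral_congr fun ξ => ?_
    rw [add_sub_cancel]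
  rw [lintegral_congr e1, lintegral_lintegral_swap]
  · exact lintegral_congr fun ξ =>
      lintegral_phi_add_phi hn s ξ (G := fun τ => G (τ, ξ)) (by fun_prop)
  · refine Measurable.aemeasurable (Measurable.mul (hG.comp ?_) ?_) <;> fun_prop

/-- Each of the two frequencies is rescaled by 2π in dimension n + 1; this is the inverse constant
built into `sumDensity`. -/
theorem lintegral_sumMap {n : ℕ} (hn : 1 ≤ n) (s : ℝ) {G : ℝ × E (n + 1) → ℝ≥0∞}
    (hG : Measurable G) :
    ∫⁻ q : E (n + 1) × E (n + 1), ENNReal.ofReal (1 / (weight s q.1 * weight s q.2)) *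
        G (sumMap s q) = ∫⁻ p, sumDensity n s p * G p := by
  have h2 : (0 : ℝ) < 2 * Real.pi := by positivity
  have hmw : Measurable (weight s : E (n + 1) → ℝ) := (continuous_weight s).measurable
  have hms : Measurable (sumMap s : E (n + 1) × E (n + 1) → _) := (continuous_sumMap s).measurable
  set c : ℝ := (2 * Real.pi) ^ (n + 1) with hc
  have hc0 : 0 < c := by positivity
  have h := lintegral_lintegral_phi hn s hG
  rw [lintegral_comp_smul_E _ h2] at h
  have e1 : ∀ ξ₁ : E (n + 1), ∫⁻ η₂ : E (n + 1), G (phi s ‖(2 * Real.pi) • ξ₁‖ + phi s ‖η₂‖,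
        (2 * Real.pi) • ξ₁ + η₂) *
        ENNReal.ofReal (1 / (phi s ‖(2 * Real.pi) • ξ₁‖ * phi s ‖η₂‖)) =
      ENNReal.ofReal c * ∫⁻ ξ₂ : E (n + 1), ENNReal.ofReal (1 / (weight s ξ₁ * weight s ξ₂)) *
        G (sumMap s (ξ₁, ξ₂)) := by
    intro ξ₁
    rw [lintegral_comp_smul_E _ h2]
    congr 1
    refine lintegral_congr fun ξ₂ => ?_
    simp only [norm_smul, Real.norm_eq_abs, abs_of_pos h2, ← smul_add, sumMap, weight]
    rw [mul_comm]
  rw [lintegral_congr e1, lintegral_const_mul' _ _ (by simp), ← mul_assoc,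
    ← ENNReal.ofReal_mul hc0.le] at h
  rw [Measure.volume_eq_prod, lintegral_prod _ (by fun_prop), Measure.volume_eq_prod,
    lintegral_prod_symm (fun p => sumDensity n s p * G p)
      ((measurable_sumDensity s).mul hG).aemeasurable]
  have h3 : ∀ ξ : E (n + 1), ∫⁻ τ : ℝ, sumDensity n s (τ, ξ) * G (τ, ξ) =
      ENNReal.ofReal ((c * c)⁻¹) * ∫⁻ τ in Set.Ioi 0, G (τ, ξ) * density n s τ ‖ξ‖ := by
    intro ξ
    rw [← lintegral_const_mul' _ _ (by simp), ← lintegral_indicator measurableSet_Ioi]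
    refine lintegral_congr fun τ => ?_
    by_cases hτ : 0 < τ
    · rw [Set.indicator_of_mem (Set.mem_Ioi.2 hτ), sumDensity, if_pos hτ]
      ring
    · rw [Set.indicator_of_notMem (by simpa using hτ), sumDensity, if_neg hτ, zero_mul]
  rw [lintegral_congr h3, lintegral_const_mul' _ _ (by simp), ← h, ← mul_assoc,
    ← ENNReal.ofReal_mul (by positivity), inv_mul_cancel₀ (by positivity), ENNReal.ofReal_one,
    one_mul]

/-- The image of `pairMeasure` under `sumMap`. -/
def sumMeasure (n : ℕ) (s : ℝ) : Measure (ℝ × E (n + 1)) := volume.withDensity (sumDensity n s)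

theorem measurable_pairDensity {d : ℕ} (s : ℝ) : Measurable fun q : E d × E d =>
    ENNReal.ofReal (1 / (weight s q.1 * weight s q.2)) := by
  have hmw : Measurable (weight s : E d → ℝ) := (continuous_weight s).measurable
  fun_prop

theorem measurePreserving_sumMap {n : ℕ} (hn : 1 ≤ n) (s : ℝ) :
    MeasurePreserving (sumMap s) (pairMeasure (n + 1) s) (sumMeasure n s) := by
  have hms : Measurable (sumMap s : E (n + 1) × E (n + 1) → _) := (continuous_sumMap s).measurable
  refine ⟨hms, Measure.ext fun B hB => ?_⟩
  have h := lintegral_sumMap hn s (G := B.indicator 1) (measurable_one.indicator hB)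
  rw [Measure.map_apply hms hB, pairMeasure, sumMeasure, withDensity_apply _ (hms hB),
    withDensity_apply _ hB, ← lintegral_indicator hB, ← lintegral_indicator (hms hB)]
  rw [show (∫⁻ q, (sumMap s ⁻¹' B).indicator (fun q : E (n + 1) × E (n + 1) =>
    ENNReal.ofReal (1 / (weight s q.1 * weight s q.2))) q) = _ from lintegral_congr fun q => ?_, h]
  · refine lintegral_congr fun q => ?_
    by_cases hq : q ∈ B
    · rw [Set.indicator_of_mem hq, Set.indicator_of_mem hq, Pi.one_apply, mul_one]
    · rw [Set.indicator_of_notMem hq, Set.indicator_of_notMem hq, mul_zero]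
  · by_cases hq : sumMap s q ∈ B
    · rw [Set.indicator_of_mem (show q ∈ sumMap s ⁻¹' B from hq), Set.indicator_of_mem hq,
        Pi.one_apply, mul_one]
    · rw [Set.indicator_of_notMem (show q ∉ sumMap s ⁻¹' B from hq), Set.indicator_of_notMem hq,
        mul_zero]

/-! ### Conditional expectation along a measure-preserving map. -/

/-- The conditional expectation of a square-integrable function along a measure-preserving map, as
the adjoint of composition. -/
theorem exists_condExp {X Y : Type*} [MeasurableSpace X] [MeasurableSpace Y] {ν : Measure X}
    {lam : Measure Y} {Φ : X → Y} (hΦ : MeasurePreserving Φ ν lam) {h : X → ℂ}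
    (hh : MemLp h 2 ν) :
    ∃ H : Y → ℂ, MemLp H 2 lam ∧
      (∀ g : Y → ℂ, MemLp g 2 lam → ∫ y, g y * H y ∂lam = ∫ x, g (Φ x) * h x ∂ν) ∧
      ∀ w : Y → ℝ≥0∞, Measurable w →
        ∫⁻ y, w y * ‖H y‖ₑ ^ 2 ∂lam ≤ ∫⁻ x, w (Φ x) * ‖h x‖ₑ ^ 2 ∂ν := by
  set T := (Lp.compMeasurePreservingₗᵢ (E := ℂ) (p := 2) ℂ Φ hΦ).toContinuousLinearMap with hT
  set H : Lp ℂ 2 lam := ContinuousLinearMap.adjoint T (hh.toLp h) with hH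
  have hpair : ∀ g : Y → ℂ, MemLp g 2 lam →
      ∫ y, g y * H y ∂lam = ∫ x, g (Φ x) * h x ∂ν := by
    intro g hg
    have h1 := ContinuousLinearMap.adjoint_inner_right T (hg.star.toLp _) (hh.toLp h)
    rw [← hH, L2.inner_def, L2.inner_def] at h1
    have e1 : ∫ y, g y * H y ∂lam = ∫ y, inner ℂ ((hg.star.toLp _ : Lp ℂ 2 lam) y) (H y) ∂lam := by
      refine integral_congr_ae ?_
      filter_upwards [hg.star.coeFn_toLp] with y hy
      rw [hy]
      simp [mul_comm]
    rw [e1, h1]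
    refine integral_congr_ae ?_
    have e2 := Lp.coeFn_compMeasurePreserving (hg.star.toLp (star g)) hΦ
    filter_upwards [e2, hΦ.quasiMeasurePreserving.ae_eq_comp hg.star.coeFn_toLp,
      hh.coeFn_toLp] with x hx1 hx2 hx3
    have : (T (hg.star.toLp _) : X → ℂ) x = star (g (Φ x)) := hx1.trans hx2
    rw [this, hx3]
    simp [mul_comm]
  refine ⟨H, Lp.memLp H, hpair, fun w hw => ?_⟩
  have hHm : MemLp H 2 lam := Lp.memLp H
  have hHΦ : MemLp (fun x => H (Φ x)) 2 ν := hHm.comp_measurePreserving hΦ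
  -- The weighted inequality follows from a comparison of measures, so no integrability of the
  -- weighted function is needed. Pairing with the conjugate of H restricted to B and using 2|ab| ≤
  -- |a|² + |b|² bounds the integral of |H|² over B by half of itself plus half of the integral of
  -- |h|² over the preimage.
  have hle : lam.withDensity (fun y => ‖H y‖ₑ ^ 2) ≤
      (ν.withDensity fun x => ‖h x‖ₑ ^ 2).map Φ := by
    refine Measure.le_iff.2 fun B hB => ?_
    have hΦB := hΦ.measurable hB
    rw [Measure.map_apply hΦ.measurable hB, withDensity_apply _ hB, withDensity_apply _ hΦB]
    have h1 := hpair (B.indicator (star (H : Y → ℂ))) (hHm.star.indicator hB)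
    have i1 : Integrable (fun y => ‖H y‖ ^ 2) lam := (memLp_two_iff_integrable_sq_norm hHm.1).1 hHm
    have i2 : Integrable (fun x => ‖H (Φ x)‖ ^ 2) ν :=
      (memLp_two_iff_integrable_sq_norm hHΦ.1).1 hHΦ
    have i3 : Integrable (fun x => ‖h x‖ ^ 2) ν := (memLp_two_iff_integrable_sq_norm hh.1).1 hh
    have a1 : ∫ y, B.indicator (star (H : Y → ℂ)) y * H y ∂lam =
        ((∫ y in B, ‖H y‖ ^ 2 ∂lam : ℝ) : ℂ) := by
      rw [← integral_complex_ofReal, ← integral_indicator hB]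
      refine integral_congr_ae (Filter.Eventually.of_forall fun y => ?_)
      by_cases hy : y ∈ B
      · simp only [Set.indicator_of_mem hy, Pi.star_apply, RCLike.star_def]
        rw [← Complex.normSq_eq_conj_mul_self, Complex.normSq_eq_norm_sq]
      · simp [Set.indicator_of_notMem hy]
    have a2 : ‖∫ x, B.indicator (star (H : Y → ℂ)) (Φ x) * h x ∂ν‖ ≤
        ∫ x in Φ ⁻¹' B, (‖H (Φ x)‖ ^ 2 + ‖h x‖ ^ 2) / 2 ∂ν := by
      rw [← integral_indicator hΦB]
      refine norm_integral_le_of_norm_le (((i2.add i3).div_const 2).indicator hΦB)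
        (Filter.Eventually.of_forall fun x => ?_)
      by_cases hx : Φ x ∈ B
      · rw [Set.indicator_of_mem hx, Set.indicator_of_mem (show x ∈ Φ ⁻¹' B from hx), norm_mul,
          Pi.star_apply, norm_star]
        nlinarith [sq_nonneg (‖H (Φ x)‖ - ‖h x‖)]
      · simp [Set.indicator_of_notMem hx, Set.indicator_of_notMem (show x ∉ Φ ⁻¹' B from hx)]
    have a3 : ∫ x in Φ ⁻¹' B, ‖H (Φ x)‖ ^ 2 ∂ν = ∫ y in B, ‖H y‖ ^ 2 ∂lam := by
      have := setIntegral_map (μ := ν) (g := Φ) (f := fun y => ‖H y‖ ^ 2) hB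
        (by rw [hΦ.map_eq]; exact i1.1) hΦ.measurable.aemeasurable
      rw [← this, hΦ.map_eq]
    rw [← h1, a1, integral_div, integral_add i2.integrableOn i3.integrableOn, a3,
      Complex.norm_real, Real.norm_eq_abs] at a2
    have a4 : ∫ y in B, ‖H y‖ ^ 2 ∂lam ≤ ∫ x in Φ ⁻¹' B, ‖h x‖ ^ 2 ∂ν := by
      linarith [le_abs_self (∫ y in B, ‖H y‖ ^ 2 ∂lam)]
    have b1 := ofReal_integral_eq_lintegral_ofReal (i1.integrableOn (s := B)).integrable
      (Filter.Eventually.of_forall fun y => sq_nonneg ‖H y‖)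
    have b2 := ofReal_integral_eq_lintegral_ofReal (i3.integrableOn (s := Φ ⁻¹' B)).integrable
      (Filter.Eventually.of_forall fun y => sq_nonneg ‖h y‖)
    have b3 : ∀ z : ℂ, ‖z‖ₑ ^ 2 = ENNReal.ofReal (‖z‖ ^ 2) := fun z => by
      rw [ENNReal.ofReal_pow (norm_nonneg z), ofReal_norm]
    simp only [b3]
    rw [← b1, ← b2]
    exact ENNReal.ofReal_le_ofReal a4
  have hHe : AEMeasurable (fun y => ‖H y‖ₑ ^ 2) lam := hHm.1.enorm.pow_const 2
  have hhe : AEMeasurable (fun x => ‖h x‖ₑ ^ 2) ν := hh.1.enorm.pow_const 2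
  calc ∫⁻ y, w y * ‖H y‖ₑ ^ 2 ∂lam = ∫⁻ y, w y ∂(lam.withDensity fun y => ‖H y‖ₑ ^ 2) := by
        rw [lintegral_withDensity_eq_lintegral_mul₀ hHe hw.aemeasurable]
        simp [mul_comm]
    _ ≤ ∫⁻ y, w y ∂((ν.withDensity fun x => ‖h x‖ₑ ^ 2).map Φ) := lintegral_mono' hle le_rfl
    _ = ∫⁻ x, w (Φ x) * ‖h x‖ₑ ^ 2 ∂ν := by
        rw [lintegral_map hw hΦ.measurable, lintegral_withDensity_eq_lintegral_mul₀ hhe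
          (g := fun x => w (Φ x)) (hw.comp hΦ.measurable).aemeasurable]
        simp [mul_comm]

/-! ### Plancherel's theorem in bilinear form and the Fourier transform of radial functions. -/

theorem continuous_integral_mul {d : ℕ} (m : L2 d) :
    Continuous fun f : L2 d => ∫ x, f x * m x := by
  have h : (fun f : L2 d => ∫ x, f x * m x) =
      fun f => inner ℂ ((Lp.memLp m).star.toLp _ : L2 d) f := by
    ext f
    rw [L2.inner_def]
    refine integral_congr_ae ?_
    filter_upwards [(Lp.memLp m).star.coeFn_toLp] with x hx
    rw [hx]
    simp
  rw [h]
  fun_prop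

/-- The Fourier transform on L² is compatible with that of tempered distributions, which is defined
by this duality. -/
theorem integral_fourier_mul_schwartz {d : ℕ} (c : L2 d) (φ : SchwartzMap (E d) ℂ) :
    ∫ x, (𝓕 c : L2 d) x * φ x = ∫ x, c x * (𝓕 φ : SchwartzMap (E d) ℂ) x := by
  have h := DFunLike.congr_fun (Lp.fourier_toTemperedDistribution_eq c) φ
  rw [TemperedDistribution.fourier_apply, Lp.toTemperedDistribution_apply,
    Lp.toTemperedDistribution_apply] at h
  simpa [mul_comm] using h.symm

/-- The bilinear form of Plancherel's theorem. -/
theorem integral_fourierInv_mul_fourier {d : ℕ} (b c : L2 d) :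
    ∫ x, (𝓕⁻ b : L2 d) x * (𝓕 c : L2 d) x = ∫ x, b x * c x := by
  refine (SchwartzMap.denseRange_toLpCLM (E := E d) (F := ℂ) (μ := volume) (p := 2)
    ENNReal.ofNat_ne_top).induction_on (p := fun b : L2 d =>
      ∫ x, (𝓕⁻ b : L2 d) x * (𝓕 c : L2 d) x = ∫ x, b x * c x) b ?_ ?_
  · exact isClosed_eq ((continuous_integral_mul _).comp
      (ContinuousFourierInv.continuous_fourierInv (E := L2 d) (F := L2 d)))
      (continuous_integral_mul _)
  · intro φ
    rw [SchwartzMap.toLpCLM_apply, SchwartzMap.toLp_fourierInv_eq]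
    have h := integral_fourier_mul_schwartz c (𝓕⁻ φ : SchwartzMap (E d) ℂ)
    rw [FourierTransform.fourier_fourierInv_eq] at h
    have e1 : ∫ x, (((𝓕⁻ φ : SchwartzMap (E d) ℂ).toLp 2 volume : L2 d)) x * (𝓕 c : L2 d) x =
        ∫ x, (𝓕 c : L2 d) x * (𝓕⁻ φ : SchwartzMap (E d) ℂ) x := by
      refine integral_congr_ae ?_
      filter_upwards [(𝓕⁻ φ : SchwartzMap (E d) ℂ).coeFn_toLp 2 volume] with x hx
      rw [hx, mul_comm]
    have e2 : ∫ x, ((φ.toLp 2 volume : L2 d)) x * c x = ∫ x, c x * φ x := by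
      refine integral_congr_ae ?_
      filter_upwards [φ.coeFn_toLp 2 volume] with x hx
      rw [hx, mul_comm]
    rw [e1, e2, h]

theorem integral_fourier_mul_eq {d : ℕ} {f g : E d → ℂ} (hf : Integrable f) (hg : Integrable g) :
    ∫ x, 𝓕 f x * g x = ∫ x, f x * 𝓕 g x := by
  have h := VectorFourier.integral_fourierIntegral_smul_eq_flip (L := innerₗ (E d))
    Real.continuous_fourierChar continuous_inner hf hg
  rw [flip_innerₗ] at h
  exact h

theorem exists_schwartz {d : ℕ} {g : E d → ℝ} (hg : ContDiff ℝ (⊤ : ℕ∞) g)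
    (hgc : HasCompactSupport g) :
    ∃ φ : SchwartzMap (E d) ℂ, ∀ x, φ x = ((g x : ℝ) : ℂ) := by
  have hg1 : ContDiff ℝ (⊤ : ℕ∞) fun p => ((g p : ℝ) : ℂ) := Complex.ofRealCLM.contDiff.comp hg
  have hg2 : HasCompactSupport fun p => ((g p : ℝ) : ℂ) :=
    hgc.comp_left (g := fun r : ℝ => (r : ℂ)) Complex.ofReal_zero
  exact ⟨hg2.toSchwartzMap hg1, fun x => rfl⟩

theorem ae_eq_of_schwartz {d : ℕ} {f g : E d → ℂ} (hf : LocallyIntegrable f)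
    (hg : LocallyIntegrable g)
    (h : ∀ φ : SchwartzMap (E d) ℂ, ∫ x, f x * φ x = ∫ x, g x * φ x) : f =ᵐ[volume] g := by
  refine ae_eq_of_integral_contDiff_smul_eq hf hg fun u hu huc => ?_
  obtain ⟨φ, hφ⟩ := exists_schwartz hu huc
  have := h φ
  simp only [hφ] at this
  simpa only [Complex.real_smul, mul_comm] using this

theorem locallyIntegrable_L2 {d : ℕ} (f : L2 d) : LocallyIntegrable (f : E d → ℂ) :=
  (Lp.memLp f).locallyIntegrable (by norm_num)

theorem continuous_fourier {d : ℕ} {f : E d → ℂ} (hf : Integrable f) : Continuous (𝓕 f) :=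
  VectorFourier.fourierIntegral_continuous Real.continuous_fourierChar continuous_inner hf

/-- The `L²` Fourier transform agrees with the Fourier integral on `L¹ ∩ L²`. -/
theorem coeFn_fourier_toLp {d : ℕ} {f : E d → ℂ} (hf : Integrable f) (hf2 : MemLp f 2) :
    ((𝓕 (hf2.toLp f) : L2 d) : E d → ℂ) =ᵐ[volume] 𝓕 f := by
  refine ae_eq_of_schwartz (locallyIntegrable_L2 _) (continuous_fourier hf).locallyIntegrable
    fun φ => ?_
  rw [integral_fourier_mul_schwartz, integral_fourier_mul_eq hf φ.integrable]
  refine integral_congr_ae ?_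
  filter_upwards [hf2.coeFn_toLp] with x hx
  rw [hx]
  rfl

/-- The inverse `L²` Fourier transform agrees with the Fourier integral on `L¹ ∩ L²`. -/
theorem coeFn_fourierInv_toLp {d : ℕ} {f : E d → ℂ} (hf : Integrable f) (hf2 : MemLp f 2) :
    ((𝓕⁻ (hf2.toLp f) : L2 d) : E d → ℂ) =ᵐ[volume] 𝓕⁻ f := by
  have hc : Continuous (𝓕⁻ f) := by
    simp_rw [show 𝓕⁻ f = fun x => 𝓕 f (-x) from funext (Real.fourierInv_eq_fourier_neg f)]
    exact (continuous_fourier hf).comp continuous_neg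
  refine ae_eq_of_schwartz (locallyIntegrable_L2 _) hc.locallyIntegrable fun φ => ?_
  have h1 := integral_fourierInv_mul_fourier (hf2.toLp f)
    (𝓕⁻ (φ.toLp 2 volume) : L2 d)
  rw [FourierTransform.fourier_fourierInv_eq, SchwartzMap.toLp_fourierInv_eq] at h1
  have e1 : ∫ x, (𝓕⁻ (hf2.toLp f) : L2 d) x * φ x =
      ∫ x, (𝓕⁻ (hf2.toLp f) : L2 d) x * (φ.toLp 2 volume : L2 d) x := by
    refine integral_congr_ae ?_
    filter_upwards [φ.coeFn_toLp 2 volume] with x hx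
    rw [hx]
  have e2 : ∫ x, (hf2.toLp f : L2 d) x * ((𝓕⁻ φ : SchwartzMap (E d) ℂ).toLp 2 volume : L2 d) x =
      ∫ x, f x * 𝓕 (fun y => φ (-y)) x := by
    refine integral_congr_ae ?_
    filter_upwards [hf2.coeFn_toLp, (𝓕⁻ φ : SchwartzMap (E d) ℂ).coeFn_toLp 2 volume] with x hx hx2
    rw [hx, hx2, SchwartzMap.fourierInv_coe, Real.fourierInv_eq_fourier_comp_neg]
  rw [e1, h1, e2, ← integral_fourier_mul_eq hf φ.integrable.comp_neg,
    ← integral_neg_eq_self (fun x => 𝓕 f x * φ (-x))]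
  simp only [Real.fourierInv_eq_fourier_neg, neg_neg]

/-- Composition of an `L²` function with a linear isometry. -/
def isoComp {d : ℕ} (A : E d ≃ₗᵢ[ℝ] E d) (f : L2 d) : L2 d :=
  Lp.compMeasurePreserving A A.measurePreserving f

theorem coeFn_isoComp {d : ℕ} (A : E d ≃ₗᵢ[ℝ] E d) (f : L2 d) :
    isoComp A f =ᵐ[volume] fun x => f (A x) :=
  Lp.coeFn_compMeasurePreserving f A.measurePreserving

theorem isRadial_iff {d : ℕ} (f : L2 d) :
    IsRadial f ↔ ∀ A : E d ≃ₗᵢ[ℝ] E d, isoComp A f = f := by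
  refine forall_congr' fun A => ?_
  rw [Lp.ext_iff]
  exact ⟨fun h => (coeFn_isoComp A f).trans h, fun h => (coeFn_isoComp A f).symm.trans h⟩

theorem fourier_isoComp {d : ℕ} (A : E d ≃ₗᵢ[ℝ] E d) (f : L2 d) :
    (𝓕 (isoComp A f) : L2 d) = isoComp A (𝓕 f) := by
  refine Lp.ext (ae_eq_of_schwartz (locallyIntegrable_L2 _) (locallyIntegrable_L2 _) fun φ => ?_)
  set φ' : SchwartzMap (E d) ℂ :=
    SchwartzMap.compCLMOfContinuousLinearEquiv ℂ A.symm.toContinuousLinearEquiv φ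
  have hφ' : ∀ x, φ' x = φ (A.symm x) := fun x => rfl
  have h1 : ∀ (f : L2 d) (φ : E d → ℂ), ∫ x, isoComp A f x * φ x = ∫ x, f x * φ (A.symm x) := by
    intro f φ
    rw [← A.measurePreserving.integral_comp A.toHomeomorph.measurableEmbedding
      fun x => f x * φ (A.symm x)]
    refine integral_congr_ae ?_
    filter_upwards [coeFn_isoComp A f] with x hx
    rw [hx, A.symm_apply_apply]
  rw [integral_fourier_mul_schwartz, h1, h1]
  simp only [← hφ']
  rw [integral_fourier_mul_schwartz]
  congr 1
  ext x
  congr 1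
  have := Real.fourier_comp_linearIsometry A.symm φ x
  exact this.symm

theorem IsRadial.fourier {d : ℕ} {f : L2 d} (hf : IsRadial f) : IsRadial (𝓕 f : L2 d) := by
  rw [isRadial_iff] at hf ⊢
  intro A
  rw [← fourier_isoComp, hf A]

theorem IsRadial.fourierInv {d : ℕ} {f : L2 d} (hf : IsRadial f) : IsRadial (𝓕⁻ f : L2 d) := by
  rw [isRadial_iff] at hf ⊢
  intro A
  have h := fourier_isoComp A (𝓕⁻ f : L2 d)
  rw [FourierTransform.fourier_fourierInv_eq, hf A] at h
  apply_fun (fun g : L2 d => (𝓕⁻ g : L2 d)) at h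
  simpa only [FourierTransform.fourierInv_fourier_eq] using h

theorem fourier_comp_add_right {d : ℕ} (f : E d → ℂ) (v w : E d) :
    𝓕 (fun x => f (x + v)) w = Complex.exp ((2 * Real.pi * inner ℝ v w : ℝ) * Complex.I) *
      𝓕 f w := by
  have h := congrFun (VectorFourier.fourierIntegral_comp_add_right Real.fourierChar volume
    (innerₗ (E d)) f v) w
  exact h

/-- |FG| ≤ |F|² + |G|² separates the two L² factors, and the shears (x, y) ↦ (x, x + y) and (x, y) ↦
(x + y, y) turn each resulting term into a product of integrable functions. -/
theorem integrable_mul_mul_add {d : ℕ} {F G θ : E d → ℂ} (hF : MemLp F 2) (hG : MemLp G 2)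
    (hθ : Integrable θ) :
    Integrable fun q : E d × E d => F q.1 * G q.2 * θ (q.1 + q.2) := by
  have i1 : Integrable (fun x => ‖F x‖ ^ 2) := (memLp_two_iff_integrable_sq_norm hF.1).1 hF
  have i2 : Integrable (fun x => ‖G x‖ ^ 2) := (memLp_two_iff_integrable_sq_norm hG.1).1 hG
  have m1 := measurePreserving_prod_add (volume : Measure (E d)) (volume : Measure (E d))
  have m2 := measurePreserving_add_prod (volume : Measure (E d)) (volume : Measure (E d))
  have j1 : Integrable fun q : E d × E d => ‖F q.1‖ ^ 2 * ‖θ (q.1 + q.2)‖ :=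
    m1.integrable_comp_of_integrable (i1.mul_prod hθ.norm)
  have j2 : Integrable fun q : E d × E d => ‖θ (q.1 + q.2)‖ * ‖G q.2‖ ^ 2 :=
    m2.integrable_comp_of_integrable (hθ.norm.mul_prod i2)
  have a1 : AEStronglyMeasurable (fun q : E d × E d => θ (q.1 + q.2)) (volume.prod volume) :=
    hθ.1.comp_quasiMeasurePreserving (Measure.quasiMeasurePreserving_snd.comp
      m1.quasiMeasurePreserving)
  refine (j1.add j2).mono' (((hF.1.comp_fst).mul (hG.1.comp_snd)).mul a1) ?_
  refine Filter.Eventually.of_forall fun q => ?_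
  rw [norm_mul, norm_mul]
  have := norm_nonneg (θ (q.1 + q.2))
  change _ ≤ ‖F q.1‖ ^ 2 * ‖θ (q.1 + q.2)‖ + ‖θ (q.1 + q.2)‖ * ‖G q.2‖ ^ 2
  nlinarith [sq_nonneg (‖F q.1‖ - ‖G q.2‖), sq_nonneg ‖F q.1‖, sq_nonneg ‖G q.2‖]

/-- The Fourier transform of a product of two `L²` functions, tested against `θ`. -/
theorem integral_fourierInv_mul_fourierInv {d : ℕ} (a b : L2 d) {θ : E d → ℂ} (hθ : Integrable θ)
    (hθ2 : MemLp θ 2) :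
    ∫ x, (𝓕⁻ a : L2 d) x * (𝓕⁻ b : L2 d) x * 𝓕 θ x =
      ∫ q : E d × E d, a q.1 * b q.2 * θ (q.1 + q.2) := by
  have hFc := continuous_fourier hθ
  have hF2 : MemLp (𝓕 θ) 2 := (Lp.memLp _).ae_eq (coeFn_fourier_toLp hθ hθ2)
  have hFb : ∀ x, ‖𝓕 θ x‖ ≤ ∫ v, ‖θ v‖ := fun x =>
    VectorFourier.norm_fourierIntegral_le_integral_norm _ _ _ _ _
  have hm1 : Integrable fun x => (𝓕⁻ b : L2 d) x * 𝓕 θ x :=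
    (Lp.memLp (𝓕⁻ b : L2 d)).integrable_mul hF2
  have hm2 : MemLp (fun x => (𝓕⁻ b : L2 d) x * 𝓕 θ x) 2 := by
    refine MemLp.of_le_mul (Lp.memLp (𝓕⁻ b : L2 d)) (c := ∫ v, ‖θ v‖)
      ((Lp.memLp (𝓕⁻ b : L2 d)).1.mul hFc.aestronglyMeasurable)
      (Filter.Eventually.of_forall fun x => ?_)
    rw [norm_mul, mul_comm]
    exact mul_le_mul_of_nonneg_right (hFb x) (norm_nonneg _)
  -- The inverse transform at v pairs 𝓕⁻ b with a modulation of 𝓕 θ, which is the transform of the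
  -- translate θ(· + v); Plancherel gives a correlation of b and θ. A second application of
  -- Plancherel, with a, then produces the double integral.
  have key : ∀ v : E d, 𝓕⁻ (fun x => (𝓕⁻ b : L2 d) x * 𝓕 θ x) v = ∫ ξ, b ξ * θ (v + ξ) := by
    intro v
    have hθv : Integrable fun x => θ (x + v) := hθ.comp_add_right v
    have hθv2 : MemLp (fun x => θ (x + v)) 2 :=
      hθ2.comp_measurePreserving (measurePreserving_add_right volume v)
    have h1 := integral_fourierInv_mul_fourier b (hθv2.toLp _)
    rw [Real.fourierInv_eq']
    have e1 : ∫ x, Complex.exp (((2 * Real.pi * inner ℝ x v : ℝ) : ℂ) * Complex.I) •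
        ((𝓕⁻ b : L2 d) x * 𝓕 θ x) =
        ∫ x, (𝓕⁻ b : L2 d) x * (𝓕 (hθv2.toLp _) : L2 d) x := by
      refine integral_congr_ae ?_
      filter_upwards [coeFn_fourier_toLp hθv hθv2] with x hx
      rw [hx, fourier_comp_add_right, smul_eq_mul, real_inner_comm]
      ring
    rw [e1, h1]
    refine integral_congr_ae ?_
    filter_upwards [hθv2.coeFn_toLp] with x hx
    rw [hx, add_comm]
  have h2 := integral_fourierInv_mul_fourier a (𝓕⁻ (hm2.toLp _) : L2 d)
  rw [FourierTransform.fourier_fourierInv_eq] at h2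
  have e1 : ∫ x, (𝓕⁻ a : L2 d) x * (𝓕⁻ b : L2 d) x * 𝓕 θ x =
      ∫ x, (𝓕⁻ a : L2 d) x * (hm2.toLp _ : L2 d) x := by
    refine integral_congr_ae ?_
    filter_upwards [hm2.coeFn_toLp] with x hx
    rw [hx, mul_assoc]
  rw [e1, h2, Measure.volume_eq_prod, integral_prod _ (by
    rw [← Measure.volume_eq_prod]
    exact integrable_mul_mul_add (Lp.memLp a) (Lp.memLp b) hθ)]
  refine integral_congr_ae ?_
  filter_upwards [coeFn_fourierInv_toLp hm1 hm2] with x hx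
  rw [hx, key, ← integral_const_mul]
  simp only [mul_assoc]

/-! ### The space-time Fourier transform of a product of two solutions. -/

/-- The Fourier transform of `ψ(τ, ζ)` in the variable `τ`. -/
def timeFourier {d : ℕ} (ψ : ℝ × E d → ℂ) (t : ℝ) (ζ : E d) : ℂ :=
  ∫ τ : ℝ, Complex.exp (-Complex.I * ((t * τ : ℝ) : ℂ)) * ψ (τ, ζ)

theorem timeFourier_eq {d : ℕ} (ψ : ℝ × E d → ℂ) (t : ℝ) (ζ : E d) :
    timeFourier ψ t ζ = 𝓕 (fun τ => ψ (τ, ζ)) (t / (2 * Real.pi)) := by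
  rw [Real.fourier_real_eq_integral_exp_smul, timeFourier]
  refine integral_congr_ae (Filter.Eventually.of_forall fun τ => ?_)
  have hpi : (Real.pi : ℂ) ≠ 0 := by exact_mod_cast Real.pi_ne_zero
  simp only [smul_eq_mul]
  congr 2
  push_cast
  field_simp

theorem measurable_timeFourier {d : ℕ} {ψ : ℝ × E d → ℂ} (hψ : Continuous ψ) :
    StronglyMeasurable fun q : ℝ × E d => timeFourier ψ q.1 q.2 := by
  refine StronglyMeasurable.integral_prod_right' (f := fun z : (ℝ × E d) × ℝ =>
    Complex.exp (-Complex.I * ((z.1.1 * z.2 : ℝ) : ℂ)) * ψ (z.2, z.1.2)) ?_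
  refine Continuous.stronglyMeasurable ?_
  fun_prop

theorem continuous_slice {d : ℕ} {ψ : ℝ × E d → ℂ} (hψ : Continuous ψ) (ζ : E d) :
    Continuous fun τ => ψ (τ, ζ) := by fun_prop

theorem hasCompactSupport_slice {d : ℕ} {ψ : ℝ × E d → ℂ} (hψ : HasCompactSupport ψ) (ζ : E d) :
    HasCompactSupport fun τ => ψ (τ, ζ) := by
  refine HasCompactSupport.of_support_subset_isCompact (hψ.isCompact.image continuous_fst) ?_
  intro τ hτ
  exact ⟨(τ, ζ), subset_tsupport _ hτ, rfl⟩

theorem integrable_slice {d : ℕ} {ψ : ℝ × E d → ℂ} (hψ : Continuous ψ)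
    (hc : HasCompactSupport ψ) (ζ : E d) : Integrable fun τ => ψ (τ, ζ) :=
  (continuous_slice hψ ζ).integrable_of_hasCompactSupport (hasCompactSupport_slice hc ζ)

/-- The bound is uniform in t and keeps the compact support in ζ. It serves both for ψ and for its
second τ-derivative, with the same radius. -/
theorem exists_timeFourier_le {d : ℕ} {ψ : ℝ × E d → ℂ} (hψ : Continuous ψ)
    (hc : HasCompactSupport ψ) (R : ℝ) (hR : ∀ p, ψ p ≠ 0 → ‖p‖ ≤ R) :
    ∃ C : ℝ, ∀ t ζ, ‖timeFourier ψ t ζ‖ ≤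
      (Metric.closedBall (0 : E d) R).indicator (fun _ => C) ζ := by
  obtain ⟨M, hM⟩ := hψ.bounded_above_of_compact_support hc
  refine ⟨∫ τ : ℝ, (Metric.closedBall (0 : ℝ) R).indicator (fun _ => M) τ, fun t ζ => ?_⟩
  by_cases hζ : ζ ∈ Metric.closedBall (0 : E d) R
  · rw [Set.indicator_of_mem hζ]
    refine norm_integral_le_of_norm_le ?_ (Filter.Eventually.of_forall fun τ => ?_)
    · rw [integrable_indicator_iff Metric.isClosed_closedBall.measurableSet]
      exact integrableOn_const (isCompact_closedBall _ _).measure_lt_top.ne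
    · have h1 : ‖Complex.exp (-Complex.I * ((t * τ : ℝ) : ℂ))‖ = 1 := by
        rw [show -Complex.I * ((t * τ : ℝ) : ℂ) = ((-(t * τ) : ℝ) : ℂ) * Complex.I by
          push_cast; ring]
        exact Complex.norm_exp_ofReal_mul_I _
      rw [norm_mul, h1, one_mul]
      by_cases hz : ψ (τ, ζ) = 0
      · rw [hz, norm_zero]
        exact Set.indicator_nonneg (fun _ _ => (norm_nonneg _).trans (hM 0)) _
      · have : τ ∈ Metric.closedBall (0 : ℝ) R := by
          rw [mem_closedBall_zero_iff]
          exact (norm_fst_le (τ, ζ)).trans (hR _ hz)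
        rw [Set.indicator_of_mem this]
        exact hM _
  · rw [Set.indicator_of_notMem hζ]
    have : ∀ τ, ψ (τ, ζ) = 0 := by
      intro τ
      by_contra h
      refine hζ ?_
      rw [mem_closedBall_zero_iff]
      exact (norm_snd_le (τ, ζ)).trans (hR _ h)
    simp [timeFourier, this]

/-- The derivative in the variable `τ`. -/
def timeDeriv {d : ℕ} (ψ : ℝ × E d → ℂ) (p : ℝ × E d) : ℂ := fderiv ℝ ψ p (1, 0)

theorem contDiff_timeDeriv {d : ℕ} {ψ : ℝ × E d → ℂ} (hψ : ContDiff ℝ (⊤ : ℕ∞) ψ) :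
    ContDiff ℝ (⊤ : ℕ∞) (timeDeriv ψ) :=
  (hψ.fderiv_right (m := (⊤ : ℕ∞)) (by norm_cast)).clm_apply contDiff_const

theorem support_timeDeriv {d : ℕ} (ψ : ℝ × E d → ℂ) :
    Function.support (timeDeriv ψ) ⊆ tsupport ψ := by
  intro p hp
  refine support_fderiv_subset ℝ (f := ψ) ?_
  intro h
  exact hp (by simp [timeDeriv, h])

theorem tsupport_timeDeriv {d : ℕ} (ψ : ℝ × E d → ℂ) : tsupport (timeDeriv ψ) ⊆ tsupport ψ :=
  closure_minimal (support_timeDeriv ψ) (isClosed_tsupport ψ)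

theorem hasCompactSupport_timeDeriv {d : ℕ} {ψ : ℝ × E d → ℂ} (hψ : HasCompactSupport ψ) :
    HasCompactSupport (timeDeriv ψ) :=
  hψ.of_isClosed_subset (isClosed_tsupport _) (tsupport_timeDeriv ψ)

theorem timeFourier_timeDeriv {d : ℕ} {ψ : ℝ × E d → ℂ} (hψ : ContDiff ℝ (⊤ : ℕ∞) ψ)
    (hc : HasCompactSupport ψ) (t : ℝ) (ζ : E d) :
    timeFourier (timeDeriv ψ) t ζ = Complex.I * t * timeFourier ψ t ζ := by
  have hder : ∀ τ, HasDerivAt (fun τ => ψ (τ, ζ)) (timeDeriv ψ (τ, ζ)) τ := by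
    intro τ
    have h1 : HasDerivAt (fun τ : ℝ => ((τ, ζ) : ℝ × E d)) (1, 0) τ :=
      (hasDerivAt_id τ).prodMk (hasDerivAt_const τ ζ)
    exact ((hψ.differentiable (by simp)) (τ, ζ)).hasFDerivAt.comp_hasDerivAt τ h1
  have hd : deriv (fun τ => ψ (τ, ζ)) = fun τ => timeDeriv ψ (τ, ζ) :=
    funext fun τ => (hder τ).deriv
  have h := Real.fourier_deriv (integrable_slice hψ.continuous hc ζ)
    (fun τ => (hder τ).differentiableAt) (by
      rw [hd]
      exact integrable_slice (contDiff_timeDeriv hψ).continuous (hasCompactSupport_timeDeriv hc) ζ)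
  rw [timeFourier_eq, timeFourier_eq, ← hd, h]
  simp only [smul_eq_mul]
  have hpi : (Real.pi : ℂ) ≠ 0 := by exact_mod_cast Real.pi_ne_zero
  push_cast
  field_simp

/-- The second τ-derivative has transform −t² times that of ψ, so adding the two uniform bounds
controls 1 + t² times the transform. This provides the majorant, integrable in t, for Fubini in
`integral_propagator_mul`. -/
theorem exists_timeFourier_decay {d : ℕ} {ψ : ℝ × E d → ℂ} (hψ : ContDiff ℝ (⊤ : ℕ∞) ψ)
    (hc : HasCompactSupport ψ) :
    ∃ C R : ℝ, ∀ t ζ, ‖timeFourier ψ t ζ‖ ≤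
      (1 + t ^ 2)⁻¹ * (Metric.closedBall (0 : E d) R).indicator (fun _ => C) ζ := by
  obtain ⟨R, hR⟩ := hc.isCompact.isBounded.exists_norm_le
  have hR0 : ∀ p, ψ p ≠ 0 → ‖p‖ ≤ R := fun p hp => hR p (subset_tsupport _ hp)
  have hs2 := (tsupport_timeDeriv (timeDeriv ψ)).trans (tsupport_timeDeriv ψ)
  have hR2 : ∀ p, timeDeriv (timeDeriv ψ) p ≠ 0 → ‖p‖ ≤ R := fun p hp =>
    hR p (hs2 (subset_tsupport _ hp))
  have hψ1 := contDiff_timeDeriv hψ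
  have hc1 := hasCompactSupport_timeDeriv hc
  obtain ⟨C, hC⟩ := exists_timeFourier_le hψ.continuous hc R hR0
  obtain ⟨C', hC'⟩ := exists_timeFourier_le (contDiff_timeDeriv hψ1).continuous
    (hasCompactSupport_timeDeriv hc1) R hR2
  refine ⟨C + C', R, fun t ζ => ?_⟩
  have h2 : timeFourier (timeDeriv (timeDeriv ψ)) t ζ = -(t : ℂ) ^ 2 * timeFourier ψ t ζ := by
    rw [timeFourier_timeDeriv hψ1 hc1, timeFourier_timeDeriv hψ hc]
    linear_combination (t : ℂ) ^ 2 * timeFourier ψ t ζ * Complex.I_sq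
  have h3 := hC' t ζ
  rw [h2, norm_mul, norm_neg, norm_pow, Complex.norm_real, Real.norm_eq_abs, sq_abs] at h3
  have h4 := hC t ζ
  rw [inv_mul_eq_div, le_div_iff₀ (by positivity)]
  have h5 : (Metric.closedBall (0 : E d) R).indicator (fun _ => C + C') ζ =
      (Metric.closedBall (0 : E d) R).indicator (fun _ => C) ζ +
      (Metric.closedBall (0 : E d) R).indicator (fun _ => C') ζ := by
    exact congrFun (Set.indicator_add _ _ _) ζ
  rw [h5]
  linarith

theorem integral_timeFourier {d : ℕ} {ψ : ℝ × E d → ℂ} (hψ : ContDiff ℝ (⊤ : ℕ∞) ψ)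
    (hc : HasCompactSupport ψ) (ω : ℝ) (ζ : E d) :
    ∫ t : ℝ, Complex.exp (Complex.I * ((t * ω : ℝ) : ℂ)) * timeFourier ψ t ζ =
      2 * Real.pi * ψ (ω, ζ) := by
  have hpi : (Real.pi : ℂ) ≠ 0 := by exact_mod_cast Real.pi_ne_zero
  have h2 : (0 : ℝ) < 2 * Real.pi := by positivity
  obtain ⟨C, R, hCR⟩ := exists_timeFourier_decay hψ hc
  have hcont := continuous_slice hψ.continuous ζ
  have hint := integrable_slice hψ.continuous hc ζ
  have hF : Integrable fun t => timeFourier ψ t ζ := by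
    refine (integrable_inv_one_add_sq.mul_const
      ((Metric.closedBall (0 : E d) R).indicator (fun _ => C) ζ)).mono' ?_
      (Filter.Eventually.of_forall fun t => hCR t ζ)
    exact ((measurable_timeFourier hψ.continuous).comp_measurable
      (measurable_id.prodMk measurable_const)).aestronglyMeasurable
  have hF' : Integrable (𝓕 fun τ => ψ (τ, ζ)) := by
    refine (hF.comp_mul_left' h2.ne').congr (Filter.Eventually.of_forall fun w => ?_)
    change timeFourier ψ (2 * Real.pi * w) ζ = _
    rw [timeFourier_eq, mul_div_cancel_left₀ _ h2.ne']
  have hinv := congrFun (hcont.fourierInv_fourier_eq hint hF') ω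
  rw [Real.fourierInv_eq'] at hinv
  have h := Measure.integral_comp_mul_left (fun t : ℝ =>
    Complex.exp (Complex.I * ((t * ω : ℝ) : ℂ)) * timeFourier ψ t ζ) (2 * Real.pi)
  rw [abs_of_pos (by positivity), Complex.real_smul] at h
  rw [← hinv]
  have e1 : ∫ v : ℝ, Complex.exp (((2 * Real.pi * inner ℝ v ω : ℝ) : ℂ) * Complex.I) •
      𝓕 (fun τ => ψ (τ, ζ)) v = ∫ x : ℝ, Complex.exp (Complex.I * ((2 * Real.pi * x * ω : ℝ) : ℂ)) *
        timeFourier ψ (2 * Real.pi * x) ζ := by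
    refine integral_congr_ae (Filter.Eventually.of_forall fun v => ?_)
    simp only [smul_eq_mul]
    rw [timeFourier_eq, mul_div_cancel_left₀ _ h2.ne', mul_comm Complex.I]
    congr 4
    simp only [RCLike.inner_apply, conj_trivial]
    ring
  rw [e1, h, ← mul_assoc, show (2 * (Real.pi : ℂ)) = ((2 * Real.pi : ℝ) : ℂ) by push_cast; ring,
    ← Complex.ofReal_mul, mul_inv_cancel₀ h2.ne', Complex.ofReal_one, one_mul]

theorem testFourier_eq {d : ℕ} {ψ : ℝ × E d → ℂ} (hψ : Continuous ψ)
    (hc : HasCompactSupport ψ) (t : ℝ) (x : E d) :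
    testFourier ψ t x = (2 * Real.pi) ^ d *
      𝓕 (fun ζ : E d => timeFourier ψ t ((2 * Real.pi) • ζ)) x := by
  have h2 : (0 : ℝ) < 2 * Real.pi := by positivity
  have hpi : (Real.pi : ℂ) ≠ 0 := by exact_mod_cast Real.pi_ne_zero
  have hint : Integrable (fun p : ℝ × E d =>
      Complex.exp (-Complex.I * ((t * p.1 + inner ℝ x p.2 : ℝ) : ℂ)) * ψ p)
      (volume.prod volume) := by
    refine Continuous.integrable_of_hasCompactSupport (by fun_prop) hc.mul_left
  rw [testFourier, Measure.volume_eq_prod, integral_prod_symm _ hint, Real.fourier_eq']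
  have h := Measure.integral_comp_smul (volume : Measure (E d)) (fun y : E d => ∫ τ : ℝ,
    Complex.exp (-Complex.I * ((t * τ + inner ℝ x y : ℝ) : ℂ)) * ψ (τ, y)) (2 * Real.pi)
  rw [finrank_euclideanSpace_fin, abs_of_pos (by positivity), Complex.real_smul] at h
  have e1 : ∫ v : E d, Complex.exp (((-2 * Real.pi * inner ℝ v x : ℝ) : ℂ) * Complex.I) •
      timeFourier ψ t ((2 * Real.pi) • v) = ∫ v : E d, ∫ τ : ℝ,
    Complex.exp (-Complex.I * ((t * τ + inner ℝ x ((2 * Real.pi) • v) : ℝ) : ℂ)) *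
      ψ (τ, (2 * Real.pi) • v) := by
    refine integral_congr_ae (Filter.Eventually.of_forall fun v => ?_)
    simp only [timeFourier]
    rw [smul_eq_mul, ← integral_const_mul]
    refine integral_congr_ae (Filter.Eventually.of_forall fun τ => ?_)
    simp only
    rw [← mul_assoc, ← Complex.exp_add, inner_smul_right, real_inner_comm]
    congr 2
    push_cast
    ring
  rw [e1, h]
  push_cast
  field_simp

theorem norm_mul_phase_le {a e z : ℂ} {c r : ℝ} (he : ‖e‖ = 1) (hz : ‖z‖ ≤ c * r) (hr : 0 ≤ r) :
    ‖a * (e * z)‖ ≤ c * ‖a * (r : ℂ)‖ := by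
  rw [norm_mul, norm_mul, he, one_mul, norm_mul, Complex.norm_real, Real.norm_eq_abs,
    abs_of_nonneg hr, mul_left_comm]
  exact mul_le_mul_of_nonneg_left hz (norm_nonneg _)

set_option maxHeartbeats 1000000 in
/-- The space-time Fourier transform of the product of two solutions, tested against `ψ`. -/
theorem integral_propagator_mul {d : ℕ} (s : ℝ) (f g : L2 d) {ψ : ℝ × E d → ℂ}
    (hψ : ContDiff ℝ (⊤ : ℕ∞) ψ) (hc : HasCompactSupport ψ) :
    ∫ t : ℝ, ∫ x : E d, propagator s t f x * propagator s t g x * testFourier ψ t x =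
      (2 * Real.pi) ^ (d + 1) *
        ∫ q : E d × E d, (𝓕 f : L2 d) q.1 * (𝓕 g : L2 d) q.2 * ψ (sumMap s q) := by
  have h2 : (0 : ℝ) < 2 * Real.pi := by positivity
  obtain ⟨C, R, hCR⟩ := exists_timeFourier_decay hψ hc
  set F : L2 d := 𝓕 f
  set G : L2 d := 𝓕 g
  set χ : E d → ℝ := fun ζ =>
    (Metric.closedBall (0 : E d) R).indicator (fun _ => C) ((2 * Real.pi) • ζ) with hχ
  have hχi : Integrable χ := by
    refine Integrable.comp_smul (f := (Metric.closedBall (0 : E d) R).indicator (fun _ => C)) ?_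
      h2.ne'
    rw [integrable_indicator_iff Metric.isClosed_closedBall.measurableSet]
    exact integrableOn_const (isCompact_closedBall _ _).measure_lt_top.ne
  have hχb : ∀ ζ, ‖χ ζ‖ ≤ |C| := fun ζ => by
    exact norm_indicator_le_norm_self _ _
  set θ : ℝ → E d → ℂ := fun t ζ => timeFourier ψ t ((2 * Real.pi) • ζ) with hθ
  have hθm : StronglyMeasurable fun q : ℝ × E d => θ q.1 q.2 :=
    (measurable_timeFourier hψ.continuous).comp_measurable
      (g := fun q : ℝ × E d => (q.1, (2 * Real.pi) • q.2)) (by fun_prop)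
  have hθle : ∀ t ζ, ‖θ t ζ‖ ≤ (1 + t ^ 2)⁻¹ * χ ζ := fun t ζ => hCR t _
  have hχ0 : ∀ ζ, 0 ≤ χ ζ := fun ζ => by
    have := (norm_nonneg _).trans (hθle 0 ζ)
    simpa using this
  have hθi : ∀ t, Integrable (θ t) := fun t => (hχi.const_mul _).mono'
    (hθm.comp_measurable measurable_prodMk_left).aestronglyMeasurable
    (Filter.Eventually.of_forall (hθle t))
  have hχ2 : MemLp χ 2 := by
    refine (memLp_two_iff_integrable_sq_norm hχi.1).2 ((hχi.norm.const_mul |C|).mono'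
      (hχi.1.norm.pow 2) (Filter.Eventually.of_forall fun ζ => ?_))
    rw [norm_pow, norm_norm, pow_two]
    exact mul_le_mul_of_nonneg_right (hχb ζ) (norm_nonneg _)
  have hθ2 : ∀ t, MemLp (θ t) 2 := fun t => (hχ2.const_mul _).mono' (hθi t).1
    (Filter.Eventually.of_forall (hθle t))
  have hF : MemLp F 2 := Lp.memLp F
  have hG : MemLp G 2 := Lp.memLp G
  set Ψ : ℝ → E d × E d → ℂ := fun t q => F q.1 * G q.2 *
    (Complex.exp (Complex.I * ((t * (weight s q.1 + weight s q.2) : ℝ) : ℂ)) * θ t (q.1 + q.2))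
    with hΨ
  have e1 : ∀ t, ∫ x : E d, propagator s t f x * propagator s t g x * testFourier ψ t x =
      (2 * Real.pi) ^ d * ∫ q, Ψ t q := by
    intro t
    have h := integral_fourierInv_mul_fourierInv ((memLp_propagatorSymbol_mul s t F).toLp _)
      ((memLp_propagatorSymbol_mul s t G).toLp _) (hθi t) (hθ2 t)
    have a1 : ∫ x : E d, propagator s t f x * propagator s t g x * testFourier ψ t x =
        (2 * Real.pi) ^ d * ∫ x : E d, propagator s t f x * propagator s t g x * 𝓕 (θ t) x := by
      rw [← integral_const_mul]
      refine integral_congr_ae (Filter.Eventually.of_forall fun x => ?_)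
      simp only
      rw [testFourier_eq hψ.continuous hc]
      ring
    rw [a1]
    congr 1
    refine h.trans (integral_congr_ae ?_)
    have q1 := (Measure.quasiMeasurePreserving_fst (μ := (volume : Measure (E d)))
      (ν := (volume : Measure (E d)))).ae_eq_comp (memLp_propagatorSymbol_mul s t F).coeFn_toLp
    have q2 := (Measure.quasiMeasurePreserving_snd (μ := (volume : Measure (E d)))
      (ν := (volume : Measure (E d)))).ae_eq_comp (memLp_propagatorSymbol_mul s t G).coeFn_toLp
    filter_upwards [q1, q2] with q hq1 hq2
    simp only [Function.comp_apply] at hq1 hq2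
    rw [hq1, hq2]
    have : Complex.exp (Complex.I * ((t * (weight s q.1 + weight s q.2) : ℝ) : ℂ)) =
        propagatorSymbol s t q.1 * propagatorSymbol s t q.2 := by
      rw [propagatorSymbol, propagatorSymbol, ← Complex.exp_add]
      congr 1
      simp only [weight]
      push_cast
      ring
    rw [hΨ]
    simp only
    rw [this]
    ring
  have hbase : Integrable fun q : E d × E d => F q.1 * G q.2 * ((χ (q.1 + q.2) : ℝ) : ℂ) :=
    integrable_mul_mul_add hF hG hχi.ofReal
  have hw := continuous_weight (d := d) s
  -- The phases have modulus 1 and the decay in t supplies a product majorant. The integrals may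
  -- thus be exchanged, and the t-integral becomes Fourier inversion at the frequency given by the
  -- sum of the weights.
  have hΨi : Integrable (Function.uncurry Ψ) (volume.prod volume) := by
    refine (integrable_inv_one_add_sq.mul_prod hbase.norm).mono' ?_
      (Filter.Eventually.of_forall fun z => ?_)
    · refine AEStronglyMeasurable.mul ?_ (AEStronglyMeasurable.mul ?_ ?_)
      · exact (hF.1.comp_fst.mul hG.1.comp_snd).comp_snd
      · exact Continuous.aestronglyMeasurable (by fun_prop)
      · exact (hθm.comp_measurable
          (g := fun z : ℝ × E d × E d => (z.1, z.2.1 + z.2.2)) (by fun_prop)).aestronglyMeasurable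
    · have h1 : ‖Complex.exp (Complex.I *
          ((z.1 * (weight s z.2.1 + weight s z.2.2) : ℝ) : ℂ))‖ = 1 := by
        rw [mul_comm]
        exact Complex.norm_exp_ofReal_mul_I _
      exact norm_mul_phase_le h1 (hθle _ _) (hχ0 _)
  rw [integral_congr_ae (Filter.Eventually.of_forall e1), integral_const_mul,
    integral_integral_swap hΨi, pow_succ, mul_assoc,
    ← integral_const_mul (2 * (Real.pi : ℂ))]
  congr 1
  refine integral_congr_ae (Filter.Eventually.of_forall fun q => ?_)
  simp only [hΨ]
  rw [integral_const_mul, hθ, integral_timeFourier hψ hc, sumMap]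
  ring

/-! ### The null-form norm as a weighted norm of a fibre average. -/

section

theorem eLpNorm_two_sq {α F : Type*} [MeasurableSpace α] [NormedAddCommGroup F] (μ : Measure α)
    (f : α → F) : eLpNorm f 2 μ ^ 2 = ∫⁻ x, ‖f x‖ₑ ^ 2 ∂μ := by
  have h := eLpNorm_nnreal_pow_eq_lintegral (f := f) (μ := μ) (p := 2) (by norm_num)
  simpa using h

/-- The symbol `|τ² - |ξ|² - (2s)²|^β`. -/
def nullSymbol {d : ℕ} (s β : ℝ) (p : ℝ × E d) : ℝ := |p.1 ^ 2 - ‖p.2‖ ^ 2 - (2 * s) ^ 2| ^ β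

theorem nullSymbol_nonneg {d : ℕ} (s β : ℝ) (p : ℝ × E d) : 0 ≤ nullSymbol s β p := by
  unfold nullSymbol; positivity

theorem measurable_nullSymbol {d : ℕ} (s β : ℝ) :
    Measurable (nullSymbol s β : ℝ × E d → ℝ) := by
  unfold nullSymbol
  fun_prop

theorem norm_le_weight {d : ℕ} (s : ℝ) (ξ : E d) : ‖ξ‖ ≤ weight s ξ := by
  refine Real.le_sqrt_of_sq_le ?_
  have h1 : (1 : ℝ) ≤ 2 * Real.pi := by linarith [Real.pi_gt_three]
  have h2 : ‖ξ‖ ^ 2 ≤ (2 * Real.pi * ‖ξ‖) ^ 2 := by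
    have := norm_nonneg ξ
    gcongr
    nlinarith
  nlinarith [sq_nonneg s]

/-- A bound on the sum of the weights bounds both frequencies, so the preimage of a compact set is
bounded; the weights are at least s, so the density of `pairMeasure` is bounded. -/
theorem sumMeasure_lt_top_of_isCompact {n : ℕ} (hn : 1 ≤ n) {s : ℝ} (hs : 0 < s)
    {K : Set (ℝ × E (n + 1))} (hK : IsCompact K) : sumMeasure n s K < ⊤ := by
  have hmp := measurePreserving_sumMap hn s
  rw [← hmp.measure_preimage hK.measurableSet.nullMeasurableSet, pairMeasure,
    withDensity_apply _ (hmp.measurable hK.measurableSet)]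
  obtain ⟨R, hR⟩ := hK.isBounded.exists_norm_le
  have hsub : sumMap s ⁻¹' K ⊆ Metric.closedBall (0 : E (n + 1) × E (n + 1)) R := by
    intro q hq
    have h1 := (norm_fst_le _).trans (hR _ hq)
    rw [sumMap, Real.norm_eq_abs] at h1
    have h2 := (le_abs_self _).trans h1
    have h3 := norm_le_weight s q.1
    have h4 := norm_le_weight s q.2
    have h5 := weight_pos hs q.1
    have h6 := weight_pos hs q.2
    rw [mem_closedBall_zero_iff, Prod.norm_def, max_le_iff]
    simp only at h2
    constructor <;> linarith
  calc ∫⁻ q in sumMap s ⁻¹' K, ENNReal.ofReal (1 / (weight s q.1 * weight s q.2))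
      ≤ ∫⁻ q in sumMap s ⁻¹' K, ENNReal.ofReal (1 / (s * s)) := by
        refine lintegral_mono fun q => ENNReal.ofReal_le_ofReal ?_
        have := le_weight s q.1
        have := le_weight s q.2
        have := weight_pos hs q.1
        gcongr
    _ = ENNReal.ofReal (1 / (s * s)) * volume (sumMap s ⁻¹' K) := by
        rw [setLIntegral_const]
    _ < ⊤ := ENNReal.mul_lt_top (by simp)
        ((measure_mono hsub).trans_lt (isCompact_closedBall _ _).measure_lt_top)

theorem nullFormNorm_eq {d : ℕ} (s β : ℝ) {f g : L2 d} {W : ℝ × E d → ℂ}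
    (hW : IsSpaceTimeFourier (fun t x => propagator s t f x * propagator s t g x) W) :
    nullFormNorm s β f g = ENNReal.ofReal ((2 * Real.pi) ^ (-((d : ℝ) + 1) / 2)) *
      eLpNorm (fun p : ℝ × E d => ((nullSymbol s β p : ℝ) : ℂ) * W p) 2 volume := by
  refine le_antisymm (iInf₂_le W hW) (le_iInf₂ fun W' hW' => le_of_eq ?_)
  congr 1
  refine eLpNorm_congr_ae ?_
  filter_upwards [hW.ae_eq hW'] with p hp
  rw [hp]
  rfl

variable {n : ℕ}

/-- If `k` is a conditional expectation of `f̂(η₁) ĝ(η₂) φ_s(η₁) φ_s(η₂)` along `sumMap`, then the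
space-time Fourier transform of the product of the two solutions is `k` times the density. -/
theorem isSpaceTimeFourier_of (hn : 1 ≤ n) (s : ℝ) {f g : L2 (n + 1)} {k : ℝ × E (n + 1) → ℂ}
    (hk : ∀ K : Set (ℝ × E (n + 1)), IsCompact K → IntegrableOn k K (sumMeasure n s))
    (hpair : ∀ ψ : ℝ × E (n + 1) → ℂ, Continuous ψ → HasCompactSupport ψ →
      ∫ p, ψ p * k p ∂(sumMeasure n s) =
        ∫ q : E (n + 1) × E (n + 1), (𝓕 f : L2 (n + 1)) q.1 * (𝓕 g : L2 (n + 1)) q.2 *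
          ψ (sumMap s q)) :
    IsSpaceTimeFourier (fun t x => propagator s t f x * propagator s t g x)
      (fun p => (2 * Real.pi) ^ (n + 1 + 1) * (((sumDensity n s p).toReal : ℂ) * k p)) := by
  have hfin : ∀ᵐ p : ℝ × E (n + 1), sumDensity n s p < ⊤ :=
    Filter.Eventually.of_forall fun p => (sumDensity_ne_top hn s p).lt_top
  refine ⟨?_, fun ψ hψ hc => ?_⟩
  · rw [locallyIntegrable_iff]
    intro K hK
    have h := (hk K hK)
    rw [IntegrableOn, sumMeasure, restrict_withDensity hK.measurableSet,
      integrable_withDensity_iff_integrable_smul' (measurable_sumDensity s)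
        (ae_restrict_of_ae hfin)] at h
    simp only [Complex.real_smul] at h
    exact h.const_mul _
  · rw [integral_propagator_mul s f g hψ hc, ← hpair ψ hψ.continuous hc, sumMeasure,
      integral_withDensity_eq_integral_toReal_smul (measurable_sumDensity s) hfin,
      ← integral_const_mul]
    refine integral_congr_ae (Filter.Eventually.of_forall fun p => ?_)
    simp only [Complex.real_smul]
    ring

theorem lintegral_sumMeasure (s : ℝ) {u : ℝ × E (n + 1) → ℝ≥0∞}
    (hu : AEMeasurable u (sumMeasure n s)) :
    ∫⁻ p, u p ∂(sumMeasure n s) = ∫⁻ p : ℝ × E (n + 1), sumDensity n s p * u p := by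
  rw [sumMeasure, lintegral_withDensity_eq_lintegral_mul₀' (measurable_sumDensity s).aemeasurable
    hu]
  rfl

theorem enorm_ofReal_of_nonneg {r : ℝ} (hr : 0 ≤ r) : ‖(r : ℂ)‖ₑ = ENNReal.ofReal r := by
  rw [← ofReal_norm, Complex.norm_real, Real.norm_of_nonneg hr]

theorem enorm_nullSymbol_mul_sq (hn : 1 ≤ n) (s β : ℝ) (p : ℝ × E (n + 1)) (z : ℂ) :
    ‖((nullSymbol s β p : ℝ) : ℂ) *
      ((2 * Real.pi) ^ (n + 1 + 1) * (((sumDensity n s p).toReal : ℂ) * z))‖ₑ ^ 2 =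
      ENNReal.ofReal (((2 * Real.pi) ^ (n + 1 + 1)) ^ 2) * (sumDensity n s p *
        (ENNReal.ofReal (nullSymbol s β p ^ 2) * sumDensity n s p * ‖z‖ₑ ^ 2)) := by
  have h2 : (0 : ℝ) ≤ (2 * Real.pi) ^ (n + 1 + 1) := by positivity
  have a2 : ((2 * Real.pi) ^ (n + 1 + 1) : ℂ) = (((2 * Real.pi) ^ (n + 1 + 1) : ℝ) : ℂ) := by
    rw [Complex.ofReal_pow]; push_cast; rfl
  rw [a2, enorm_mul, enorm_mul, enorm_mul, enorm_ofReal_of_nonneg (nullSymbol_nonneg s β p),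
    enorm_ofReal_of_nonneg h2, enorm_ofReal_of_nonneg ENNReal.toReal_nonneg,
    ENNReal.ofReal_toReal (sumDensity_ne_top hn s p), ENNReal.ofReal_pow h2,
    ENNReal.ofReal_pow (nullSymbol_nonneg s β p)]
  ring

theorem ofReal_two_pi_pow (n : ℕ) :
    ENNReal.ofReal ((2 * Real.pi) ^ (-(((n + 1 : ℕ) : ℝ) + 1) / 2)) ^ 2 *
      ENNReal.ofReal (((2 * Real.pi) ^ (n + 1 + 1)) ^ 2) =
      ENNReal.ofReal ((2 * Real.pi) ^ (n + 2)) := by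
  have h2 : (0 : ℝ) < 2 * Real.pi := by positivity
  rw [← ENNReal.ofReal_pow (by positivity), ← ENNReal.ofReal_mul (by positivity)]
  congr 1
  have h3 : ((2 * Real.pi) ^ (-(((n + 1 : ℕ) : ℝ) + 1) / 2)) ^ 2 =
      ((2 * Real.pi) ^ (n + 2))⁻¹ := by
    rw [← Real.rpow_natCast, ← Real.rpow_mul h2.le, ← Real.rpow_natCast, ← Real.rpow_neg h2.le]
    congr 1
    push_cast
    ring
  rw [h3, pow_two, inv_mul_cancel_left₀ (by positivity)]

/-- The transform is (2π)^(n+2) times density times k. In its squared modulus one factor of the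
density is absorbed into `sumMeasure` and the other stays in the integrand; the powers of 2π combine
with the Plancherel normalization. -/
theorem nullFormNorm_sq_eq (hn : 1 ≤ n) (s β : ℝ) {f g : L2 (n + 1)} {k : ℝ × E (n + 1) → ℂ}
    (hkm : AEStronglyMeasurable k (sumMeasure n s))
    (hk : ∀ K : Set (ℝ × E (n + 1)), IsCompact K → IntegrableOn k K (sumMeasure n s))
    (hpair : ∀ ψ : ℝ × E (n + 1) → ℂ, Continuous ψ → HasCompactSupport ψ →
      ∫ p, ψ p * k p ∂(sumMeasure n s) =
        ∫ q : E (n + 1) × E (n + 1), (𝓕 f : L2 (n + 1)) q.1 * (𝓕 g : L2 (n + 1)) q.2 *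
          ψ (sumMap s q)) :
    nullFormNorm s β f g ^ 2 = ENNReal.ofReal ((2 * Real.pi) ^ (n + 2)) *
      ∫⁻ p, ENNReal.ofReal (nullSymbol s β p ^ 2) * sumDensity n s p * ‖k p‖ₑ ^ 2
        ∂(sumMeasure n s) := by
  have hm := measurable_sumDensity (n := n) s
  have hu : AEMeasurable (fun p => ENNReal.ofReal (nullSymbol s β p ^ 2) *
      sumDensity n s p * ‖k p‖ₑ ^ 2) (sumMeasure n s) :=
    AEMeasurable.mul (((measurable_nullSymbol s β).pow_const 2).ennreal_ofReal.mul
      hm).aemeasurable (hkm.enorm.pow_const 2)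
  have h1 := nullFormNorm_eq s β (isSpaceTimeFourier_of hn s hk hpair)
  have h2 := eLpNorm_two_sq volume (fun p : ℝ × E (n + 1) => ((nullSymbol s β p : ℝ) : ℂ) *
    ((2 * Real.pi) ^ (n + 1 + 1) * (((sumDensity n s p).toReal : ℂ) * k p)))
  rw [lintegral_congr fun p => enorm_nullSymbol_mul_sq hn s β p (k p),
    lintegral_const_mul' _ _ ENNReal.ofReal_ne_top, ← lintegral_sumMeasure s hu] at h2
  rw [h1, mul_pow, h2, ← mul_assoc, ofReal_two_pi_pow]

theorem lintegral_pairMeasure {d : ℕ} (s : ℝ) {u : E d × E d → ℝ≥0∞}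
    (hu : AEMeasurable u volume) :
    ∫⁻ q, u q ∂(pairMeasure d s) =
      ∫⁻ q : E d × E d, ENNReal.ofReal (1 / (weight s q.1 * weight s q.2)) * u q := by
  rw [pairMeasure, lintegral_withDensity_eq_lintegral_mul₀ (measurable_pairDensity s).aemeasurable
    hu]
  rfl

theorem lintegral_enorm_sq_prod {d : ℕ} (F G : L2 d) :
    ∫⁻ q : E d × E d, ‖F q.1‖ₑ ^ 2 * ‖G q.2‖ₑ ^ 2 < ⊤ := by
  have h1 := (Lp.memLp F).eLpNorm_lt_top
  have h2 := (Lp.memLp G).eLpNorm_lt_top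
  rw [Measure.volume_eq_prod, lintegral_prod_mul (f := fun x => ‖F x‖ₑ ^ 2)
    (g := fun x => ‖G x‖ₑ ^ 2) ((Lp.memLp F).1.enorm.pow_const 2)
    ((Lp.memLp G).1.enorm.pow_const 2), ← eLpNorm_two_sq, ← eLpNorm_two_sq]
  exact ENNReal.mul_lt_top (ENNReal.pow_lt_top h1) (ENNReal.pow_lt_top h2)

theorem pairMeasure_ac (d : ℕ) (s : ℝ) : pairMeasure d s ≪ volume :=
  withDensity_absolutelyContinuous _ _

/-- The function to be averaged is F G times both weights, which for general L² data need not be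
square integrable for `pairMeasure`. The damping factor depends only on the first coordinate of
`sumMap`, so it can be undone after averaging, and r e^(−2r) ≤ 1 makes the damped function square
integrable. -/
theorem memLp_pair {d : ℕ} {s : ℝ} (hs : 0 < s) (F G : L2 d) :
    MemLp (fun q : E d × E d => F q.1 * G q.2 *
      ((weight s q.1 * weight s q.2 * Real.exp (-(weight s q.1 + weight s q.2)) : ℝ) : ℂ)) 2
      (pairMeasure d s) := by
  have hw := continuous_weight (d := d) s
  have hm : AEStronglyMeasurable (fun q : E d × E d => F q.1 * G q.2 *
      ((weight s q.1 * weight s q.2 * Real.exp (-(weight s q.1 + weight s q.2)) : ℝ) : ℂ))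
      volume :=
    ((Lp.memLp F).1.comp_fst.mul (Lp.memLp G).1.comp_snd).mul
      (Continuous.aestronglyMeasurable (by fun_prop))
  refine ⟨hm.mono_ac (pairMeasure_ac d s), ?_⟩
  have key : eLpNorm (fun q : E d × E d => F q.1 * G q.2 *
      ((weight s q.1 * weight s q.2 * Real.exp (-(weight s q.1 + weight s q.2)) : ℝ) : ℂ)) 2
      (pairMeasure d s) ^ 2 < ⊤ := by
    rw [eLpNorm_two_sq, lintegral_pairMeasure s (hm.enorm.pow_const 2)]
    refine lt_of_le_of_lt (lintegral_mono fun q => ?_) (lintegral_enorm_sq_prod F G)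
    have h1 := weight_pos hs q.1
    have h2 := weight_pos hs q.2
    rw [enorm_mul, enorm_mul, enorm_ofReal_of_nonneg (by positivity), mul_pow, mul_pow, mul_comm,
      mul_assoc (_ * _), ← ENNReal.ofReal_pow (by positivity),
      ← ENNReal.ofReal_mul (by positivity)]
    refine mul_le_of_le_one_right' (ENNReal.ofReal_le_one.2 ?_)
    have h3 : ∀ r : ℝ, 0 < r → r * Real.exp (-r) ^ 2 ≤ 1 := by
      intro r hr
      have b1 : r ≤ Real.exp r := (lt_add_one r).le.trans (Real.add_one_le_exp r)
      have b2 : Real.exp (-r) ≤ 1 := Real.exp_le_one_iff.2 (by linarith)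
      have b3 : Real.exp r * Real.exp (-r) = 1 := by rw [← Real.exp_add]; simp
      have b4 := Real.exp_pos (-r)
      nlinarith
    have h4 : (weight s q.1 * weight s q.2 *
        Real.exp (-(weight s q.1 + weight s q.2))) ^ 2 * (1 / (weight s q.1 * weight s q.2)) =
        (weight s q.1 * Real.exp (-weight s q.1) ^ 2) *
          (weight s q.2 * Real.exp (-weight s q.2) ^ 2) := by
      rw [neg_add, Real.exp_add]
      field_simp
    rw [h4]
    exact mul_le_one₀ (h3 _ h1) (by positivity) (h3 _ h2)
  by_contra h
  rw [not_lt, top_le_iff] at h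
  rw [h] at key
  simp at key

theorem integral_pairMeasure {d : ℕ} {s : ℝ} (hs : 0 < s) (u : E d × E d → ℂ) :
    ∫ q, u q ∂(pairMeasure d s) =
      ∫ q : E d × E d, ((1 / (weight s q.1 * weight s q.2) : ℝ) : ℂ) * u q := by
  rw [pairMeasure, integral_withDensity_eq_integral_toReal_smul (measurable_pairDensity s)
    (Filter.Eventually.of_forall fun q => ENNReal.ofReal_lt_top)]
  refine integral_congr_ae (Filter.Eventually.of_forall fun q => ?_)
  have h1 := weight_pos hs q.1
  have h2 := weight_pos hs q.2
  simp only
  rw [ENNReal.toReal_ofReal (by positivity), Complex.real_smul]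

/-- The integrand that bounds the null-form norm. -/
def bilinKernel (n : ℕ) (s β : ℝ) (q : E (n + 1) × E (n + 1)) : ℝ≥0∞ :=
  ENNReal.ofReal (nullSymbol s β (sumMap s q) ^ 2) * sumDensity n s (sumMap s q) *
    ENNReal.ofReal (weight s q.1 * weight s q.2)

theorem measurable_bilinKernel (s β : ℝ) : Measurable (bilinKernel n s β) := by
  have hw := (continuous_weight (d := n + 1) s).measurable
  have hS := (continuous_sumMap (d := n + 1) s).measurable
  have h1 := (measurable_nullSymbol (d := n + 1) s β).comp hS
  have h2 := (measurable_sumDensity (n := n) s).comp hS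
  unfold bilinKernel
  exact ((h1.pow_const 2).ennreal_ofReal.mul h2).mul (by fun_prop)

/-- The bilinear estimate that follows from the Cauchy--Schwarz inequality on the fibres. -/
theorem nullFormNorm_sq_le (hn : 1 ≤ n) {s : ℝ} (hs : 0 < s) (β : ℝ) (f g : L2 (n + 1)) :
    nullFormNorm s β f g ^ 2 ≤ ENNReal.ofReal ((2 * Real.pi) ^ (n + 2)) *
      ∫⁻ q : E (n + 1) × E (n + 1), bilinKernel n s β q *
        (‖(𝓕 f : L2 (n + 1)) q.1‖ₑ ^ 2 * ‖(𝓕 g : L2 (n + 1)) q.2‖ₑ ^ 2) := by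
  set F : L2 (n + 1) := 𝓕 f
  set G : L2 (n + 1) := 𝓕 g
  have hmp := measurePreserving_sumMap hn s
  have hh := memLp_pair hs F G
  set h : E (n + 1) × E (n + 1) → ℂ := fun q => F q.1 * G q.2 *
      ((weight s q.1 * weight s q.2 * Real.exp (-(weight s q.1 + weight s q.2)) : ℝ) : ℂ) with hdef
  obtain ⟨H, hH, hHpair, hHle⟩ := exists_condExp hmp hh
  have hexp : Continuous fun p : ℝ × E (n + 1) => (Real.exp p.1 : ℂ) := by fun_prop
  have hmem : ∀ u : ℝ × E (n + 1) → ℂ, Continuous u → HasCompactSupport u →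
      MemLp u 2 (sumMeasure n s) := by
    intro u hu huc
    have : IsFiniteMeasureOnCompacts (sumMeasure n s) :=
      ⟨fun K hK => sumMeasure_lt_top_of_isCompact hn hs hK⟩
    exact hu.memLp_of_hasCompactSupport huc
  have hkint : ∀ K : Set (ℝ × E (n + 1)), IsCompact K →
      IntegrableOn (fun p => (Real.exp p.1 : ℂ) * H p) K (sumMeasure n s) := by
    intro K hK
    have h1 : MemLp (fun p : ℝ × E (n + 1) => (Real.exp p.1 : ℂ)) 2
        ((sumMeasure n s).restrict K) := by
      have : IsFiniteMeasure ((sumMeasure n s).restrict K) :=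
        ⟨by rw [Measure.restrict_apply_univ]; exact sumMeasure_lt_top_of_isCompact hn hs hK⟩
      obtain ⟨M, hM⟩ := hK.exists_bound_of_continuousOn hexp.continuousOn
      exact MemLp.of_bound hexp.aestronglyMeasurable M
        ((ae_restrict_iff' hK.measurableSet).2 (Filter.Eventually.of_forall hM))
    exact h1.integrable_mul (hH.restrict K)
  -- Multiplying the average by e^τ removes the damping, since τ is the sum of the two weights on
  -- the image of `sumMap`.
  have hpair : ∀ ψ : ℝ × E (n + 1) → ℂ, Continuous ψ → HasCompactSupport ψ →
      ∫ p, ψ p * ((Real.exp p.1 : ℂ) * H p) ∂(sumMeasure n s) =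
        ∫ q : E (n + 1) × E (n + 1), F q.1 * G q.2 * ψ (sumMap s q) := by
    intro ψ hψ hc
    have h1 := hHpair (fun p => ψ p * (Real.exp p.1 : ℂ))
      (hmem _ (hψ.mul hexp) hc.mul_right)
    simp only [mul_assoc] at h1
    rw [h1, integral_pairMeasure hs]
    refine integral_congr_ae (Filter.Eventually.of_forall fun q => ?_)
    have b1 : (weight s q.1 : ℂ) ≠ 0 := by exact_mod_cast (weight_pos hs q.1).ne'
    have b2 : (weight s q.2 : ℂ) ≠ 0 := by exact_mod_cast (weight_pos hs q.2).ne'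
    have b3 : (Real.exp (weight s q.1 + weight s q.2) : ℂ) *
        (Real.exp (-(weight s q.1 + weight s q.2)) : ℂ) = 1 := by
      rw [← Complex.ofReal_mul, ← Real.exp_add]; simp
    simp only [hdef]
    rw [show (sumMap s q).1 = weight s q.1 + weight s q.2 from rfl]
    push_cast at b3 ⊢
    field_simp
    linear_combination (F q.1 * G q.2 * ψ (sumMap s q)) * b3
  rw [nullFormNorm_sq_eq (k := fun p => (Real.exp p.1 : ℂ) * H p) hn s β
    (hexp.aestronglyMeasurable.mul hH.1) hkint hpair]
  refine mul_le_mul_right ?_ _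
  have hSm := (continuous_sumMap (d := n + 1) s).measurable
  have hwm := (measurable_nullSymbol (d := n + 1) s β)
  have hdm := measurable_sumDensity (n := n) s
  have hpre : Measurable fun p : ℝ × E (n + 1) => ENNReal.ofReal (nullSymbol s β p ^ 2) *
      sumDensity n s p * ENNReal.ofReal (Real.exp p.1 ^ 2) := by fun_prop
  calc _ = ∫⁻ p, (ENNReal.ofReal (nullSymbol s β p ^ 2) * sumDensity n s p *
        ENNReal.ofReal (Real.exp p.1 ^ 2)) * ‖H p‖ₑ ^ 2 ∂(sumMeasure n s) := by
        refine lintegral_congr fun p => ?_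
        rw [enorm_mul, mul_pow, enorm_ofReal_of_nonneg (Real.exp_pos _).le,
          ENNReal.ofReal_pow (Real.exp_pos _).le]
        ring
    _ ≤ ∫⁻ q, (ENNReal.ofReal (nullSymbol s β (sumMap s q) ^ 2) * sumDensity n s (sumMap s q) *
        ENNReal.ofReal (Real.exp (sumMap s q).1 ^ 2)) * ‖h q‖ₑ ^ 2 ∂(pairMeasure (n + 1) s) :=
        hHle (fun p => ENNReal.ofReal (nullSymbol s β p ^ 2) * sumDensity n s p *
          ENNReal.ofReal (Real.exp p.1 ^ 2)) hpre
    _ = _ := by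
        have hm : AEMeasurable (fun q => ‖h q‖ₑ ^ 2)
            (volume : Measure (E (n + 1) × E (n + 1))) := by
          have hw := continuous_weight (d := n + 1) s
          exact (((Lp.memLp F).1.comp_fst.mul (Lp.memLp G).1.comp_snd).mul
            (Continuous.aestronglyMeasurable (by fun_prop))).enorm.pow_const 2
        rw [lintegral_pairMeasure (u := fun q => (ENNReal.ofReal (nullSymbol s β (sumMap s q) ^ 2) *
          sumDensity n s (sumMap s q) * ENNReal.ofReal (Real.exp (sumMap s q).1 ^ 2)) *
            ‖h q‖ₑ ^ 2) s
          (AEMeasurable.mul (hpre.comp hSm).aemeasurable hm)]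
        refine lintegral_congr fun q => ?_
        have b1 := weight_pos hs q.1
        have b2 := weight_pos hs q.2
        have b3 : ENNReal.ofReal (weight s q.1 * weight s q.2) =
            ENNReal.ofReal (1 / (weight s q.1 * weight s q.2)) *
            (ENNReal.ofReal (Real.exp (sumMap s q).1 ^ 2) * ENNReal.ofReal (weight s q.1 *
              weight s q.2 * Real.exp (-(weight s q.1 + weight s q.2))) ^ 2) := by
          rw [← ENNReal.ofReal_pow (by positivity), ← ENNReal.ofReal_mul (by positivity),
            ← ENNReal.ofReal_mul (by positivity)]
          congr 1
          have : Real.exp (weight s q.1 + weight s q.2) *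
            Real.exp (-(weight s q.1 + weight s q.2)) = 1 := by rw [← Real.exp_add]; simp
          rw [show (sumMap s q).1 = weight s q.1 + weight s q.2 from rfl]
          generalize Real.exp (weight s q.1 + weight s q.2) = X at *
          generalize Real.exp (-(weight s q.1 + weight s q.2)) = Y at *
          have h3 : 1 / (weight s q.1 * weight s q.2) *
              (X ^ 2 * (weight s q.1 * weight s q.2 * Y) ^ 2) =
              weight s q.1 * weight s q.2 * (X * Y) ^ 2 := by
            field_simp
          rw [h3, this, one_pow, mul_one]
        simp only [hdef, bilinKernel]
        rw [enorm_mul, enorm_mul, enorm_ofReal_of_nonneg (by positivity), b3]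
        ring

end

/-! ### Convexity, symmetrization and spherical averages. -/

section

/-- x^p is the exponential of p log x, which is convex when p ≤ 0, and the exponential is convex and
increasing. -/
theorem convexOn_rpow_of_nonpos {p : ℝ} (hp : p ≤ 0) :
    ConvexOn ℝ (Set.Ioi 0) fun x : ℝ => x ^ p := by
  have h := (strictConcaveOn_log_Ioi.concaveOn.neg).smul (neg_nonneg.2 hp)
  refine ⟨convex_Ioi 0, fun x hx y hy a b ha hb hab => ?_⟩
  have h1 := h.2 hx hy ha hb hab
  have hxy : 0 < a • x + b • y := (convex_Ioi (0 : ℝ)) hx hy ha hb hab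
  have hx : 0 < x := hx
  have hy : 0 < y := hy
  simp only [smul_eq_mul, Pi.neg_apply] at h1 hxy ⊢
  rw [Real.rpow_def_of_pos hxy, Real.rpow_def_of_pos hx, Real.rpow_def_of_pos hy]
  have h2 := convexOn_exp.2 (Set.mem_univ (Real.log x * p)) (Set.mem_univ (Real.log y * p))
    ha hb hab
  simp only [smul_eq_mul] at h2
  refine (Real.exp_le_exp.2 ?_).trans h2
  nlinarith

/-- With r = t/c in [−1, 1], both 1 − t and 1 + t are convex combinations of 1 − c and 1 + c, with
exchanged coefficients. -/
theorem convexOn_symm_add_le {S : Set ℝ} {f : ℝ → ℝ} (hf : ConvexOn ℝ S f) {t c : ℝ}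
    (h1 : 1 - c ∈ S) (h2 : 1 + c ∈ S) (htc : |t| ≤ |c|) :
    f (1 - t) + f (1 + t) ≤ f (1 - c) + f (1 + c) := by
  rcases eq_or_ne c 0 with rfl | hc
  · have : t = 0 := by simpa using htc
    rw [this]
  · set r := t / c with hr
    have hr1 : |r| ≤ 1 := by
      rw [hr, abs_div]
      exact (div_le_one (abs_pos.2 hc)).2 htc
    obtain ⟨hr2, hr3⟩ := abs_le.1 hr1
    have ht : t = r * c := by rw [hr, div_mul_cancel₀ _ hc]
    have e1 := hf.2 h1 h2 (show 0 ≤ (1 + r) / 2 by linarith)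
      (show 0 ≤ (1 - r) / 2 by linarith) (by ring)
    have e2 := hf.2 h1 h2 (show 0 ≤ (1 - r) / 2 by linarith)
      (show 0 ≤ (1 + r) / 2 by linarith) (by ring)
    simp only [smul_eq_mul] at e1 e2
    rw [show (1 + r) / 2 * (1 - c) + (1 - r) / 2 * (1 + c) = 1 - t by rw [ht]; ring] at e1
    rw [show (1 - r) / 2 * (1 - c) + (1 + r) / 2 * (1 + c) = 1 + t by rw [ht]; ring] at e2
    linarith

/-- This monotonicity is what restricts p in the sharp estimate. Extended values are used because c
is a cosine and may be ±1, where a negative power is infinite and the inequality is trivial. -/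
theorem ofReal_rpow_symm_le {p t c : ℝ} (hp : p ≤ 0 ∨ 1 ≤ p) (ht : |t| < 1) (htc : |t| ≤ |c|)
    (hc : |c| ≤ 1) :
    ENNReal.ofReal (1 - t) ^ p + ENNReal.ofReal (1 + t) ^ p ≤
      ENNReal.ofReal (1 - c) ^ p + ENNReal.ofReal (1 + c) ^ p := by
  obtain ⟨ht1, ht2⟩ := abs_lt.1 ht
  obtain ⟨hc1, hc2⟩ := abs_le.1 hc
  have a1 : 0 < 1 - t := by linarith
  have a2 : 0 < 1 + t := by linarith
  have b1 : 0 ≤ 1 - c := by linarith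
  have b2 : 0 ≤ 1 + c := by linarith
  rw [ENNReal.ofReal_rpow_of_pos a1, ENNReal.ofReal_rpow_of_pos a2,
    ← ENNReal.ofReal_add (by positivity) (by positivity)]
  rcases hp with hp | hp
  · rcases b1.eq_or_lt with h | h1
    · rcases hp.eq_or_lt with rfl | hp'
      · simp; norm_num
      · rw [← h, ENNReal.ofReal_zero, ENNReal.zero_rpow_of_neg hp', top_add]
        exact le_top
    · rcases b2.eq_or_lt with h | h2
      · rcases hp.eq_or_lt with rfl | hp'
        · simp; norm_num
        · rw [← h, ENNReal.ofReal_zero, ENNReal.zero_rpow_of_neg hp', add_top]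
          exact le_top
      · rw [ENNReal.ofReal_rpow_of_pos h1, ENNReal.ofReal_rpow_of_pos h2,
          ← ENNReal.ofReal_add (by positivity) (by positivity)]
        exact ENNReal.ofReal_le_ofReal
          (convexOn_symm_add_le (convexOn_rpow_of_nonpos hp) h1 h2 htc)
  · have hp0 : 0 ≤ p := by linarith
    rw [ENNReal.ofReal_rpow_of_nonneg b1 hp0, ENNReal.ofReal_rpow_of_nonneg b2 hp0,
      ← ENNReal.ofReal_add (by positivity) (by positivity)]
    exact ENNReal.ofReal_le_ofReal (convexOn_symm_add_le (convexOn_rpow hp) b1 b2 htc)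

/-- The cosine of the angle between two vectors. -/
def cosAngle {d : ℕ} (x y : E d) : ℝ := inner ℝ x y / (‖x‖ * ‖y‖)

theorem abs_cosAngle_le_one {d : ℕ} (x y : E d) : |cosAngle x y| ≤ 1 :=
  abs_real_inner_div_norm_mul_norm_le_one x y

theorem cosAngle_neg_right {d : ℕ} (x y : E d) : cosAngle x (-y) = -cosAngle x y := by
  simp [cosAngle, neg_div]

theorem measurable_cosAngle {d : ℕ} : Measurable fun q : E d × E d => cosAngle q.1 q.2 := by
  unfold cosAngle; fun_prop

/-- The average of `(1 - cos)^p` over the sphere of `ℝⁿ⁺¹`, as a quotient of two integrals over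
`ℝⁿ⁺¹`. -/
def sphereAverage (n : ℕ) (p : ℝ) : ℝ≥0∞ :=
  ENNReal.ofReal ((2 * Real.pi) ^ ((n : ℝ) / 2) * 2 ^ (p + n / 2) * Real.Gamma (p + n / 2)) /
    (2 * ballConst n * ENNReal.ofReal (Real.Gamma (p + n)))

variable {n : ℕ}

/-- With e = y/‖y‖, the product ‖x‖(1 − cos) is ‖x‖ − ⟨x, e⟩, so this is the parabolic integral,
whose value does not depend on y. -/
theorem lintegral_weight_mul_cosAngle (hn : 1 ≤ n) {p : ℝ} (hp : 0 < p + n / 2) {y : E (n + 1)}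
    (hy : y ≠ 0) :
    ∫⁻ x : E (n + 1), ENNReal.ofReal (‖x‖ ^ (p - 1) * Real.exp (-‖x‖)) *
        ENNReal.ofReal (1 - cosAngle x y) ^ p =
      ENNReal.ofReal ((2 * Real.pi) ^ ((n : ℝ) / 2) * 2 ^ (p + n / 2) *
        Real.Gamma (p + n / 2)) := by
  have hy0 : 0 < ‖y‖ := norm_pos_iff.2 hy
  have he : ‖(‖y‖⁻¹ • y)‖ = 1 := norm_smul_inv_norm hy
  rw [← lintegral_parabolic hn hp he]
  refine lintegral_congr_ae ?_
  filter_upwards [measure_eq_zero_iff_ae_notMem.1 (measure_singleton (0 : E (n + 1)))] with x hx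
  have hx0 : 0 < ‖x‖ := norm_pos_iff.2 hx
  have h1 : ‖x‖ - inner ℝ x (‖y‖⁻¹ • y) = ‖x‖ * (1 - cosAngle x y) := by
    rw [inner_smul_right, cosAngle]
    field_simp
  rw [h1, ENNReal.ofReal_mul hx0.le, ENNReal.mul_rpow_of_ne_top (by simp) (by simp),
    ENNReal.ofReal_rpow_of_pos hx0, mul_comm (_ * _) (ENNReal.ofReal (_ / _)), ← mul_assoc,
    ← ENNReal.ofReal_mul (by positivity), Real.rpow_sub_one hx0.ne']
  congr 2
  ring

/-- The function (1 − cos)^p of two vectors is integrated against an explicit rotation-invariant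
weight in z and against m in y. Invariance of m makes the y-integral independent of z; invariance of
the weight makes the z-integral independent of y. Comparing the two orders of integration gives the
average without a measure on the sphere. -/
theorem sphereAverage_spec (hn : 1 ≤ n) {p : ℝ} (hp : 0 < p + n / 2) {m : Measure (E (n + 1))}
    [SFinite m] (hm : ∀ A : E (n + 1) ≃ₗᵢ[ℝ] E (n + 1), MeasurePreserving A m m) (hm0 : m {0} = 0)
    {x : E (n + 1)} (hx : x ≠ 0) :
    ∫⁻ y, ENNReal.ofReal (1 - cosAngle x y) ^ p ∂m = sphereAverage n p * m Set.univ := by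
  have hp' : 0 < p + n := by
    have : (0 : ℝ) ≤ (n : ℝ) / 2 := by positivity
    linarith
  have hmc := measurable_cosAngle (d := n + 1)
  have hconst : ∀ z : E (n + 1), z ≠ 0 → ∫⁻ y, ENNReal.ofReal (1 - cosAngle z y) ^ p ∂m =
      ∫⁻ y, ENNReal.ofReal (1 - cosAngle x y) ^ p ∂m := by
    intro z hz
    obtain ⟨A, hA⟩ := exists_isometry_map (v := ‖x‖ • z) (w := ‖z‖ • x) (by
      rw [norm_smul, norm_smul, norm_norm, norm_norm, mul_comm])
    have hmx : Measurable fun y => ENNReal.ofReal (1 - cosAngle x y) ^ p := by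
      have := hmc.comp (measurable_prodMk_left (x := x))
      exact (measurable_const.sub this).ennreal_ofReal.pow_const p
    rw [← (hm A).lintegral_comp hmx]
    refine lintegral_congr fun y => ?_
    have hx0 : 0 < ‖x‖ := norm_pos_iff.2 hx
    have hz0 : 0 < ‖z‖ := norm_pos_iff.2 hz
    have h1 : A z = (‖z‖ / ‖x‖) • x := by
      rw [map_smul] at hA
      rw [div_eq_inv_mul, mul_smul, ← hA, smul_smul, inv_mul_cancel₀ hx0.ne', one_smul]
    have h2 : cosAngle z y = cosAngle x (A y) := by
      rw [cosAngle, cosAngle, ← A.inner_map_map, h1, A.norm_map, inner_smul_left]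
      simp only [conj_trivial]
      field_simp
    rw [h2]
  set J := ∫⁻ y, ENNReal.ofReal (1 - cosAngle x y) ^ p ∂m with hJ
  set D : ℝ≥0∞ := 2 * ballConst n * ENNReal.ofReal (Real.Gamma (p + n)) with hD
  have hD0 : D ≠ 0 := by
    rw [hD]
    have := ballConst_pos hn
    have := Real.Gamma_pos_of_pos hp'
    simp [*]
  have hDt : D ≠ ⊤ :=
    ENNReal.mul_ne_top (ENNReal.mul_ne_top (by simp) (ballConst_ne_top hn)) (by simp)
  set N : ℝ≥0∞ := ENNReal.ofReal ((2 * Real.pi) ^ ((n : ℝ) / 2) * 2 ^ (p + n / 2) *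
        Real.Gamma (p + n / 2)) with hN
  have h1 : D * J = N * m Set.univ := by
    calc D * J = ∫⁻ z : E (n + 1), ENNReal.ofReal (‖z‖ ^ (p - 1) * Real.exp (-‖z‖)) * J := by
          rw [lintegral_mul_const _ (by fun_prop), lintegral_norm_rpow_mul_exp hn hp']
      _ = ∫⁻ z : E (n + 1), ∫⁻ y, ENNReal.ofReal (‖z‖ ^ (p - 1) * Real.exp (-‖z‖)) *
            ENNReal.ofReal (1 - cosAngle z y) ^ p ∂m := by
          refine lintegral_congr_ae ?_
          filter_upwards [measure_eq_zero_iff_ae_notMem.1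
            (measure_singleton (0 : E (n + 1)))] with z hz
          rw [lintegral_const_mul' _ _ (by simp), hconst z hz]
      _ = ∫⁻ y, (∫⁻ z : E (n + 1), ENNReal.ofReal (‖z‖ ^ (p - 1) * Real.exp (-‖z‖)) *
            ENNReal.ofReal (1 - cosAngle z y) ^ p) ∂m := by
          have hm1 : Measurable fun q : E (n + 1) × E (n + 1) =>
              ENNReal.ofReal (‖q.1‖ ^ (p - 1) * Real.exp (-‖q.1‖)) := by fun_prop
          have hm2 : Measurable fun q : E (n + 1) × E (n + 1) =>
              ENNReal.ofReal (1 - cosAngle q.1 q.2) ^ p :=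
            (measurable_const.sub hmc).ennreal_ofReal.pow_const p
          exact lintegral_lintegral_swap (hm1.mul hm2).aemeasurable
      _ = ∫⁻ y, N ∂m := by
          refine lintegral_congr_ae ?_
          filter_upwards [measure_eq_zero_iff_ae_notMem.1 hm0] with y hy
          exact lintegral_weight_mul_cosAngle hn hp hy
      _ = N * m Set.univ := by rw [lintegral_const]
  change J = N / D * m Set.univ
  rw [ENNReal.div_eq_inv_mul, mul_assoc, ← h1, ← mul_assoc, ENNReal.inv_mul_cancel hD0 hDt, one_mul]

/-- The quotient of the inner product and the product of the weights. -/
def ratio {d : ℕ} (s : ℝ) (x y : E d) : ℝ :=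
  (2 * Real.pi) ^ 2 * inner ℝ x y / (weight s x * weight s y)

theorem lt_weight {d : ℕ} {s : ℝ} (hs : 0 < s) (ξ : E d) : 2 * Real.pi * ‖ξ‖ < weight s ξ := by
  refine Real.lt_sqrt_of_sq_lt ?_
  nlinarith [pow_pos hs 2]

/-- The ratio is the cosine times a factor in [0, 1), because s > 0 makes each weight exceed 2π
times the norm. -/
theorem abs_ratio {d : ℕ} {s : ℝ} (hs : 0 < s) (x y : E d) :
    |ratio s x y| < 1 ∧ |ratio s x y| ≤ |cosAngle x y| := by
  have hx := weight_pos hs x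
  have hy := weight_pos hs y
  have hx1 := lt_weight hs x
  have hy1 := lt_weight hs y
  have hpi := Real.pi_pos
  have h0 : (2 * Real.pi * ‖x‖) * (2 * Real.pi * ‖y‖) < weight s x * weight s y :=
    mul_lt_mul'' hx1 hy1 (by positivity) (by positivity)
  have h1 : ratio s x y = cosAngle x y *
      ((2 * Real.pi * ‖x‖) * (2 * Real.pi * ‖y‖) / (weight s x * weight s y)) := by
    rw [ratio, cosAngle]
    rcases eq_or_ne x 0 with rfl | hx'
    · simp
    rcases eq_or_ne y 0 with rfl | hy'
    · simp
    have : ‖x‖ ≠ 0 := norm_ne_zero_iff.2 hx'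
    have : ‖y‖ ≠ 0 := norm_ne_zero_iff.2 hy'
    field_simp
  have h2 : (2 * Real.pi * ‖x‖) * (2 * Real.pi * ‖y‖) / (weight s x * weight s y) < 1 :=
    (div_lt_one (by positivity)).2 h0
  have h3 : 0 ≤ (2 * Real.pi * ‖x‖) * (2 * Real.pi * ‖y‖) / (weight s x * weight s y) := by
    positivity
  have h4 := abs_cosAngle_le_one x y
  have h5 := abs_nonneg (cosAngle x y)
  rw [h1, abs_mul, abs_of_nonneg h3]
  constructor <;> nlinarith

theorem ratio_neg_right {d : ℕ} (s : ℝ) (x y : E d) : ratio s x (-y) = -ratio s x y := by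
  simp [ratio, weight_neg, neg_div]

theorem measurable_ratio {d : ℕ} (s : ℝ) : Measurable fun q : E d × E d => ratio s q.1 q.2 := by
  have hw := (continuous_weight (d := d) s).measurable
  unfold ratio; fun_prop

theorem two_mul_lintegral_one_sub {d : ℕ} {m : Measure (E d)}
    (hneg : MeasurePreserving (fun y : E d => -y) m m) (p : ℝ) {u : E d → ℝ} (hu : Measurable u)
    (hodd : ∀ y, u (-y) = -u y) :
    2 * ∫⁻ y, ENNReal.ofReal (1 - u y) ^ p ∂m =
      ∫⁻ y, (ENNReal.ofReal (1 - u y) ^ p + ENNReal.ofReal (1 + u y) ^ p) ∂m := by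
  have h1 : Measurable fun y => ENNReal.ofReal (1 - u y) ^ p :=
    (measurable_const.sub hu).ennreal_ofReal.pow_const p
  have h2 := hneg.lintegral_comp h1
  simp only [hodd, sub_neg_eq_add] at h2
  rw [lintegral_add_left h1, h2, two_mul]

/-- Symmetrization under `y ↦ -y`. -/
theorem lintegral_ratio_le {d : ℕ} {s p : ℝ} (hs : 0 < s) (hp : p ≤ 0 ∨ 1 ≤ p)
    {m : Measure (E d)} (hm : MeasurePreserving (fun y : E d => -y) m m) (x : E d) :
    ∫⁻ y, ENNReal.ofReal (1 - ratio s x y) ^ p ∂m ≤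
      ∫⁻ y, ENNReal.ofReal (1 - cosAngle x y) ^ p ∂m := by
  have h1 := two_mul_lintegral_one_sub hm p
    ((measurable_ratio s).comp (measurable_prodMk_left (x := x))) (ratio_neg_right s x)
  have h2 := two_mul_lintegral_one_sub hm p
    (measurable_cosAngle.comp (measurable_prodMk_left (x := x))) (cosAngle_neg_right x)
  have h3 : 2 * ∫⁻ y, ENNReal.ofReal (1 - ratio s x y) ^ p ∂m ≤
      2 * ∫⁻ y, ENNReal.ofReal (1 - cosAngle x y) ^ p ∂m := by
    refine h1.trans_le (le_trans ?_ h2.symm.le)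
    refine lintegral_mono fun y => ?_
    have h := abs_ratio hs x y
    exact ofReal_rpow_symm_le hp h.1 h.2 (abs_cosAngle_le_one x y)
  exact (ENNReal.mul_le_mul_iff_right (by simp) (by simp)).1 h3

end

/-! ### The pointwise bound for the kernel. -/

section

variable {n : ℕ}

/-- The value of `τ² - |ξ|² - (2s)²` at the sum of two points of the hyperboloid. -/
def excess {d : ℕ} (s : ℝ) (q : E d × E d) : ℝ :=
  2 * (weight s q.1 * weight s q.2 - (2 * Real.pi) ^ 2 * inner ℝ q.1 q.2 - s ^ 2)

/-- Cauchy–Schwarz for the plane vectors (s, 2π‖η₁‖) and (s, 2π‖η₂‖), then for the inner product of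
the frequencies. -/
theorem excess_nonneg {d : ℕ} {s : ℝ} (hs : 0 < s) (q : E d × E d) : 0 ≤ excess s q := by
  have h1 := weight_pos hs q.1
  have h2 := weight_pos hs q.2
  have h3 : s ^ 2 + (2 * Real.pi * ‖q.1‖) * (2 * Real.pi * ‖q.2‖) ≤
      weight s q.1 * weight s q.2 := by
    refine abs_le_of_sq_le_sq' ?_ (by positivity) |>.2
    rw [mul_pow, weight_sq, weight_sq]
    nlinarith [sq_nonneg (s * (2 * Real.pi * ‖q.1‖ - 2 * Real.pi * ‖q.2‖))]
  have h4 := real_inner_le_norm q.1 q.2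
  have h5 := mul_le_mul_of_nonneg_left h4 (sq_nonneg (2 * Real.pi))
  unfold excess
  nlinarith

theorem sumMap_sq_sub_sq {d : ℕ} (s : ℝ) (q : E d × E d) :
    (sumMap s q).1 ^ 2 - ‖(sumMap s q).2‖ ^ 2 = excess s q + 4 * s ^ 2 := by
  have h : ‖(sumMap s q).2‖ ^ 2 =
      (2 * Real.pi) ^ 2 * (‖q.1‖ ^ 2 + 2 * inner ℝ q.1 q.2 + ‖q.2‖ ^ 2) := by
    rw [← norm_add_sq_real]
    simp only [sumMap]
    rw [norm_smul, mul_pow, Real.norm_eq_abs, sq_abs]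
  rw [h, show (sumMap s q).1 = weight s q.1 + weight s q.2 from rfl, add_sq, weight_sq, weight_sq,
    excess]
  ring

/-- The shift 2s² cancels the term −s² in `excess`, and what remains factors through the two
weights. This is why the kernel is compared with a power of the excess plus 2s². -/
theorem excess_add {d : ℕ} {s : ℝ} (hs : 0 < s) (q : E d × E d) :
    excess s q + 2 * s ^ 2 = 2 * (weight s q.1 * weight s q.2 * (1 - ratio s q.1 q.2)) := by
  have h1 := (weight_pos hs q.1).ne'
  have h2 := (weight_pos hs q.2).ne'
  rw [excess, ratio]
  field_simp
  ring

/-- The constant in the bound for the kernel. -/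
def kernelConst (n : ℕ) : ℝ≥0∞ :=
  ENNReal.ofReal (((2 * Real.pi) ^ (n + 1) * (2 * Real.pi) ^ (n + 1))⁻¹ * (4 / 2 ^ n)) * ballConst n

theorem kernelConst_ne_top (hn : 1 ≤ n) : kernelConst n ≠ ⊤ :=
  ENNReal.mul_ne_top (by simp) (ballConst_ne_top hn)

theorem kernelConst_ne_zero (hn : 1 ≤ n) : kernelConst n ≠ 0 := by
  refine mul_ne_zero ?_ (ballConst_pos hn)
  have := Real.pi_pos
  rw [Ne, ENNReal.ofReal_eq_zero, not_le]
  positivity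

theorem bilinKernel_eq {s : ℝ} (hs : 0 < s) (β : ℝ) (q : E (n + 1) × E (n + 1)) :
    bilinKernel n s β q = ENNReal.ofReal ((excess s q ^ β) ^ 2) *
      (ENNReal.ofReal (((2 * Real.pi) ^ (n + 1) * (2 * Real.pi) ^ (n + 1))⁻¹) *
        (ENNReal.ofReal (4 / √(excess s q + 4 * s ^ 2) *
          ((√(excess s q) / 2) ^ n / √(excess s q))) * ballConst n)) *
      ENNReal.ofReal (weight s q.1 * weight s q.2) := by
  have h1 : 0 < (sumMap s q).1 := add_pos (weight_pos hs q.1) (weight_pos hs q.2)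
  have h2 := sumMap_sq_sub_sq s q
  have h3 := excess_nonneg hs q
  have h4 : (sumMap s q).1 ^ 2 - ‖(sumMap s q).2‖ ^ 2 - 4 * s ^ 2 = excess s q := by
    rw [h2]; ring
  have h5 : (sumMap s q).1 ^ 2 - ‖(sumMap s q).2‖ ^ 2 - (2 * s) ^ 2 = excess s q := by
    rw [h2]; ring
  rw [bilinKernel, sumDensity, if_pos h1, nullSymbol, h5, abs_of_nonneg h3, density, h4, h2]

/-- The division by √0 gives 0 by convention, whatever the value of 0 ^ β. -/
theorem bilinKernel_of_excess_eq_zero {s : ℝ} (hs : 0 < s) (β : ℝ) {q : E (n + 1) × E (n + 1)}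
    (hq : excess s q = 0) : bilinKernel n s β q = 0 := by
  rw [bilinKernel_eq hs, hq]
  simp

/-- The squared symbol contributes the power 2β of the excess and the density the power (n − 1)/2;
together they make p + 1/2, which is the origin of the exponent p. -/
theorem bilinKernel_of_excess_pos {s : ℝ} (hs : 0 < s) {β p : ℝ} (hp : p = 2 * β + n / 2 - 1)
    {q : E (n + 1) × E (n + 1)} (hq : 0 < excess s q) :
    bilinKernel n s β q = kernelConst n * ENNReal.ofReal (excess s q ^ (p + 1 / 2) /
      √(excess s q + 4 * s ^ 2) * (weight s q.1 * weight s q.2)) := by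
  rw [bilinKernel_eq hs, kernelConst]
  set A := excess s q
  have h1 := weight_pos hs q.1
  have h2 := weight_pos hs q.2
  have hA : 0 < A + 4 * s ^ 2 := by positivity
  have e1 : (√A) ^ n / √A = A ^ ((n : ℝ) / 2 - 1 / 2) := by
    rw [Real.sqrt_eq_rpow, ← Real.rpow_natCast, ← Real.rpow_mul hq.le, ← Real.rpow_sub hq]
    congr 1; ring
  have e2 : (A ^ β) ^ 2 = A ^ (2 * β) := by
    rw [← Real.rpow_natCast, ← Real.rpow_mul hq.le]; congr 1; push_cast; ring
  have e3 : A ^ (p + 1 / 2) = A ^ (2 * β) * A ^ ((n : ℝ) / 2 - 1 / 2) := by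
    rw [← Real.rpow_add hq, hp]; congr 1; ring
  have e4 : (A ^ β) ^ 2 * (((2 * Real.pi) ^ (n + 1) * (2 * Real.pi) ^ (n + 1))⁻¹ *
      (4 / √(A + 4 * s ^ 2) * ((√A / 2) ^ n / √A))) * (weight s q.1 * weight s q.2) =
      ((2 * Real.pi) ^ (n + 1) * (2 * Real.pi) ^ (n + 1))⁻¹ * (4 / 2 ^ n) *
      (A ^ (p + 1 / 2) / √(A + 4 * s ^ 2) * (weight s q.1 * weight s q.2)) := by
    rw [e3, ← e1, e2, div_pow]
    ring
  have hpi := Real.pi_pos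
  have e5 := congrArg ENNReal.ofReal e4
  rw [ENNReal.ofReal_mul (by positivity), ENNReal.ofReal_mul (by positivity),
    ENNReal.ofReal_mul (by positivity), ENNReal.ofReal_mul (p := _ * (4 / 2 ^ n)) (by positivity)]
    at e5
  calc _ = _ * ballConst n := by
        rw [← mul_assoc (ENNReal.ofReal _) (ENNReal.ofReal _) (ballConst n), ← mul_assoc,
          mul_right_comm]
    _ = _ := by rw [e5]; ring

/-- Replacing A by A + 2s² does not lower the numerator, as γ ≥ 0, while replacing A + 4s² by A +
2s² strictly lowers the denominator. For γ = p + 1/2 the sign condition is the lower bound on β; the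
strictness rules out extremizers. -/
theorem rpow_div_sqrt_lt {A s γ : ℝ} (hA : 0 < A) (hs : 0 < s) (hγ : 0 ≤ γ) :
    A ^ γ / √(A + 4 * s ^ 2) < (A + 2 * s ^ 2) ^ (γ - 1 / 2) := by
  have h1 : 0 < A + 2 * s ^ 2 := by positivity
  rw [Real.rpow_sub h1, ← Real.sqrt_eq_rpow]
  have h2 : A ^ γ ≤ (A + 2 * s ^ 2) ^ γ :=
    Real.rpow_le_rpow hA.le (by nlinarith [sq_nonneg s]) hγ
  have h3 : √(A + 2 * s ^ 2) < √(A + 4 * s ^ 2) :=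
    Real.sqrt_lt_sqrt h1.le (by nlinarith [pow_pos hs 2])
  have h4 : 0 < √(A + 2 * s ^ 2) := Real.sqrt_pos.2 h1
  exact (div_le_div_of_nonneg_right h2 (Real.sqrt_nonneg _)).trans_lt
    (div_lt_div_of_pos_left (Real.rpow_pos_of_pos h1 _) h4 h3)

/-- The bound for the kernel; it is strict. -/
theorem bilinKernel_lt (hn : 1 ≤ n) {s : ℝ} (hs : 0 < s) {β p : ℝ} (hp : p = 2 * β + n / 2 - 1)
    (hp0 : 0 ≤ p + 1 / 2) (q : E (n + 1) × E (n + 1)) :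
    bilinKernel n s β q < kernelConst n * ENNReal.ofReal (2 ^ p) *
      (ENNReal.ofReal (weight s q.1 ^ (p + 1)) * (ENNReal.ofReal (1 - ratio s q.1 q.2) ^ p *
        ENNReal.ofReal (weight s q.2 ^ (p + 1)))) := by
  have h1 := weight_pos hs q.1
  have h2 := weight_pos hs q.2
  have h3 : 0 < 1 - ratio s q.1 q.2 := by
    have := abs_lt.1 (abs_ratio hs q.1 q.2).1
    linarith
  have e : kernelConst n * ENNReal.ofReal (2 ^ p) *
      (ENNReal.ofReal (weight s q.1 ^ (p + 1)) * (ENNReal.ofReal (1 - ratio s q.1 q.2) ^ p *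
        ENNReal.ofReal (weight s q.2 ^ (p + 1)))) =
      kernelConst n * ENNReal.ofReal ((excess s q + 2 * s ^ 2) ^ p *
        (weight s q.1 * weight s q.2)) := by
    rw [ENNReal.ofReal_rpow_of_pos h3, mul_assoc, ← ENNReal.ofReal_mul (by positivity),
      ← ENNReal.ofReal_mul (by positivity), ← ENNReal.ofReal_mul (by positivity), excess_add hs,
      Real.mul_rpow (by positivity) (by positivity), Real.mul_rpow (by positivity) (by positivity),
      Real.mul_rpow (by positivity) (by positivity), Real.rpow_add_one h1.ne',
      Real.rpow_add_one h2.ne']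
    congr 2
    ring
  rw [e]
  have hA := excess_nonneg hs q
  have hpos : 0 < (excess s q + 2 * s ^ 2) ^ p * (weight s q.1 * weight s q.2) :=
    mul_pos (Real.rpow_pos_of_pos (by positivity) _) (mul_pos h1 h2)
  rcases hA.eq_or_lt with h | h
  · rw [bilinKernel_of_excess_eq_zero hs β h.symm]
    exact ENNReal.mul_pos (kernelConst_ne_zero hn) (ENNReal.ofReal_pos.2 hpos).ne'
  · rw [bilinKernel_of_excess_pos hs hp h]
    refine ENNReal.mul_lt_mul_right (kernelConst_ne_zero hn) (kernelConst_ne_top hn) ?_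
    refine (ENNReal.ofReal_lt_ofReal_iff hpos).2 ?_
    have := rpow_div_sqrt_lt h hs hp0
    rw [show p + 1 / 2 - 1 / 2 = p by ring] at this
    exact mul_lt_mul_of_pos_right this (mul_pos h1 h2)

/-- The density of the weighted `L²` norm. -/
def weightedSq {d : ℕ} (s p : ℝ) (F : L2 d) (x : E d) : ℝ≥0∞ :=
  ‖F x‖ₑ ^ 2 * ENNReal.ofReal (weight s x ^ (p + 1))

theorem aemeasurable_weightedSq {d : ℕ} (s p : ℝ) (F : L2 d) :
    AEMeasurable (weightedSq s p F) volume := by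
  have hw := (continuous_weight (d := d) s).measurable
  exact ((Lp.aestronglyMeasurable F).enorm.pow_const 2).mul
    (hw.pow_const (p + 1)).ennreal_ofReal.aemeasurable

theorem sobolevNorm_sq {d : ℕ} {s : ℝ} (hs : 0 < s) {α p : ℝ} (hα : 2 * α = p + 1) (f : L2 d) :
    sobolevNorm s α f ^ 2 = ∫⁻ x, weightedSq s p (𝓕 f) x := by
  rw [sobolevNorm, eLpNorm_two_sq]
  refine lintegral_congr fun x => ?_
  have h := weight_pos hs x
  change ‖((weight s x ^ α : ℝ) : ℂ) * _‖ₑ ^ 2 = _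
  rw [enorm_mul, enorm_ofReal_of_nonneg (by positivity), mul_pow, weightedSq,
    ← ENNReal.ofReal_pow (by positivity), mul_comm, ← hα, mul_comm 2 α, Real.rpow_mul h.le]
  norm_num

end

/-! ### The bilinear estimate for radial data. -/

section

variable {n : ℕ}

theorem measurePreserving_withDensity {d : ℕ} {b : E d → ℝ≥0∞} (A : E d ≃ₗᵢ[ℝ] E d)
    (hA : (fun x => b (A x)) =ᵐ[volume] b) :
    MeasurePreserving A (volume.withDensity b) (volume.withDensity b) := by
  refine ⟨A.continuous.measurable, Measure.ext fun S hS => ?_⟩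
  have hS' : MeasurableSet (A ⁻¹' S) := A.continuous.measurable hS
  rw [Measure.map_apply A.continuous.measurable hS, withDensity_apply _ hS,
    withDensity_apply _ hS', ← A.measurePreserving.setLIntegral_comp_preimage_emb
      A.toHomeomorph.measurableEmbedding b S]
  exact lintegral_congr_ae (ae_restrict_of_ae (hA.mono fun x hx => hx.symm))

theorem IsRadial.weightedSq {d : ℕ} {G : L2 d} (hG : IsRadial G) (s p : ℝ)
    (A : E d ≃ₗᵢ[ℝ] E d) :
    (fun x => weightedSq s p G (A x)) =ᵐ[volume] weightedSq s p G := by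
  filter_upwards [hG A] with x hx
  simp only [KleinGordon.weightedSq, weight, hx, A.norm_map]

/-- The integral over one of the two frequencies, for radial data. -/
theorem lintegral_ratio_mul_weightedSq_le (hn : 1 ≤ n) {s p : ℝ} (hs : 0 < s)
    (hp0 : 0 < p + n / 2) (hp : p ≤ 0 ∨ 1 ≤ p) {G : L2 (n + 1)} (hG : IsRadial G)
    {x : E (n + 1)} (hx : x ≠ 0) :
    ∫⁻ y, ENNReal.ofReal (1 - ratio s x y) ^ p * weightedSq s p G y ≤
      sphereAverage n p * ∫⁻ y, weightedSq s p G y := by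
  have hb := aemeasurable_weightedSq s p G
  have hA := fun A => measurePreserving_withDensity A (hG.weightedSq s p A)
  have hneg : MeasurePreserving (fun y : E (n + 1) => -y)
      (volume.withDensity (weightedSq s p G)) (volume.withDensity (weightedSq s p G)) := by
    have := hA (LinearIsometryEquiv.neg ℝ)
    rwa [LinearIsometryEquiv.coe_neg] at this
  have h0 : (volume.withDensity (weightedSq s p G)) {0} = 0 :=
    withDensity_absolutelyContinuous _ _ (measure_singleton 0)
  have h1 := lintegral_ratio_le hs hp hneg x
  rw [sphereAverage_spec hn hp0 hA h0 hx, withDensity_apply _ MeasurableSet.univ,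
    Measure.restrict_univ] at h1
  have hm : Measurable fun y => ENNReal.ofReal (1 - ratio s x y) ^ p :=
    (measurable_const.sub ((measurable_ratio s).comp
      (measurable_prodMk_left (x := x)))).ennreal_ofReal.pow_const p
  rw [lintegral_withDensity_eq_lintegral_mul₀ hb hm.aemeasurable] at h1
  refine le_trans (le_of_eq ?_) h1
  exact lintegral_congr fun y => mul_comm _ _

/-- Only 1 − r ≤ 2 is used. It serves for 0 < p < 1, where the convexity argument is not available.
-/
theorem lintegral_ratio_mul_weightedSq_le_of_nonneg {d : ℕ} {s p : ℝ} (hs : 0 < s) (hp : 0 ≤ p)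
    (G : L2 d) (x : E d) :
    ∫⁻ y, ENNReal.ofReal (1 - ratio s x y) ^ p * weightedSq s p G y ≤
      2 ^ p * ∫⁻ y, weightedSq s p G y := by
  rw [← lintegral_const_mul'' _ (aemeasurable_weightedSq s p G)]
  refine lintegral_mono fun y => ?_
  have h := abs_lt.1 (abs_ratio hs x y).1
  have h2 : ENNReal.ofReal (1 - ratio s x y) ≤ 2 :=
    (ENNReal.ofReal_le_ofReal (show 1 - ratio s x y ≤ 2 by linarith)).trans (by simp)
  exact mul_le_mul_left (ENNReal.rpow_le_rpow h2 hp) _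

/-- The majorant for the integrand of the bilinear estimate. -/
def majorant (n : ℕ) (s p : ℝ) (F G : L2 (n + 1)) (q : E (n + 1) × E (n + 1)) : ℝ≥0∞ :=
  kernelConst n * ENNReal.ofReal (2 ^ p) * (weightedSq s p F q.1 *
    (ENNReal.ofReal (1 - ratio s q.1 q.2) ^ p * weightedSq s p G q.2))

theorem aemeasurable_majorant (s p : ℝ) (F G : L2 (n + 1)) :
    AEMeasurable (majorant n s p F G) volume := by
  have h1 : AEMeasurable (fun q : E (n + 1) × E (n + 1) => weightedSq s p F q.1) volume :=
    (aemeasurable_weightedSq s p F).comp_fst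
  have h2 : AEMeasurable (fun q : E (n + 1) × E (n + 1) => weightedSq s p G q.2) volume :=
    (aemeasurable_weightedSq s p G).comp_snd
  have h3 : Measurable fun q : E (n + 1) × E (n + 1) =>
      ENNReal.ofReal (1 - ratio s q.1 q.2) ^ p :=
    (measurable_const.sub (measurable_ratio s)).ennreal_ofReal.pow_const p
  exact (h1.mul (h3.aemeasurable.mul h2)).const_mul _

/-- The factor R is left open so that the sharp spherical average and the crude bound share one
argument. -/
theorem lintegral_majorant_le (hn : 1 ≤ n) {s p : ℝ} {F G : L2 (n + 1)} {R : ℝ≥0∞}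
    (hR : ∀ x : E (n + 1), x ≠ 0 → ∫⁻ y, ENNReal.ofReal (1 - ratio s x y) ^ p *
      weightedSq s p G y ≤ R * ∫⁻ y, weightedSq s p G y) :
    ∫⁻ q, majorant n s p F G q ≤ kernelConst n * ENNReal.ofReal (2 ^ p) * R *
      ((∫⁻ x, weightedSq s p F x) * ∫⁻ y, weightedSq s p G y) := by
  have hK : kernelConst n * ENNReal.ofReal (2 ^ p) ≠ ⊤ :=
    ENNReal.mul_ne_top (kernelConst_ne_top hn) (by simp)
  have hF : ∀ x, weightedSq s p F x ≠ ⊤ := fun x => ENNReal.mul_ne_top (by simp) (by simp)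
  rw [Measure.volume_eq_prod, lintegral_prod _ (aemeasurable_majorant s p F G)]
  calc ∫⁻ x, ∫⁻ y, majorant n s p F G (x, y)
      = ∫⁻ x, kernelConst n * ENNReal.ofReal (2 ^ p) * (weightedSq s p F x *
          ∫⁻ y, ENNReal.ofReal (1 - ratio s x y) ^ p * weightedSq s p G y) := by
        refine lintegral_congr fun x => ?_
        simp only [majorant]
        rw [lintegral_const_mul' _ _ hK, lintegral_const_mul' _ _ (hF x)]
    _ ≤ ∫⁻ x, kernelConst n * ENNReal.ofReal (2 ^ p) * (weightedSq s p F x *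
          (R * ∫⁻ y, weightedSq s p G y)) := by
        refine lintegral_mono_ae ?_
        filter_upwards [measure_eq_zero_iff_ae_notMem.1
          (measure_singleton (0 : E (n + 1)))] with x hx
        gcongr
        exact hR x hx
    _ = _ := by
        rw [lintegral_const_mul' _ _ hK, lintegral_mul_const'' _ (aemeasurable_weightedSq s p F)]
        ring

theorem bilinKernel_mul_le_majorant (hn : 1 ≤ n) {s : ℝ} (hs : 0 < s) {β p : ℝ}
    (hp : p = 2 * β + n / 2 - 1) (hp0 : 0 ≤ p + 1 / 2) (F G : L2 (n + 1))
    (q : E (n + 1) × E (n + 1)) :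
    bilinKernel n s β q * (‖F q.1‖ₑ ^ 2 * ‖G q.2‖ₑ ^ 2) ≤ majorant n s p F G q := by
  refine (mul_le_mul_left (bilinKernel_lt hn hs hp hp0 q).le _).trans (le_of_eq ?_)
  rw [majorant, weightedSq, weightedSq]
  ring

theorem bilinKernel_mul_lt_majorant (hn : 1 ≤ n) {s : ℝ} (hs : 0 < s) {β p : ℝ}
    (hp : p = 2 * β + n / 2 - 1) (hp0 : 0 ≤ p + 1 / 2) {F G : L2 (n + 1)}
    {q : E (n + 1) × E (n + 1)} (hF : F q.1 ≠ 0) (hG : G q.2 ≠ 0) :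
    bilinKernel n s β q * (‖F q.1‖ₑ ^ 2 * ‖G q.2‖ₑ ^ 2) < majorant n s p F G q := by
  refine (ENNReal.mul_lt_mul_left ?_ (ENNReal.mul_ne_top (by simp) (by simp))
    (bilinKernel_lt hn hs hp hp0 q)).trans_eq ?_
  · simp [hF, hG]
  rw [majorant, weightedSq, weightedSq]
  ring

/-- The estimate, given a bound for the integral over one of the two frequencies. -/
theorem nullFormNorm_sq_le_of_bound (hn : 1 ≤ n) {s : ℝ} (hs : 0 < s) {α β p : ℝ}
    (hα : 2 * α = p + 1) (hp : p = 2 * β + n / 2 - 1) (hp0 : 0 ≤ p + 1 / 2) {f g : L2 (n + 1)}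
    {R : ℝ≥0∞} (hR : ∀ x : E (n + 1), x ≠ 0 → ∫⁻ y, ENNReal.ofReal (1 - ratio s x y) ^ p *
      weightedSq s p (𝓕 g) y ≤ R * ∫⁻ y, weightedSq s p (𝓕 g) y) :
    nullFormNorm s β f g ^ 2 ≤ ENNReal.ofReal ((2 * Real.pi) ^ (n + 2)) *
      (kernelConst n * ENNReal.ofReal (2 ^ p) * R *
        (sobolevNorm s α f ^ 2 * sobolevNorm s α g ^ 2)) := by
  refine (nullFormNorm_sq_le hn hs β f g).trans ?_
  rw [sobolevNorm_sq hs hα, sobolevNorm_sq hs hα]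
  gcongr
  exact (lintegral_mono (bilinKernel_mul_le_majorant hn hs hp hp0 _ _)).trans
    (lintegral_majorant_le hn hR)

/-- The estimate is strict for nonzero data. -/
theorem nullFormNorm_sq_lt_of_bound (hn : 1 ≤ n) {s : ℝ} (hs : 0 < s) {α β p : ℝ}
    (hα : 2 * α = p + 1) (hp : p = 2 * β + n / 2 - 1) (hp0 : 0 ≤ p + 1 / 2) {f g : L2 (n + 1)}
    {R : ℝ≥0∞} (hRt : R ≠ ⊤)
    (hR : ∀ x : E (n + 1), x ≠ 0 → ∫⁻ y, ENNReal.ofReal (1 - ratio s x y) ^ p *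
      weightedSq s p (𝓕 g) y ≤ R * ∫⁻ y, weightedSq s p (𝓕 g) y)
    (hf : f ≠ 0) (hg : g ≠ 0) (hfS : sobolevNorm s α f < ⊤) (hgS : sobolevNorm s α g < ⊤) :
    nullFormNorm s β f g ^ 2 < ENNReal.ofReal ((2 * Real.pi) ^ (n + 2)) *
      (kernelConst n * ENNReal.ofReal (2 ^ p) * R *
        (sobolevNorm s α f ^ 2 * sobolevNorm s α g ^ 2)) := by
  refine (nullFormNorm_sq_le hn hs β f g).trans_lt ?_
  have hpi := Real.pi_pos
  refine ENNReal.mul_lt_mul_right (ENNReal.ofReal_pos.2 (by positivity)).ne' (by simp) ?_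
  have hle := lintegral_majorant_le (F := 𝓕 f) hn hR
  rw [← sobolevNorm_sq hs hα, ← sobolevNorm_sq hs hα] at hle
  refine lt_of_lt_of_le ?_ hle
  have hfin : ∫⁻ q, majorant n s p (𝓕 f) (𝓕 g) q ≠ ⊤ :=
    ne_top_of_le_ne_top (ENNReal.mul_ne_top (ENNReal.mul_ne_top (ENNReal.mul_ne_top
      (kernelConst_ne_top hn) (by simp)) hRt) (ENNReal.mul_ne_top (by simp [hfS.ne])
      (by simp [hgS.ne]))) hle
  have hne : ∀ h : L2 (n + 1), h ≠ 0 →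
      (volume : Measure (E (n + 1))) {x | (𝓕 h : L2 (n + 1)) x ≠ 0} ≠ 0 := by
    intro h hh h0
    refine hh ?_
    have h1 : (𝓕 h : L2 (n + 1)) = 0 := by
      rw [Lp.eq_zero_iff_ae_eq_zero]
      exact ae_iff.2 h0
    have h2 := FourierTransform.fourierInv_fourier_eq (F := L2 (n + 1)) h
    rw [h1] at h2
    rw [← h2]
    exact FourierTransform.fourierInv_zero
  have hle' := bilinKernel_mul_le_majorant hn hs hp hp0 (𝓕 f) (𝓕 g)
  -- The pointwise bound is strict where both transforms are nonzero. This product set has positive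
  -- measure because the Fourier transform is injective, and finiteness of the integrals preserves
  -- the strict inequality.
  refine lintegral_strict_mono_of_ae_le_of_ae_lt_on (aemeasurable_majorant s p _ _)
    (ne_top_of_le_ne_top hfin (lintegral_mono hle')) (Filter.Eventually.of_forall hle')
    (s := {x | (𝓕 f : L2 (n + 1)) x ≠ 0} ×ˢ {x | (𝓕 g : L2 (n + 1)) x ≠ 0}) ?_
    (Filter.Eventually.of_forall fun q hq => bilinKernel_mul_lt_majorant hn hs hp hp0 hq.1 hq.2)
  rw [Measure.volume_eq_prod, Measure.prod_prod]
  exact mul_ne_zero (hne f hf) (hne g hg)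

end

/-! ### The value of the constant, the sharp estimate and the absence of extremizers. -/

section

variable {n : ℕ}

theorem Fpp_pos {β p : ℝ} (hp : p = 2 * β + n / 2 - 1) (hp0 : 0 < p + n / 2) :
    0 < Fpp β (n + 1) := by
  have hn : (0 : ℝ) ≤ n := Nat.cast_nonneg n
  have h1 : 0 < Real.Gamma (((n + 1 : ℕ) : ℝ) - 2 + 2 * β) :=
    Real.Gamma_pos_of_pos (by push_cast; linarith)
  have h2 : 0 < Real.Gamma ((3 * ((n + 1 : ℕ) : ℝ) - 5) / 2 + 2 * β) :=
    Real.Gamma_pos_of_pos (by push_cast; linarith)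
  have := Real.pi_pos
  unfold Fpp
  positivity

theorem Fpp_eq {β p : ℝ} (hp : p = 2 * β + n / 2 - 1) :
    (2 * Real.pi) ^ (n + 2) *
      (((2 * Real.pi) ^ (n + 1) * (2 * Real.pi) ^ (n + 1))⁻¹ * (4 / 2 ^ n) * 2 ^ p *
        ((2 * Real.pi) ^ ((n : ℝ) / 2) * 2 ^ (p + n / 2) * Real.Gamma (p + n / 2) /
          (2 * Real.Gamma (p + n)))) = Fpp β (n + 1) := by
  have e1 : ((n + 1 : ℕ) : ℝ) - 2 + 2 * β = p + n / 2 := by push_cast; linarith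
  have e2 : (3 * ((n + 1 : ℕ) : ℝ) - 5) / 2 + 2 * β = p + n := by push_cast; linarith
  have e3 : (-((n + 1 : ℕ) : ℝ) + 1) / 2 = n / 2 - n := by push_cast; ring
  have e4 : -1 + 4 * β = 2 - n + p + (p + n / 2) + (n / 2 - n) - 1 := by rw [hp]; ring
  have hpi := Real.pi_pos
  have e5 : (2 : ℝ) ^ (-1 + 4 * β) =
      4 / 2 ^ n * 2 ^ p * 2 ^ (p + n / 2) * (2 ^ ((n : ℝ) / 2) / 2 ^ n) / 2 := by
    rw [e4, Real.rpow_sub_one (by norm_num), Real.rpow_add (by norm_num),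
      Real.rpow_add (by norm_num), Real.rpow_add (by norm_num), Real.rpow_sub (by norm_num),
      Real.rpow_sub (by norm_num), Real.rpow_natCast, Real.rpow_two]
    norm_num
  have e6 : Real.pi ^ ((n : ℝ) / 2 - n) = Real.pi ^ ((n : ℝ) / 2) / Real.pi ^ n := by
    rw [Real.rpow_sub hpi, Real.rpow_natCast]
  rw [Fpp, e1, e2, e3, e5, e6, Real.mul_rpow (by norm_num) hpi.le]
  field_simp
  ring

/-- The value of the constant. -/
theorem const_eq (hn : 1 ≤ n) {β p : ℝ} (hp : p = 2 * β + n / 2 - 1) (hp0 : 0 < p + n / 2) :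
    ENNReal.ofReal ((2 * Real.pi) ^ (n + 2)) *
      (kernelConst n * ENNReal.ofReal (2 ^ p) * sphereAverage n p) =
      ENNReal.ofReal (Fpp β (n + 1)) := by
  have hpi := Real.pi_pos
  have hn0 : (0 : ℝ) ≤ n := Nat.cast_nonneg n
  have hG := Real.Gamma_pos_of_pos hp0
  have hG' : 0 < Real.Gamma (p + n) := Real.Gamma_pos_of_pos (by linarith)
  -- The ball integral in `kernelConst` cancels the one in the denominator of `sphereAverage`, so
  -- its value is never needed.
  have e : ballConst n * sphereAverage n p =
      ENNReal.ofReal ((2 * Real.pi) ^ ((n : ℝ) / 2) * 2 ^ (p + n / 2) * Real.Gamma (p + n / 2) /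
          (2 * Real.Gamma (p + n))) := by
    rw [sphereAverage, ENNReal.ofReal_div_of_pos (by positivity), ENNReal.ofReal_mul (p := 2)
      (by norm_num), ENNReal.ofReal_ofNat, mul_comm 2 (ballConst n), mul_assoc (ballConst n),
      ← mul_div_assoc]
    exact ENNReal.mul_div_mul_left _ _ (ballConst_pos hn) (ballConst_ne_top hn)
  calc _ = ENNReal.ofReal ((2 * Real.pi) ^ (n + 2)) *
      (ENNReal.ofReal (((2 * Real.pi) ^ (n + 1) * (2 * Real.pi) ^ (n + 1))⁻¹ * (4 / 2 ^ n)) *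
        ENNReal.ofReal (2 ^ p) * (ballConst n * sphereAverage n p)) := by
        rw [kernelConst]; ring
    _ = _ := by
        rw [e, ← ENNReal.ofReal_mul (by positivity), ← ENNReal.ofReal_mul (by positivity),
          ← ENNReal.ofReal_mul (by positivity), Fpp_eq hp]

theorem sphereAverage_ne_top (hn : 1 ≤ n) {p : ℝ} (hp0 : 0 < p + n / 2) :
    sphereAverage n p ≠ ⊤ := by
  have hn0 : (0 : ℝ) ≤ n := Nat.cast_nonneg n
  have hG' : 0 < Real.Gamma (p + n) := Real.Gamma_pos_of_pos (by linarith)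
  refine ENNReal.div_ne_top (by simp) ?_
  simp [ballConst_pos hn, hG']

/-- The estimate with the sharp constant. -/
theorem radialEstimate_Fpp (hn : 1 ≤ n) {s β p : ℝ} (hs : 0 < s) (hp : p = 2 * β + n / 2 - 1)
    (hp1 : 0 ≤ p + 1 / 2) (hp0 : 0 < p + n / 2) (hpp : p ≤ 0 ∨ 1 ≤ p) :
    RadialEstimate (n + 1) s β (Fpp β (n + 1) ^ (1 / 2 : ℝ)) := by
  intro f g hf hg
  have hα : 2 * ((((n + 1 : ℕ) : ℝ) - 1) / 4 + β) = p + 1 := by push_cast; linarith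
  have h := nullFormNorm_sq_le_of_bound hn hs hα hp hp1 (f := f) (g := g)
    (fun x hx => lintegral_ratio_mul_weightedSq_le hn hs hp0 hpp hg.1.fourier hx)
  rw [← mul_assoc, const_eq hn hp hp0, ← mul_pow] at h
  have hF := (Fpp_pos hp hp0).le
  rw [show ENNReal.ofReal (Fpp β (n + 1)) = ENNReal.ofReal (Fpp β (n + 1) ^ (1 / 2 : ℝ)) ^ 2 by
    rw [← ENNReal.ofReal_pow (by positivity), ← Real.sqrt_eq_rpow, Real.sq_sqrt hF], ← mul_pow] at h
  rw [mul_assoc]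
  exact (ENNReal.pow_le_pow_left_iff two_ne_zero).1 h

/-- There are no extremizers. -/
theorem nullFormNorm_ne (hn : 1 ≤ n) {s β p : ℝ} (hs : 0 < s) (hp : p = 2 * β + n / 2 - 1)
    (hp1 : 0 ≤ p + 1 / 2) (hp0 : 0 < p + n / 2) (hpp : p ≤ 0 ∨ 1 ≤ p) {f g : L2 (n + 1)}
    (hf0 : f ≠ 0) (hg0 : g ≠ 0) (hf : IsRadialDatum s β f) (hg : IsRadialDatum s β g) :
    nullFormNorm s β f g ≠ ENNReal.ofReal (Fpp β (n + 1) ^ (1 / 2 : ℝ)) *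
      sobolevNorm s ((((n + 1 : ℕ) : ℝ) - 1) / 4 + β) f *
      sobolevNorm s ((((n + 1 : ℕ) : ℝ) - 1) / 4 + β) g := by
  have hα : 2 * ((((n + 1 : ℕ) : ℝ) - 1) / 4 + β) = p + 1 := by push_cast; linarith
  have h := nullFormNorm_sq_lt_of_bound hn hs hα hp hp1 (sphereAverage_ne_top hn hp0)
    (fun x hx => lintegral_ratio_mul_weightedSq_le hn hs hp0 hpp hg.1.fourier hx) hf0 hg0 hf.2 hg.2
  rw [← mul_assoc, const_eq hn hp hp0, ← mul_pow] at h
  have hF := (Fpp_pos hp hp0).le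
  rw [show ENNReal.ofReal (Fpp β (n + 1)) = ENNReal.ofReal (Fpp β (n + 1) ^ (1 / 2 : ℝ)) ^ 2 by
    rw [← ENNReal.ofReal_pow (by positivity), ← Real.sqrt_eq_rpow, Real.sq_sqrt hF], ← mul_pow] at h
  intro he
  rw [mul_assoc] at he
  rw [he] at h
  exact h.ne rfl

/-- The estimate for all exponents, with a constant that does not depend on `s`. -/
theorem exists_radialEstimate (hn : 1 ≤ n) {β p : ℝ} (hp : p = 2 * β + n / 2 - 1)
    (hp1 : 0 ≤ p + 1 / 2) (hp0 : 0 < p + n / 2) :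
    ∃ C : ℝ, 0 < C ∧ ∀ s : ℝ, 0 < s → RadialEstimate (n + 1) s β C := by
  by_cases hpp : p ≤ 0 ∨ 1 ≤ p
  · exact ⟨_, Real.rpow_pos_of_pos (Fpp_pos hp hp0) _, fun s hs =>
      radialEstimate_Fpp hn hs hp hp1 hp0 hpp⟩
  push Not at hpp
  set K := ENNReal.ofReal ((2 * Real.pi) ^ (n + 2)) *
      (kernelConst n * ENNReal.ofReal (2 ^ p) * 2 ^ p) with hK
  have hKt : K ≠ ⊤ := ENNReal.mul_ne_top (by simp) (ENNReal.mul_ne_top (ENNReal.mul_ne_top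
    (kernelConst_ne_top hn) (by simp)) (ENNReal.rpow_ne_top_of_nonneg hpp.1.le (by simp)))
  -- The squared estimate holds with K, and K ≤ (K + 1)² avoids a square root.
  refine ⟨K.toReal + 1, by positivity, fun s hs f g hf hg => ?_⟩
  have hα : 2 * ((((n + 1 : ℕ) : ℝ) - 1) / 4 + β) = p + 1 := by push_cast; linarith
  have h := nullFormNorm_sq_le_of_bound hn hs hα hp hp1 (f := f) (g := g)
    (fun x _ => lintegral_ratio_mul_weightedSq_le_of_nonneg hs hpp.1.le _ x)
  rw [← mul_assoc, ← hK, ← mul_pow] at h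
  have h2 : K ≤ ENNReal.ofReal (K.toReal + 1) ^ 2 := by
    rw [← ENNReal.ofReal_pow (by positivity)]
    refine ENNReal.le_ofReal_iff_toReal_le hKt (by positivity) |>.2 ?_
    nlinarith [ENNReal.toReal_nonneg (a := K)]
  rw [mul_assoc]
  refine (ENNReal.pow_le_pow_left_iff two_ne_zero).1 (h.trans ?_)
  rw [mul_pow _ (_ * _)]
  gcongr

end

/-! ### The exponential family. -/

section

variable {n : ℕ}

theorem norm_le_phi {d : ℕ} (e : ℝ) (z : E d) : ‖z‖ ≤ phi e ‖z‖ :=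
  Real.le_sqrt_of_sq_le (by nlinarith [sq_nonneg e])

theorem phi_pos {e : ℝ} (he : 0 < e) (r : ℝ) : 0 < phi e r := by
  unfold phi; positivity

/-- The integral that gives the norm of the extremizing family. -/
def testMass (d : ℕ) (p e : ℝ) : ℝ≥0∞ :=
  ∫⁻ z : E d, ENNReal.ofReal (phi e ‖z‖ ^ (p - 1) * Real.exp (-phi e ‖z‖))

/-- The scale is chosen so that `testFun` squared decays like e^(−φ) in the new variable z. The
parameters a and s then enter the rescaled weight only through 2as, up to the factor 1/(2a). -/
theorem weight_smul {d : ℕ} {a s : ℝ} (ha : 0 < a) (z : E d) :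
    weight s ((4 * Real.pi * a)⁻¹ • z) = phi (2 * a * s) ‖z‖ / (2 * a) := by
  have hpi := Real.pi_pos
  rw [weight, phi, phi, norm_smul, Real.norm_of_nonneg (by positivity),
    eq_div_iff (by positivity), ← Real.sqrt_sq (show 0 ≤ 2 * a by positivity), ← Real.sqrt_mul
    (by positivity), Real.sqrt_sq (show 0 ≤ 2 * a by positivity)]
  congr 1
  field_simp
  ring

/-- The Fourier transform of the extremizing family. -/
def testFun {d : ℕ} (s a : ℝ) (x : E d) : ℝ := Real.exp (-(a * weight s x)) / weight s x

theorem testFun_pos {d : ℕ} {s : ℝ} (hs : 0 < s) (a : ℝ) (x : E d) : 0 < testFun s a x :=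
  div_pos (Real.exp_pos _) (weight_pos hs x)

theorem continuous_testFun {d : ℕ} {s : ℝ} (hs : 0 < s) (a : ℝ) :
    Continuous (testFun s a : E d → ℝ) := by
  have hw := continuous_weight (d := d) s
  exact (by fun_prop : Continuous fun x : E d => Real.exp (-(a * weight s x))).div hw
    fun x => (weight_pos hs x).ne'

theorem lintegral_testFun {s a p : ℝ} (hs : 0 < s) (ha : 0 < a) :
    ∫⁻ x : E (n + 1), ENNReal.ofReal (testFun s a x ^ 2) * ENNReal.ofReal (weight s x ^ (p + 1)) =
      ENNReal.ofReal ((4 * Real.pi * a)⁻¹ ^ (n + 1) * (2 * a) ^ (1 - p)) *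
        testMass (n + 1) p (2 * a * s) := by
  have hpi := Real.pi_pos
  rw [lintegral_comp_smul_E _ (show 0 < (4 * Real.pi * a)⁻¹ by positivity),
    ENNReal.ofReal_mul (by positivity), mul_assoc (ENNReal.ofReal _) (ENNReal.ofReal _)
      (testMass _ _ _), testMass]
  congr 1
  rw [← lintegral_const_mul' _ _ (by simp)]
  refine lintegral_congr fun z => ?_
  have hv := phi_pos (show 0 < 2 * a * s by positivity) ‖z‖
  rw [testFun, weight_smul ha, ← ENNReal.ofReal_mul (by positivity),
    ← ENNReal.ofReal_mul (by positivity)]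
  congr 1
  generalize phi (2 * a * s) ‖z‖ = v at *
  have e1 : Real.exp (-(a * (v / (2 * a)))) ^ 2 = Real.exp (-v) := by
    rw [← Real.exp_nat_mul]; congr 1; push_cast; field_simp
  have e2 : (v / (2 * a)) ^ (p + 1) = (v / (2 * a)) ^ (p - 1) * (v / (2 * a)) ^ 2 := by
    rw [← Real.rpow_two, ← Real.rpow_add (by positivity)]; congr 1; ring
  have e3 : (2 * a) ^ (1 - p) = ((2 * a) ^ (p - 1))⁻¹ := by
    rw [← Real.rpow_neg (by positivity)]; congr 1; ring
  rw [div_pow, e1, e2, e3, Real.div_rpow hv.le (by positivity)]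
  field_simp

theorem testMass_lt_top_one (hn : 1 ≤ n) (e : ℝ) : testMass (n + 1) 1 e < ⊤ := by
  have h := lintegral_norm_rpow_mul_exp hn (p := 1) (by positivity)
  refine lt_of_le_of_lt (b := ∫⁻ x : E (n + 1), ENNReal.ofReal (‖x‖ ^ ((1 : ℝ) - 1) *
    Real.exp (-‖x‖))) (lintegral_mono fun z => ENNReal.ofReal_le_ofReal ?_) ?_
  · simpa using norm_le_phi e z
  · rw [h]
    exact ENNReal.mul_lt_top (ENNReal.mul_lt_top (by simp) (ballConst_ne_top hn).lt_top) (by simp)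

/-- The weighted norm with p = 1 has an evidently finite mass, and the weight w² in it is at least
s². -/
theorem memLp_testFun (hn : 1 ≤ n) {s a : ℝ} (hs : 0 < s) (ha : 0 < a) :
    MemLp (fun x : E (n + 1) => (testFun s a x : ℂ)) 2 volume := by
  refine ⟨(Complex.continuous_ofReal.comp (continuous_testFun hs a)).aestronglyMeasurable, ?_⟩
  have h1 : eLpNorm (fun x : E (n + 1) => (testFun s a x : ℂ)) 2 volume ^ 2 < ⊤ := by
    rw [eLpNorm_two_sq]
    have h2 := lintegral_testFun (n := n) (p := 1) hs ha
    have h3 : ∫⁻ x : E (n + 1), ENNReal.ofReal (testFun s a x ^ 2) *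
        ENNReal.ofReal (weight s x ^ ((1 : ℝ) + 1)) < ⊤ := by
      rw [h2]; exact ENNReal.mul_lt_top (by simp) (testMass_lt_top_one hn _)
    refine lt_of_le_of_lt (b := ∫⁻ x : E (n + 1), ENNReal.ofReal (1 / s ^ 2) *
      (ENNReal.ofReal (testFun s a x ^ 2) * ENNReal.ofReal (weight s x ^ ((1 : ℝ) + 1))))
      (lintegral_mono fun x => ?_) ?_
    · have h4 := testFun_pos hs a x
      have h5 := le_weight s x
      have h6 : (1 : ℝ) ≤ 1 / s ^ 2 * weight s x ^ ((1 : ℝ) + 1) := by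
        rw [one_add_one_eq_two, Real.rpow_two, one_div, inv_mul_eq_div, one_le_div (by positivity)]
        gcongr
      rw [enorm_ofReal_of_nonneg h4.le, ← ENNReal.ofReal_pow h4.le,
        ← ENNReal.ofReal_mul (by positivity), ← ENNReal.ofReal_mul (by positivity)]
      refine ENNReal.ofReal_le_ofReal ?_
      nlinarith [pow_pos h4 2]
    · rw [lintegral_const_mul' _ _ (by simp)]
      exact ENNReal.mul_lt_top (by simp) h3
  exact (ENNReal.pow_lt_top_iff.1 h1).resolve_right two_ne_zero

/-- The extremizing family. -/
def testData (hn : 1 ≤ n) {s a : ℝ} (hs : 0 < s) (ha : 0 < a) : L2 (n + 1) :=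
  𝓕⁻ ((memLp_testFun hn hs ha).toLp _ : L2 (n + 1))

theorem fourier_testData (hn : 1 ≤ n) {s a : ℝ} (hs : 0 < s) (ha : 0 < a) :
    (𝓕 (testData hn hs ha) : L2 (n + 1)) = (memLp_testFun hn hs ha).toLp _ :=
  FourierTransform.fourier_fourierInv_eq _

theorem coeFn_fourier_testData (hn : 1 ≤ n) {s a : ℝ} (hs : 0 < s) (ha : 0 < a) :
    (𝓕 (testData hn hs ha) : L2 (n + 1)) =ᵐ[volume] fun x => (testFun s a x : ℂ) := by
  rw [fourier_testData]
  exact MemLp.coeFn_toLp _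

theorem isRadial_testData (hn : 1 ≤ n) {s a : ℝ} (hs : 0 < s) (ha : 0 < a) :
    IsRadial (testData hn hs ha) := by
  refine IsRadial.fourierInv fun A => ?_
  have h := MemLp.coeFn_toLp (memLp_testFun hn hs ha)
  refine (A.measurePreserving.quasiMeasurePreserving.ae_eq_comp h).trans (.trans ?_ h.symm)
  refine Filter.Eventually.of_forall fun x => ?_
  simp [testFun, weight]

theorem sobolevNorm_testData (hn : 1 ≤ n) {s a α p : ℝ} (hs : 0 < s) (ha : 0 < a)
    (hα : 2 * α = p + 1) :
    sobolevNorm s α (testData hn hs ha) ^ 2 =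
      ENNReal.ofReal ((4 * Real.pi * a)⁻¹ ^ (n + 1) * (2 * a) ^ (1 - p)) *
        testMass (n + 1) p (2 * a * s) := by
  rw [sobolevNorm_sq hs hα, ← lintegral_testFun hs ha]
  refine lintegral_congr_ae ?_
  filter_upwards [coeFn_fourier_testData hn hs ha] with x hx
  have h := testFun_pos hs a x
  rw [weightedSq, hx, enorm_ofReal_of_nonneg h.le, ENNReal.ofReal_pow h.le]

/-- The bilinear estimate is an equality for the extremizing family. -/
theorem nullFormNorm_testData (hn : 1 ≤ n) {s a : ℝ} (hs : 0 < s) (ha : 0 < a) (β : ℝ) :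
    nullFormNorm s β (testData hn hs ha) (testData hn hs ha) ^ 2 =
      ENNReal.ofReal ((2 * Real.pi) ^ (n + 2)) * ∫⁻ q : E (n + 1) × E (n + 1),
        bilinKernel n s β q * ENNReal.ofReal ((testFun s a q.1 * testFun s a q.2) ^ 2) := by
  have hmp := measurePreserving_sumMap hn s
  have hc : Continuous fun p : ℝ × E (n + 1) => (Real.exp (-(a * p.1)) : ℂ) := by fun_prop
  have hF := coeFn_fourier_testData hn hs ha
  -- The two transforms times both weights equal e^(−aτ), which is constant on the fibres of
  -- `sumMap` and hence its own average. No Cauchy–Schwarz inequality is needed.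
  rw [nullFormNorm_sq_eq (k := fun p => (Real.exp (-(a * p.1)) : ℂ)) hn s β
    hc.aestronglyMeasurable ?_ ?_]
  · congr 1
    have hm1 := measurable_nullSymbol (d := n + 1) s β
    have hm2 := measurable_sumDensity (n := n) s
    have hm3 : Measurable fun p : ℝ × E (n + 1) => ENNReal.ofReal (nullSymbol s β p ^ 2) *
        sumDensity n s p * ‖(Real.exp (-(a * p.1)) : ℂ)‖ₑ ^ 2 :=
      ((hm1.pow_const 2).ennreal_ofReal.mul hm2).mul (hc.measurable.enorm.pow_const 2)
    rw [← hmp.lintegral_comp hm3, lintegral_pairMeasure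
      (u := fun q => ENNReal.ofReal (nullSymbol s β (sumMap s q) ^ 2) * sumDensity n s (sumMap s q)
        * ‖(Real.exp (-(a * (sumMap s q).1)) : ℂ)‖ₑ ^ 2) s (hm3.comp hmp.measurable).aemeasurable]
    refine lintegral_congr fun q => ?_
    have h1 := weight_pos hs q.1
    have h2 := weight_pos hs q.2
    rw [bilinKernel, mul_assoc (_ * _), ← ENNReal.ofReal_mul (by positivity),
      enorm_ofReal_of_nonneg (Real.exp_pos _).le, ← ENNReal.ofReal_pow (Real.exp_pos _).le,
      mul_left_comm, ← ENNReal.ofReal_mul (by positivity)]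
    congr 2
    rw [testFun, testFun, show (sumMap s q).1 = weight s q.1 + weight s q.2 from rfl,
      show -(a * (weight s q.1 + weight s q.2)) = -(a * weight s q.1) + -(a * weight s q.2) by ring,
      Real.exp_add]
    field_simp
  · intro K hK
    have : IsFiniteMeasureOnCompacts (sumMeasure n s) :=
      ⟨fun K hK => sumMeasure_lt_top_of_isCompact hn hs hK⟩
    exact hc.continuousOn.integrableOn_compact hK
  · intro ψ hψ _
    rw [← hmp.map_eq, integral_map
      (f := fun p => ψ p * (Real.exp (-(a * p.1)) : ℂ)) hmp.measurable.aemeasurable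
      (hψ.mul hc).aestronglyMeasurable, integral_pairMeasure hs]
    refine integral_congr_ae ?_
    have h1 : ∀ᵐ q : E (n + 1) × E (n + 1), (𝓕 (testData hn hs ha) : L2 (n + 1)) q.1 =
        (testFun s a q.1 : ℂ) := Measure.quasiMeasurePreserving_fst.ae hF
    have h2 : ∀ᵐ q : E (n + 1) × E (n + 1), (𝓕 (testData hn hs ha) : L2 (n + 1)) q.2 =
        (testFun s a q.2 : ℂ) := Measure.quasiMeasurePreserving_snd.ae hF
    filter_upwards [h1, h2] with q h1 h2
    have b1 := (weight_pos hs q.1).ne'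
    have b2 := (weight_pos hs q.2).ne'
    rw [h1, h2, ← Complex.ofReal_mul, mul_left_comm, mul_comm (ψ _), ← Complex.ofReal_mul]
    congr 2
    rw [testFun, testFun, show (sumMap s q).1 = weight s q.1 + weight s q.2 from rfl,
      show -(a * (weight s q.1 + weight s q.2)) = -(a * weight s q.1) + -(a * weight s q.2) by ring,
      Real.exp_add]
    field_simp

end

/-! ### The rescaled family and its massless limit. -/

section

variable {n : ℕ}

theorem phi_zero {r : ℝ} (hr : 0 ≤ r) : phi 0 r = r := by
  rw [phi, zero_pow two_ne_zero, zero_add, Real.sqrt_sq hr]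

theorem continuous_phi_left (r : ℝ) : Continuous fun e => phi e r := by
  unfold phi; fun_prop

theorem phi_le_add {e r : ℝ} (he : 0 ≤ e) (hr : 0 ≤ r) : phi e r ≤ e + r :=
  Real.sqrt_le_iff.2 ⟨by positivity, by nlinarith [mul_nonneg he hr]⟩

/-- A majorant uniform in e ≤ 1 for either sign of p: negative powers are controlled by t^p because
φ ≥ t, the others by φ ≤ 2 max(1, t). -/
theorem phi_rpow_le {e t p : ℝ} (he : 0 ≤ e) (he1 : e ≤ 1) (ht : 0 < t) :
    phi e t ^ p ≤ (1 + 2 ^ p) * (1 + t ^ p) := by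
  have h1 : t ≤ phi e t := Real.le_sqrt_of_sq_le (by nlinarith [sq_nonneg e])
  have h2 : (0 : ℝ) ≤ 2 ^ p := by positivity
  have h3 : 0 ≤ t ^ p := by positivity
  rcases le_total p 0 with hp | hp
  · have := Real.rpow_le_rpow_of_nonpos ht h1 hp
    nlinarith
  · have h4 : phi e t ^ p ≤ (2 * max 1 t) ^ p := by
      refine Real.rpow_le_rpow (Real.sqrt_nonneg _) ?_ hp
      have := phi_le_add he ht.le
      linarith [le_max_left 1 t, le_max_right 1 t]
    have h5 : max 1 t ^ p ≤ 1 + t ^ p := by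
      rcases le_total 1 t with h | h
      · rw [max_eq_right h]; linarith
      · rw [max_eq_left h, Real.one_rpow]; linarith
    rw [Real.mul_rpow (by norm_num) (by positivity)] at h4
    nlinarith

theorem testMass_zero (hn : 1 ≤ n) {p : ℝ} (hp : 0 < p + n) :
    testMass (n + 1) p 0 = 2 * ballConst n * ENNReal.ofReal (Real.Gamma (p + n)) := by
  rw [← lintegral_norm_rpow_mul_exp hn hp, testMass]
  simp only [phi_zero (norm_nonneg _)]

theorem testMass_zero_ne_top (hn : 1 ≤ n) {p : ℝ} (hp : 0 < p + n) :
    testMass (n + 1) p 0 ≠ ⊤ := by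
  rw [testMass_zero hn hp]
  exact ENNReal.mul_ne_top (ENNReal.mul_ne_top (by simp) (ballConst_ne_top hn)) (by simp)

theorem testMass_zero_ne_zero (hn : 1 ≤ n) {p : ℝ} (hp : 0 < p + n) :
    testMass (n + 1) p 0 ≠ 0 := by
  rw [testMass_zero hn hp]
  simp [ballConst_pos hn, Real.Gamma_pos_of_pos hp]

theorem tendsto_testMass (hn : 1 ≤ n) {p : ℝ} (hp : 0 < p + n) {e : ℕ → ℝ}
    (he0 : ∀ k, 0 ≤ e k) (he1 : ∀ k, e k ≤ 1) (he : Filter.Tendsto e Filter.atTop (nhds 0)) :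
    Filter.Tendsto (fun k => testMass (n + 1) p (e k)) Filter.atTop
      (nhds (testMass (n + 1) p 0)) := by
  have h0 : ∀ᵐ z : E (n + 1), z ∉ ({0} : Set (E (n + 1))) :=
    measure_eq_zero_iff_ae_notMem.1 (measure_singleton 0)
  -- The majorant is a multiple of the massless integrands with exponents 1 and p, both of finite
  -- mass.
  refine tendsto_lintegral_of_dominated_convergence' (fun z : E (n + 1) =>
    ENNReal.ofReal (1 + 2 ^ (p - 1)) *
      (ENNReal.ofReal (‖z‖ ^ ((1 : ℝ) - 1) * Real.exp (-‖z‖)) +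
        ENNReal.ofReal (‖z‖ ^ (p - 1) * Real.exp (-‖z‖)))) ?_ ?_ ?_ ?_
  · intro k
    have : Measurable fun z : E (n + 1) => phi (e k) ‖z‖ := by unfold phi; fun_prop
    exact Measurable.aemeasurable (by fun_prop)
  · intro k
    filter_upwards [h0] with z hz
    have hz0 : 0 < ‖z‖ := norm_pos_iff.2 hz
    rw [← ENNReal.ofReal_add (by positivity) (by positivity), ← ENNReal.ofReal_mul (by positivity)]
    refine ENNReal.ofReal_le_ofReal ?_
    have h1 := phi_rpow_le (p := p - 1) (he0 k) (he1 k) hz0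
    have h2 : Real.exp (-phi (e k) ‖z‖) ≤ Real.exp (-‖z‖) :=
      Real.exp_le_exp.2 (neg_le_neg (norm_le_phi (e k) z))
    rw [sub_self, Real.rpow_zero, ← add_mul, ← mul_assoc]
    exact mul_le_mul h1 h2 (Real.exp_pos _).le (by positivity)
  · have h1 := lintegral_norm_rpow_mul_exp hn (p := 1) (by positivity)
    have h2 := lintegral_norm_rpow_mul_exp hn hp
    rw [lintegral_const_mul' _ _ (by simp), lintegral_add_left (by fun_prop), h1, h2]
    have := ballConst_ne_top hn
    finiteness
  · filter_upwards [h0] with z hz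
    have hz0 : ‖z‖ ≠ 0 := norm_ne_zero_iff.2 hz
    refine ENNReal.tendsto_ofReal ?_
    have h1 : Filter.Tendsto (fun k => phi (e k) ‖z‖) Filter.atTop (nhds (phi 0 ‖z‖)) :=
      ((continuous_phi_left ‖z‖).tendsto 0).comp he
    refine (h1.rpow_const (Or.inl ?_)).mul ((Real.continuous_exp.tendsto _).comp h1.neg)
    rwa [phi_zero (norm_nonneg _)]

/-- The rescaled value of `τ² - |ξ|² - (2s)²`. -/
def scaledExcess {d : ℕ} (e : ℝ) (q : E d × E d) : ℝ :=
  2 * (phi e ‖q.1‖ * phi e ‖q.2‖ - inner ℝ q.1 q.2 - e ^ 2)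

/-- The rescaled integrand for the extremizing family. -/
def scaledIntegrand {d : ℕ} (p e : ℝ) (q : E d × E d) : ℝ :=
  scaledExcess e q ^ (p + 1 / 2) / √(scaledExcess e q + 4 * e ^ 2) /
    (phi e ‖q.1‖ * phi e ‖q.2‖) * Real.exp (-(phi e ‖q.1‖ + phi e ‖q.2‖))

/-- The rescaled integrand, where the excess is positive. -/
def scaledIntegrandPos {d : ℕ} (p e : ℝ) (q : E d × E d) : ℝ≥0∞ :=
  if 0 < scaledExcess e q then ENNReal.ofReal (scaledIntegrand p e q) else 0

theorem measurable_scaledIntegrandPos {d : ℕ} (p e : ℝ) :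
    Measurable (scaledIntegrandPos p e : E d × E d → ℝ≥0∞) := by
  have h1 : Measurable (scaledExcess e : E d × E d → ℝ) := by
    unfold scaledExcess phi; fun_prop
  have h2 : Measurable (scaledIntegrand p e : E d × E d → ℝ) := by
    unfold scaledIntegrand phi; fun_prop
  exact Measurable.ite (measurableSet_lt measurable_const h1) h2.ennreal_ofReal measurable_const

theorem excess_smul {d : ℕ} {a s : ℝ} (ha : 0 < a) (q : E d × E d) :
    excess s ((4 * Real.pi * a)⁻¹ • q) = scaledExcess (2 * a * s) q / (2 * a) ^ 2 := by
  have hpi := Real.pi_pos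
  rw [excess, scaledExcess, Prod.smul_fst, Prod.smul_snd, weight_smul ha, weight_smul ha,
    inner_smul_left, inner_smul_right]
  simp only [conj_trivial]
  field_simp
  ring

/-- An inequality suffices, since only a lower bound of the bilinear integral is needed. It is
trivial where the scaled excess is not positive; elsewhere the proof gives equality. -/
theorem le_bilinKernel_smul {s a β p : ℝ} (hs : 0 < s) (ha : 0 < a) (hp : p = 2 * β + n / 2 - 1)
    (q : E (n + 1) × E (n + 1)) :
    kernelConst n * ENNReal.ofReal ((2 * a) ^ (1 - p) * (2 * a) ^ (1 - p)) *
        scaledIntegrandPos p (2 * a * s) q ≤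
      bilinKernel n s β ((4 * Real.pi * a)⁻¹ • q) *
        ENNReal.ofReal ((testFun s a ((4 * Real.pi * a)⁻¹ • q).1 *
          testFun s a ((4 * Real.pi * a)⁻¹ • q).2) ^ 2) := by
  rw [scaledIntegrandPos]
  split_ifs with h
  swap
  · simp
  have hpi := Real.pi_pos
  have hx : 0 < excess s ((4 * Real.pi * a)⁻¹ • q) := by
    rw [excess_smul ha]; positivity
  have hv1 := phi_pos (show 0 < 2 * a * s by positivity) ‖q.1‖
  have hv2 := phi_pos (show 0 < 2 * a * s by positivity) ‖q.2‖
  rw [bilinKernel_of_excess_pos hs hp hx, mul_assoc (kernelConst n),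
    mul_assoc (kernelConst n), ← ENNReal.ofReal_mul (by positivity),
    ← ENNReal.ofReal_mul (by
      rw [Prod.smul_fst, Prod.smul_snd, weight_smul ha, weight_smul ha]; positivity)]
  refine le_of_eq ?_
  congr 2
  rw [excess_smul ha, scaledIntegrand, Prod.smul_fst, Prod.smul_snd, testFun, testFun,
    weight_smul ha, weight_smul ha]
  generalize scaledExcess (2 * a * s) q = B at *
  generalize phi (2 * a * s) ‖q.1‖ = v at *
  generalize phi (2 * a * s) ‖q.2‖ = w at *
  have e1 : ∀ v : ℝ, Real.exp (-(a * (v / (2 * a)))) ^ 2 = Real.exp (-v) := fun v => by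
    rw [← Real.exp_nat_mul]; congr 1; push_cast; field_simp
  have e2 : √(B / (2 * a) ^ 2 + 4 * s ^ 2) = √(B + 4 * (2 * a * s) ^ 2) / (2 * a) := by
    rw [eq_div_iff (by positivity), ← Real.sqrt_sq (show 0 ≤ 2 * a by positivity), ← Real.sqrt_mul
      (by positivity), Real.sqrt_sq (show 0 ≤ 2 * a by positivity)]
    congr 1
    field_simp
  -- The exponents of 2a balance: −2(p + 1/2) = 2(1 − p) − 3.
  have e3 : (B / (2 * a) ^ 2) ^ (p + 1 / 2) =
      B ^ (p + 1 / 2) * ((2 * a) ^ (1 - p) * (2 * a) ^ (1 - p)) / (2 * a) ^ 3 := by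
    rw [Real.div_rpow h.le (by positivity), ← Real.rpow_natCast (2 * a) 2,
      ← Real.rpow_mul (by positivity), ← Real.rpow_add (by positivity), mul_div_assoc,
      ← Real.rpow_natCast (2 * a) 3, ← Real.rpow_sub (by positivity), div_eq_mul_inv,
      ← Real.rpow_neg (by positivity)]
    congr 2
    push_cast; ring
  have e4 : (Real.exp (-(a * (v / (2 * a)))) / (v / (2 * a)) *
      (Real.exp (-(a * (w / (2 * a)))) / (w / (2 * a)))) ^ 2 =
      Real.exp (-v) / (v / (2 * a)) ^ 2 * (Real.exp (-w) / (w / (2 * a)) ^ 2) := by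
    rw [mul_pow, div_pow (Real.exp _), e1, div_pow (Real.exp _), e1]
  rw [e2, e3, e4, neg_add, Real.exp_add]
  have : 0 < √(B + 4 * (2 * a * s) ^ 2) := Real.sqrt_pos.2 (by positivity)
  field_simp

end

/-! ### Optimality of the constant. -/

section

variable {n : ℕ}

theorem lintegral_comp_smul_prod {n : ℕ} {f : E n × E n → ℝ≥0∞} (hf : Measurable f) {r : ℝ}
    (hr : 0 < r) :
    ∫⁻ q, f q = ENNReal.ofReal (r ^ n * r ^ n) * ∫⁻ q : E n × E n, f (r • q) := by
  have hf' : Measurable fun q : E n × E n => f (r • q) := hf.comp (measurable_const_smul r)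
  rw [Measure.volume_eq_prod, lintegral_prod _ hf.aemeasurable, lintegral_prod _ hf'.aemeasurable,
    lintegral_comp_smul_E _ hr, ENNReal.ofReal_mul (by positivity), mul_assoc]
  congr 1
  rw [← lintegral_const_mul' _ _ (by simp)]
  refine lintegral_congr fun x => ?_
  rw [lintegral_comp_smul_E _ hr]
  rfl

/-- The estimate for the extremizing family, in rescaled form. -/
theorem lintegral_scaledIntegrandPos_le (hn : 1 ≤ n) {s e β p C : ℝ} (hs : 0 < s) (he : 0 < e)
    (hC : 0 ≤ C) (hp : p = 2 * β + n / 2 - 1) (hD : testMass (n + 1) p e < ⊤)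
    (h : RadialEstimate (n + 1) s β C) :
    ENNReal.ofReal ((2 * Real.pi) ^ (n + 2)) * (kernelConst n * ∫⁻ q : E (n + 1) × E (n + 1),
      scaledIntegrandPos p e q) ≤
      ENNReal.ofReal (C ^ 2) * (testMass (n + 1) p e * testMass (n + 1) p e) := by
  have hpi := Real.pi_pos
  -- For fixed s every e > 0 is reached by a = e/(2s), so one value of s suffices for the limit e →
  -- 0.
  obtain ⟨a, ha, rfl⟩ : ∃ a : ℝ, 0 < a ∧ e = 2 * a * s :=
    ⟨e / (2 * s), by positivity, by field_simp⟩
  have hα : 2 * ((((n + 1 : ℕ) : ℝ) - 1) / 4 + β) = p + 1 := by push_cast; linarith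
  have hS := sobolevNorm_testData hn hs ha hα
  have hfin : sobolevNorm s ((((n + 1 : ℕ) : ℝ) - 1) / 4 + β) (testData hn hs ha) < ⊤ := by
    have : sobolevNorm s ((((n + 1 : ℕ) : ℝ) - 1) / 4 + β) (testData hn hs ha) ^ 2 < ⊤ := by
      rw [hS]; exact ENNReal.mul_lt_top (by simp) hD
    exact (ENNReal.pow_lt_top_iff.1 this).resolve_right two_ne_zero
  have h1 := h _ _ ⟨isRadial_testData hn hs ha, hfin⟩ ⟨isRadial_testData hn hs ha, hfin⟩
  have h2 := pow_le_pow_left' h1 2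
  rw [mul_pow, mul_pow, nullFormNorm_testData, hS, ← ENNReal.ofReal_pow hC] at h2
  set r := (4 * Real.pi * a)⁻¹ with hr
  have hr0 : 0 < r := by positivity
  have hF := (continuous_testFun (d := n + 1) hs a).measurable
  rw [lintegral_comp_smul_prod (f := fun q => bilinKernel n s β q *
    ENNReal.ofReal ((testFun s a q.1 * testFun s a q.2) ^ 2))
    ((measurable_bilinKernel s β).mul (by fun_prop)) hr0] at h2
  set k := ENNReal.ofReal (r ^ (n + 1) * (2 * a) ^ (1 - p)) with hk
  have hk0 : k ≠ 0 := (ENNReal.ofReal_pos.2 (by positivity)).ne'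
  have hkt : k ≠ ⊤ := by simp [hk]
  -- Both sides scale by the same factor k², which is then cancelled.
  have h3 : k * k * (ENNReal.ofReal ((2 * Real.pi) ^ (n + 2)) *
      (kernelConst n * ∫⁻ q : E (n + 1) × E (n + 1), scaledIntegrandPos p (2 * a * s) q)) ≤
      k * k * (ENNReal.ofReal (C ^ 2) *
        (testMass (n + 1) p (2 * a * s) * testMass (n + 1) p (2 * a * s))) := by
    calc _ = ENNReal.ofReal ((2 * Real.pi) ^ (n + 2)) *
          (ENNReal.ofReal (r ^ (n + 1) * r ^ (n + 1)) * ∫⁻ q : E (n + 1) × E (n + 1),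
            kernelConst n * ENNReal.ofReal ((2 * a) ^ (1 - p) * (2 * a) ^ (1 - p)) *
              scaledIntegrandPos p (2 * a * s) q) := by
          rw [lintegral_const_mul' _ _ (ENNReal.mul_ne_top (kernelConst_ne_top hn) (by simp)), hk,
            ENNReal.ofReal_mul (by positivity), ENNReal.ofReal_mul (by positivity),
            ENNReal.ofReal_mul (by positivity)]
          ring
      _ ≤ _ := by
          refine le_trans ?_ (h2.trans_eq (by ring))
          exact mul_le_mul' le_rfl (mul_le_mul' le_rfl
            (lintegral_mono fun q => le_bilinKernel_smul hs ha hp q))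
  exact (ENNReal.mul_le_mul_iff_right (mul_ne_zero hk0 hk0) (ENNReal.mul_ne_top hkt hkt)).1 h3

theorem cosAngle_comm {d : ℕ} (x y : E d) : cosAngle x y = cosAngle y x := by
  rw [cosAngle, cosAngle, real_inner_comm, mul_comm]

/-- The integral with exponent −1/4 is finite, as n/2 > 1/4, while its integrand is infinite at
nonzero x where the cosine is 1. -/
theorem ae_cosAngle_lt_one (hn : 1 ≤ n) {y : E (n + 1)} (hy : y ≠ 0) :
    ∀ᵐ x : E (n + 1), cosAngle x y < 1 := by
  have hn' : (1 : ℝ) ≤ n := by exact_mod_cast hn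
  have h := lintegral_weight_mul_cosAngle hn (p := -(1 / 4)) (by linarith) hy
  have hm : Measurable fun x : E (n + 1) => cosAngle x y :=
    measurable_cosAngle.comp (measurable_prodMk_right (y := y))
  have h1 := ae_lt_top (f := fun x : E (n + 1) => ENNReal.ofReal (‖x‖ ^ (-(1 / 4 : ℝ) - 1) *
    Real.exp (-‖x‖)) * ENNReal.ofReal (1 - cosAngle x y) ^ (-(1 / 4 : ℝ)))
    (Measurable.mul (by fun_prop) ((measurable_const.sub hm).ennreal_ofReal.pow_const _))
    (μ := volume) (by rw [h]; simp)
  filter_upwards [h1, measure_eq_zero_iff_ae_notMem.1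
    (measure_singleton (0 : E (n + 1)))] with x hx hx0
  by_contra hc
  have hz : 0 < ‖x‖ := norm_pos_iff.2 hx0
  rw [ENNReal.ofReal_of_nonpos (p := 1 - cosAngle x y) (by linarith),
    ENNReal.zero_rpow_of_neg (by norm_num),
    ENNReal.mul_top (ENNReal.ofReal_pos.2 (by positivity)).ne'] at hx
  exact lt_irrefl _ hx

theorem ae_prod_cosAngle_lt_one (hn : 1 ≤ n) :
    ∀ᵐ q : E (n + 1) × E (n + 1), q.1 ≠ 0 ∧ q.2 ≠ 0 ∧ cosAngle q.1 q.2 < 1 := by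
  have h0 : ∀ᵐ z : E (n + 1), z ∉ ({0} : Set (E (n + 1))) :=
    measure_eq_zero_iff_ae_notMem.1 (measure_singleton 0)
  have h1 : ∀ᵐ q : E (n + 1) × E (n + 1), q.1 ∉ ({0} : Set (E (n + 1))) :=
    Measure.quasiMeasurePreserving_fst.ae h0
  have h2 : ∀ᵐ q : E (n + 1) × E (n + 1), q.2 ∉ ({0} : Set (E (n + 1))) :=
    Measure.quasiMeasurePreserving_snd.ae h0
  have h3 : ∀ᵐ q : E (n + 1) × E (n + 1), cosAngle q.1 q.2 < 1 := by
    rw [Measure.volume_eq_prod, Measure.ae_prod_iff_ae_ae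
      (measurableSet_lt measurable_cosAngle measurable_const)]
    filter_upwards [h0] with x hx
    simp only [cosAngle_comm x]
    exact ae_cosAngle_lt_one hn hx
  filter_upwards [h1, h2, h3] with q h1 h2 h3
  exact ⟨h1, h2, h3⟩

/-- The limit of the rescaled integrands. -/
def limitIntegrand {d : ℕ} (p : ℝ) (q : E d × E d) : ℝ≥0∞ :=
  ENNReal.ofReal (2 ^ p) * (ENNReal.ofReal (‖q.1‖ ^ (p - 1) * Real.exp (-‖q.1‖)) *
    (ENNReal.ofReal (‖q.2‖ ^ (p - 1) * Real.exp (-‖q.2‖)) *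
      ENNReal.ofReal (1 - cosAngle q.2 q.1) ^ p))

theorem lintegral_limitIntegrand (hn : 1 ≤ n) {p : ℝ} (hp0 : 0 < p + n / 2) :
    ∫⁻ q : E (n + 1) × E (n + 1), limitIntegrand p q =
      ENNReal.ofReal (2 ^ p) * sphereAverage n p *
        (testMass (n + 1) p 0 * testMass (n + 1) p 0) := by
  have hp' : 0 < p + n := by
    have : (0 : ℝ) ≤ (n : ℝ) / 2 := by positivity
    linarith
  have hmc : Measurable fun q : E (n + 1) × E (n + 1) =>
      ENNReal.ofReal (1 - cosAngle q.2 q.1) ^ p :=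
    (measurable_const.sub (measurable_cosAngle.comp measurable_swap)).ennreal_ofReal.pow_const p
  have hm : Measurable (limitIntegrand p : E (n + 1) × E (n + 1) → ℝ≥0∞) :=
    Measurable.const_mul (Measurable.mul (by fun_prop) (Measurable.mul (by fun_prop) hmc)) _
  have hT : testMass (n + 1) p 0 =
      ∫⁻ z : E (n + 1), ENNReal.ofReal (‖z‖ ^ (p - 1) * Real.exp (-‖z‖)) := by
    simp only [testMass, phi_zero (norm_nonneg _)]
  have hN : ENNReal.ofReal ((2 * Real.pi) ^ ((n : ℝ) / 2) * 2 ^ (p + n / 2) *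
      Real.Gamma (p + n / 2)) = sphereAverage n p * testMass (n + 1) p 0 := by
    rw [testMass_zero hn hp', sphereAverage, ENNReal.div_mul_cancel]
    · rw [← testMass_zero hn hp']; exact testMass_zero_ne_zero hn hp'
    · rw [← testMass_zero hn hp']; exact testMass_zero_ne_top hn hp'
  rw [Measure.volume_eq_prod, lintegral_prod _ hm.aemeasurable]
  calc ∫⁻ x : E (n + 1), ∫⁻ y : E (n + 1), limitIntegrand p (x, y)
      = ∫⁻ x : E (n + 1), ENNReal.ofReal (2 ^ p) * (ENNReal.ofReal (‖x‖ ^ (p - 1) *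
          Real.exp (-‖x‖)) * (sphereAverage n p * testMass (n + 1) p 0)) := by
        refine lintegral_congr_ae ?_
        filter_upwards [measure_eq_zero_iff_ae_notMem.1
          (measure_singleton (0 : E (n + 1)))] with x hx
        simp only [limitIntegrand]
        rw [lintegral_const_mul' _ _ (by simp), lintegral_const_mul' _ _ (by simp),
          lintegral_weight_mul_cosAngle hn hp0 hx, hN]
    _ = _ := by
        rw [lintegral_const_mul' _ _ (by simp), lintegral_mul_const _ (by fun_prop), ← hT]
        ring

/-- The limit 2‖q.1‖‖q.2‖(1 − cos) of the scaled excess is positive, so the positive branch is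
eventually taken and the powers are continuous there. The remaining pairs form a null set. -/
theorem tendsto_scaledIntegrandPos {d : ℕ} {p : ℝ} {e : ℕ → ℝ}
    (he : Filter.Tendsto e Filter.atTop (nhds 0)) {q : E d × E d} (h1 : q.1 ≠ 0) (h2 : q.2 ≠ 0)
    (hc : cosAngle q.1 q.2 < 1) :
    Filter.Tendsto (fun k => scaledIntegrandPos p (e k) q) Filter.atTop
      (nhds (limitIntegrand p q)) := by
  have hx : 0 < ‖q.1‖ := norm_pos_iff.2 h1
  have hy : 0 < ‖q.2‖ := norm_pos_iff.2 h2
  have ht : ∀ r : ℝ, 0 ≤ r → Filter.Tendsto (fun k => phi (e k) r) Filter.atTop (nhds r) := by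
    intro r hr
    have := ((continuous_phi_left r).tendsto 0).comp he
    rwa [phi_zero hr] at this
  have hv := ht _ hx.le
  have hw := ht _ hy.le
  have hin : inner ℝ q.1 q.2 = ‖q.1‖ * ‖q.2‖ * cosAngle q.1 q.2 := by
    rw [cosAngle]; field_simp
  set B : ℝ := 2 * (‖q.1‖ * ‖q.2‖ * (1 - cosAngle q.1 q.2)) with hB
  have hc' : 0 < 1 - cosAngle q.1 q.2 := by linarith
  have hB0 : 0 < B := by positivity
  have hBt : Filter.Tendsto (fun k => scaledExcess (e k) q) Filter.atTop (nhds B) := by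
    have h := (((hv.mul hw).sub_const (inner ℝ q.1 q.2)).sub (he.pow 2)).const_mul 2
    convert! h using 2
    rw [hin, hB]; ring
  have hI : Filter.Tendsto (fun k => scaledIntegrand p (e k) q) Filter.atTop
      (nhds (B ^ (p + 1 / 2) / √(B + 4 * 0 ^ 2) / (‖q.1‖ * ‖q.2‖) *
        Real.exp (-(‖q.1‖ + ‖q.2‖)))) := by
    refine Filter.Tendsto.mul (Filter.Tendsto.div (Filter.Tendsto.div
      (hBt.rpow_const (Or.inl hB0.ne')) ?_ ?_) (hv.mul hw) (by positivity)) ?_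
    · exact (Real.continuous_sqrt.tendsto _).comp (hBt.add ((he.pow 2).const_mul 4))
    · exact (Real.sqrt_pos.2 (by positivity)).ne'
    · exact (Real.continuous_exp.tendsto _).comp (hv.add hw).neg
  have hlim : limitIntegrand p q = ENNReal.ofReal (B ^ (p + 1 / 2) / √(B + 4 * 0 ^ 2) /
      (‖q.1‖ * ‖q.2‖) * Real.exp (-(‖q.1‖ + ‖q.2‖))) := by
    rw [limitIntegrand, cosAngle_comm, ENNReal.ofReal_rpow_of_pos hc',
      ← ENNReal.ofReal_mul (by positivity), ← ENNReal.ofReal_mul (by positivity),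
      ← ENNReal.ofReal_mul (by positivity)]
    congr 1
    have e1 : B ^ (p + 1 / 2) / √(B + 4 * 0 ^ 2) = B ^ p := by
      rw [zero_pow two_ne_zero, mul_zero, add_zero, Real.sqrt_eq_rpow, ← Real.rpow_sub hB0]
      congr 1; ring
    rw [e1, hB, Real.mul_rpow (by norm_num) (by positivity), Real.mul_rpow (by positivity) hc'.le,
      Real.mul_rpow hx.le hy.le, Real.rpow_sub_one hx.ne', Real.rpow_sub_one hy.ne', neg_add,
      Real.exp_add]
    field_simp
  rw [hlim]
  refine (ENNReal.tendsto_ofReal hI).congr' ?_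
  filter_upwards [hBt.eventually (lt_mem_nhds hB0)] with k hk
  rw [scaledIntegrandPos, if_pos hk]

/-- The constant is optimal. -/
theorem Fpp_le_of_radialEstimate (hn : 1 ≤ n) {s β p C : ℝ} (hs : 0 < s) (hC : 0 < C)
    (hp : p = 2 * β + n / 2 - 1) (hp0 : 0 < p + n / 2) (h : RadialEstimate (n + 1) s β C) :
    Fpp β (n + 1) ^ (1 / 2 : ℝ) ≤ C := by
  have hp' : 0 < p + n := by
    have : (0 : ℝ) ≤ (n : ℝ) / 2 := by positivity
    linarith
  set K := ENNReal.ofReal ((2 * Real.pi) ^ (n + 2)) * kernelConst n with hK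
  have hKt : K ≠ ⊤ := ENNReal.mul_ne_top (by simp) (kernelConst_ne_top hn)
  set D := testMass (n + 1) p with hD
  have hD0 := testMass_zero_ne_zero hn hp'
  have hDt := testMass_zero_ne_top hn hp'
  have he : Filter.Tendsto (fun k : ℕ => 1 / ((k : ℝ) + 1)) Filter.atTop (nhds 0) :=
    tendsto_one_div_add_atTop_nhds_zero_nat
  have hDlim := tendsto_testMass hn hp' (e := fun k : ℕ => 1 / ((k : ℝ) + 1))
    (fun k => by positivity) (fun k => by
      rw [div_le_one (by positivity)]; linarith [Nat.cast_nonneg (α := ℝ) k]) he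
  -- The masses converge to a finite limit, so the test data are eventually admissible in the
  -- estimate.
  have hle : ∀ᶠ k : ℕ in Filter.atTop, ∫⁻ q : E (n + 1) × E (n + 1),
      K * scaledIntegrandPos p (1 / ((k : ℝ) + 1)) q ≤
      ENNReal.ofReal (C ^ 2) * (D (1 / ((k : ℝ) + 1)) * D (1 / ((k : ℝ) + 1))) := by
    filter_upwards [hDlim.eventually (gt_mem_nhds hDt.lt_top)] with k hk
    rw [lintegral_const_mul' _ _ hKt, hK, mul_assoc]
    exact lintegral_scaledIntegrandPos_le hn hs (by positivity) hC.le hp hk h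
  have hR : Filter.Tendsto (fun k : ℕ => ENNReal.ofReal (C ^ 2) *
      (D (1 / ((k : ℝ) + 1)) * D (1 / ((k : ℝ) + 1)))) Filter.atTop
      (nhds (ENNReal.ofReal (C ^ 2) * (D 0 * D 0))) :=
    ENNReal.Tendsto.const_mul (ENNReal.Tendsto.mul hDlim (Or.inl hD0) hDlim (Or.inl hD0))
      (Or.inr (by simp))
  have hfatou := lintegral_liminf_le (u := Filter.atTop) (μ := volume)
    (f := fun (k : ℕ) (q : E (n + 1) × E (n + 1)) =>
      K * scaledIntegrandPos p (1 / ((k : ℝ) + 1)) q)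
    (fun k => (measurable_scaledIntegrandPos p _).const_mul K)
  have h1 : ∫⁻ q : E (n + 1) × E (n + 1), K * limitIntegrand p q ≤
      ENNReal.ofReal (C ^ 2) * (D 0 * D 0) := by
    calc _ = ∫⁻ q : E (n + 1) × E (n + 1), Filter.liminf (fun k : ℕ =>
          K * scaledIntegrandPos p (1 / ((k : ℝ) + 1)) q) Filter.atTop := by
          refine lintegral_congr_ae ?_
          filter_upwards [ae_prod_cosAngle_lt_one hn] with q hq
          exact (ENNReal.Tendsto.const_mul (tendsto_scaledIntegrandPos he hq.1 hq.2.1 hq.2.2)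
            (Or.inr hKt)).liminf_eq.symm
      _ ≤ _ := hfatou
      _ ≤ _ := Filter.liminf_le_liminf hle
      _ = _ := hR.liminf_eq
  rw [lintegral_const_mul' _ _ hKt, lintegral_limitIntegrand hn hp0, ← mul_assoc] at h1
  have h2 := (ENNReal.mul_le_mul_iff_left (mul_ne_zero hD0 hD0) (ENNReal.mul_ne_top hDt hDt)).1 h1
  rw [hK, mul_assoc, ← mul_assoc (kernelConst n), const_eq hn hp hp0] at h2
  have h3 := (ENNReal.ofReal_le_ofReal_iff (by positivity)).1 h2
  rw [← Real.sqrt_eq_rpow]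
  exact Real.sqrt_le_iff.2 ⟨hC.le, h3⟩

end

end KleinGordon

end

/-! ### The main theorem. -/

theorem mainTheorem7 (d : ℕ) (hd : 2 ≤ d) (β : ℝ) (hβ : (2 - (d : ℝ)) / 4 ≤ β)
    (hne : ¬ (d = 2 ∧ β = 0)) :
    (∃ C : ℝ, 0 < C ∧ ∀ s : ℝ, 0 < s → KleinGordon.RadialEstimate d s β C) ∧
    (β ∈ Set.Icc ((2 - (d : ℝ)) / 4) ((3 - (d : ℝ)) / 4) ∪ Set.Ici ((5 - (d : ℝ)) / 4) →
      ∀ s : ℝ, 0 < s →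
        IsLeast {C : ℝ | 0 < C ∧ KleinGordon.RadialEstimate d s β C}
          (KleinGordon.Fpp β d ^ (1 / 2 : ℝ)) ∧
        ¬ ∃ f g : KleinGordon.L2 d, f ≠ 0 ∧ g ≠ 0 ∧
          KleinGordon.IsRadialDatum s β f ∧ KleinGordon.IsRadialDatum s β g ∧
          KleinGordon.nullFormNorm s β f g =
            ENNReal.ofReal (KleinGordon.Fpp β d ^ (1 / 2 : ℝ)) *
              KleinGordon.sobolevNorm s (((d : ℝ) - 1) / 4 + β) f *
              KleinGordon.sobolevNorm s (((d : ℝ) - 1) / 4 + β) g) := by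
  obtain ⟨n, rfl⟩ : ∃ n, d = n + 1 := ⟨d - 1, by omega⟩
  have hn : 1 ≤ n := by omega
  have hn' : (1 : ℝ) ≤ n := by exact_mod_cast hn
  obtain ⟨p, hp⟩ : ∃ p : ℝ, p = 2 * β + n / 2 - 1 := ⟨_, rfl⟩
  push_cast at hβ
  have hp1 : 0 ≤ p + 1 / 2 := by linarith
  -- This is the positivity of d − 2 + 2β, the argument of the Gamma function in the numerator; it
  -- fails only for d = 2, β = 0.
  have hp0 : 0 < p + n / 2 := by
    rcases hn.eq_or_lt with h | h
    · have hβ0 : β ≠ 0 := fun h0 => hne ⟨by omega, h0⟩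
      have h1 : (n : ℝ) = 1 := by exact_mod_cast h.symm
      have : 0 < β := lt_of_le_of_ne (by linarith) hβ0.symm
      linarith
    · have h2 : (2 : ℝ) ≤ n := by exact_mod_cast h
      linarith
  refine ⟨KleinGordon.exists_radialEstimate hn hp hp1 hp0, fun hβ' s hs => ?_⟩
  -- Since p = 2β + (d − 3)/2, the two ranges of β give p ≤ 0 and p ≥ 1.
  have hpp : p ≤ 0 ∨ 1 ≤ p := by
    push_cast at hβ'
    rcases hβ' with h | h
    · exact Or.inl (by linarith [h.2])
    · exact Or.inr (by linarith [Set.mem_Ici.1 h])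
  refine ⟨⟨⟨Real.rpow_pos_of_pos (KleinGordon.Fpp_pos hp hp0) _,
    KleinGordon.radialEstimate_Fpp hn hs hp hp1 hp0 hpp⟩, fun C hC =>
    KleinGordon.Fpp_le_of_radialEstimate hn hs hC.1 hp hp0 hC.2⟩, ?_⟩
  rintro ⟨f, g, hf0, hg0, hf, hg, h⟩
  exact KleinGordon.nullFormNorm_ne hn hs hp hp1 hp0 hpp hf0 hg0 hf hg h
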